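/- Theorem 1.2. Let $N\ge 2$, $k\in\{0,\dots,N\}$, and let $$\Omega=\{x\in\mathbb R^N:\ x_{N-k+1}>0,\dots,x_N>0\}=\mathbb R^{N-k}\times(0,\infty)^k .$$ Put $\lambda_{N,k}=\left(\frac{N-2}{2}+k\right)^2$, let $\lambda\in(-\infty,\lambda_{N,k}]$, and put $$m_\lambda=\sqrt{\lambda_{N,k}-\lambda},\qquad \alpha_{k,\lambda}(x)=e^{-|x|^2/8}\,|x|^{m_\lambda-\frac{N-2}{2}}\,\frac{x_{N-k+1}\cdots x_N}{|x|^k},\qquad K(x)=e^{|x|^2/4}.$$ Functions are real-valued, $L^2=L^2(\Omega)$, and $L^2(K)$ is the space of all $u\in L^2$ with $\|u\|_{L^2(K)}^2=\int_\Omega |u|^2K\,dx<\infty$. Let $A_\lambda$ be the self-adjoint operator in $L^2$ associated with the closure of the quadratic form $a_\lambda[\varphi]=\int_\Omega\left(|\nabla\varphi|^2-\frac{\lambda}{|x|^2}|\varphi|^2\right)dx$, $\varphi\in C_c^\infty(\Omega\setminus\{0\})$; that is, $A_\lambda=-\Delta-\frac{\lambda}{|x|^2}$ on $\Omega$ with Dirichlet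 boundary conditions. For $u_0\in L^2$, a solution of $$\partial_t u=\Delta u+\frac{\lambda}{|x|^2}u \ \text{ in } (0,\infty)\times\Omega,\qquad u=0 \ \text{ on } (0,\infty)\times\partial\Omega,\qquad u(0)=u_0 \tag{1}$$ is a function $u\in C([0,\infty);L^2)\cap C((0,\infty);D(A_\lambda))\cap C^1((0,\infty);L^2)$ with $u'(t)+A_\lambda u(t)=0$ for $t>0$ and $u(0)=u_0$. Then $\alpha_{k,\lambda}\in L^2$, and for every $u_0\in L^2(K)$ problem (1) has exactly one solution $u$, and $$\|u(t)\|_{L^2}\le(1+t)^{-\frac{1+m_\lambda}{2}}\|u_0\|_{L^2(K)}\qquad\text{for all } t\ge0 .$$ This decay rate is optimal: $\frac{1+m_\lambda}{2}$ is the largest $\gamma\ge0$ for which there is a constant $C>0$ such that $\|u(t)\|_{L^2}\le C(1+t)^{-\gamma}\|u_0\|_{L^2(K)}$ for all $t\ge0$, all $u_0\in L^2(K)$ and the corresponding solution $u$. Moreover, for every $u_0\in L^2(K)$, $$\lim_{t\to\infty}t^{\frac{1+m_\lambda}{2}}\left\|u(t)-\beta\,t^{-(1+m_\lambda)}e^{-\frac{|x|^2}{4t}}e^{\frac{|x|^2}{8}}\alpha_{k,\lambda}\right\|_{L^2}=0,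 \qquad \beta=\|\alpha_{k,\lambda}\|_{L^2}^{-2}\int_\Omega u_0(x)\,e^{\frac{|x|^2}{8}}\alpha_{k,\lambda}(x)\,dx,$$ where the last integral converges absolutely. -/

import Mathlib

open MeasureTheory Filter Topology Set
open scoped ContDiff ENNReal

noncomputable section

namespace HardyHeat

/-- The Euclidean space of dimension `N`. -/
abbrev Euc (N : ℕ) : Type := EuclideanSpace ℝ (Fin N)

/-- The corner `ℝ^{N-k} × (0,∞)^k`: the last `k` coordinates are positive
(coordinates are numbered from `0` to `N-1`). -/
def corner (N k : ℕ) : Set (Euc N) :=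
  {x | ∀ i : Fin N, N ≤ (i : ℕ) + k → 0 < x i}

/-- Lebesgue measure on the corner. -/
abbrev cornerMeasure (N k : ℕ) : Measure (Euc N) := volume.restrict (corner N k)

/-- The real Hilbert space `L²` of the corner. -/
abbrev L2 (N k : ℕ) : Type := Lp ℝ 2 (cornerMeasure N k)

/-- The Hardy constant `λ_{N,k} = ((N-2)/2 + k)²`. -/
def hardyConst (N k : ℕ) : ℝ := (((N : ℝ) - 2) / 2 + (k : ℝ)) ^ 2

/-- `m_λ = √(λ_{N,k} - λ)`. -/
def mExp (N k : ℕ) (lam : ℝ) : ℝ := Real.sqrt (hardyConst N k - lam)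

/-- `α_{k,λ}(x) = e^{-|x|²/8} |x|^{m_λ-(N-2)/2} (x_{N-k+1} ⋯ x_N) / |x|^k`. -/
def alpha (N k : ℕ) (lam : ℝ) (x : Euc N) : ℝ :=
  Real.exp (-‖x‖ ^ 2 / 8) * ‖x‖ ^ (mExp N k lam - ((N : ℝ) - 2) / 2) *
    ((∏ i ∈ Finset.univ.filter (fun i : Fin N => N ≤ (i : ℕ) + k), x i) / ‖x‖ ^ k)

/-- The weight `K(x) = e^{|x|²/4}`. -/
def weightK {N : ℕ} (x : Euc N) : ℝ := Real.exp (‖x‖ ^ 2 / 4)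

/-- The weighted space `L²(K)`, as a subset of `L²`. -/
def L2K (N k : ℕ) : Set (L2 N k) :=
  {u | Integrable (fun x => |u x| ^ 2 * weightK x) (cornerMeasure N k)}

/-- The norm of `L²(K)`. -/
def normK {N k : ℕ} (u : L2 N k) : ℝ :=
  Real.sqrt (∫ x, |u x| ^ 2 * weightK x ∂(cornerMeasure N k))

/-- Real-valued smooth functions with compact support in the corner minus the origin.
The origin lies in the corner only for `k = 0`. In that case a point has zero capacity (`N ≥ 2`),
so removing it does not change the closure of the form `hardyForm` below whenever that form is
finite on all of `C_c^∞(ℝ^N)`; for `N = 2`, `k = 0`, `λ < 0` the form is infinite on test functions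
that do not vanish at the origin. -/
structure IsTest (N k : ℕ) (φ : Euc N → ℝ) : Prop where
  smooth : ContDiff ℝ ∞ φ
  compact : HasCompactSupport φ
  support : tsupport φ ⊆ corner N k \ {0}

/-- The symmetric bilinear form of `-Δ - λ/|x|²`,
`a_λ(φ, ψ) = ∫ (∇φ·∇ψ - λ φ ψ / |x|²) dx`, for test functions. -/
def hardyForm (N k : ℕ) (lam : ℝ) (φ ψ : Euc N → ℝ) : ℝ :=
  ∫ x, (inner ℝ (gradient φ x) (gradient ψ x) - lam / ‖x‖ ^ 2 * (φ x * ψ x))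
    ∂(cornerMeasure N k)

/-- The sequence `φ` of test functions is Cauchy for the form `a_λ` and converges to `u` in `L²`.
Those `u ∈ L²` that have such a sequence are the domain of the closure of `a_λ`. -/
structure FormApprox {N k : ℕ} (lam : ℝ) (φ : ℕ → Euc N → ℝ) (u : L2 N k) : Prop where
  test : ∀ n, IsTest N k (φ n)
  cauchy : Tendsto (fun p : ℕ × ℕ => hardyForm N k lam (φ p.1 - φ p.2) (φ p.1 - φ p.2))
    atTop (𝓝 0)
  tendsto : Tendsto (fun n => eLpNorm (fun x => φ n x - u x) 2 (cornerMeasure N k)) atTop (𝓝 0)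

/-- The graph of the self-adjoint operator `A_λ` in `L²` that is associated with the closure of
`a_λ`: `u ∈ D(A_λ)` and `A_λ u = f` mean that `u` is in the domain of the closed form and that
`a_λ(u, ψ) = (f, ψ)` for all `ψ` in the form core of test functions, where
`a_λ(u, ψ) = lim a_λ(φ_n, ψ)` along an approximating sequence of `u`. -/
def HardyOperator {N k : ℕ} (lam : ℝ) (u f : L2 N k) : Prop :=
  ∃ φ : ℕ → Euc N → ℝ, FormApprox lam φ u ∧
    ∀ ψ : Euc N → ℝ, IsTest N k ψ →
      Tendsto (fun n => hardyForm N k lam (φ n) ψ) atTop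
        (𝓝 (∫ x, f x * ψ x ∂(cornerMeasure N k)))

/-- `u` solves `∂_t u + A_λ u = 0`, `u(0) = u₀`, in the class
`C([0,∞); L²) ∩ C((0,∞); D(A_λ)) ∩ C¹((0,∞); L²)`. The Dirichlet boundary condition is contained
in the domain of `A_λ`, and continuity into `D(A_λ)` (with the graph norm) follows from the
continuity of `u` and of `deriv u = -A_λ u`. Values at negative times are irrelevant. -/
structure IsSolution {N k : ℕ} (lam : ℝ) (u₀ : L2 N k) (u : ℝ → L2 N k) : Prop where
  initial : u 0 = u₀
  continuous : ContinuousOn u (Ici 0)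
  differentiable : ∀ t : ℝ, 0 < t → DifferentiableAt ℝ u t
  continuous_deriv : ContinuousOn (deriv u) (Ioi 0)
  equation : ∀ t : ℝ, 0 < t → HardyOperator lam (u t) (-(deriv u t))

/-- `β = ‖α_{k,λ}‖_{L²}^{-2} ∫ u₀ e^{|x|²/8} α_{k,λ} dx`. -/
def beta {N k : ℕ} (lam : ℝ) (u₀ : L2 N k) : ℝ :=
  (∫ x, u₀ x * Real.exp (‖x‖ ^ 2 / 8) * alpha N k lam x ∂(cornerMeasure N k)) /
    ∫ x, alpha N k lam x ^ 2 ∂(cornerMeasure N k)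

/-- The profile `β t^{-(1+m_λ)} e^{-|x|²/(4t)} e^{|x|²/8} α_{k,λ}(x)`. -/
def profile {N k : ℕ} (lam : ℝ) (u₀ : L2 N k) (t : ℝ) (x : Euc N) : ℝ :=
  beta lam u₀ * t ^ (-(1 + mExp N k lam)) * Real.exp (-‖x‖ ^ 2 / (4 * t)) *
    Real.exp (‖x‖ ^ 2 / 8) * alpha N k lam x

/-- The exponents `γ ≥ 0` of polynomial decay: for some `C > 0`,
`‖u(t)‖_{L²} ≤ C (1+t)^{-γ} ‖u₀‖_{L²(K)}` for all `t ≥ 0`, all `u₀ ∈ L²(K)` and the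
solution `u` starting at `u₀`. -/
def decayExponents (N k : ℕ) (lam : ℝ) : Set ℝ :=
  {γ | 0 ≤ γ ∧ ∃ C : ℝ, 0 < C ∧ ∀ u₀ ∈ L2K N k, ∀ u : ℝ → L2 N k, IsSolution lam u₀ u →
    ∀ t : ℝ, 0 ≤ t → ‖u t‖ ≤ C * (1 + t) ^ (-γ) * normK u₀}

end HardyHeat

end

/-! Write m for m_λ. The function h(x) = |x|^{m-(N-2)/2-k} ∏ x_i, with the product over the
coordinates that are positive on the corner, is positive there, homogeneous of degree m-(N-2)/2, and
satisfies -Δh = λ|x|^{-2} h. With V = ∇ log h this gives a_λ(φ, ψ) = ∫ (∇φ - φV)·(∇ψ - ψV) for test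
functions (`hardyForm_eq`). Hence A_λ = S₀*S₀, where S₀ is the closure of φ ↦ ∇φ - φV. For such an
operator the resolvent (1 + S*S)⁻¹ is read off from the orthogonal projection onto the closed graph
(`relResolvent`), and the functional calculus of this resolvent gives exp(-tS*S)
(`isHeatSemigroup`). Existence and uniqueness of solutions follow.

In the variables s = log(1+t), y = x/√(1+t), and after multiplication by e^{|y|²/8}, the equation
becomes v_s + Lv + ((1+m)/2) v = 0. Here L = S*S is the same construction with V replaced by ∇ log α
= V - y/4; it is the Hardy operator with the potential |y|²/16 added and the ground energy (1+m)/2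
subtracted. So u(t) is the transform `simil`, at time s, of e^{-sL}(e^{|x|²/8} u₀)
(`IsSolution.eq_simil`). This is proved by checking that the right-hand side is a bounded weak
solution and that such solutions are unique (`eq_zero_of_weak_solution`). The transform has norm at
most e^{-s(1+m)/2}, e^{-sL} is a contraction, and e^{|x|²/8} u₀ has L² norm equal to the L²(K) norm
of u₀: this is the decay estimate, with constant 1.

The kernel of L is exactly ℝα. The function α belongs to it by a logarithmic cutoff
(`pair_alpha_mem`), and for v in the kernel the quotient v/α has zero gradient on a connected set
(`exists_eq_smul_of_pair_mem`). The datum e^{-|x|²/8} α therefore decays at exactly the claimed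
rate, which gives optimality. For general data e^{-sL} converges strongly to the projection onto ℝα,
which gives the asymptotics; neither a spectral gap nor compactness is used. -/

noncomputable section

namespace HardyHeat

set_option linter.unusedSectionVars false

/-! ### Complexification of a real Hilbert space and of its operators. -/

section Complexification

variable (H : Type*) [NormedAddCommGroup H] [InnerProductSpace ℝ H]

/-- The complexification of a real inner product space. -/
def Cplx : Type _ := WithLp 2 (H × H)

instance : NormedAddCommGroup (Cplx H) := inferInstanceAs (NormedAddCommGroup (WithLp 2 (H × H)))

instance [CompleteSpace H] : CompleteSpace (Cplx H) :=
  inferInstanceAs (CompleteSpace (WithLp 2 (H × H)))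

variable {H}

namespace Cplx

/-- The element `x + i y` of the complexification. -/
def mk (x y : H) : Cplx H := WithLp.toLp 2 (x, y)

/-- The real part. -/
def re (z : Cplx H) : H := (WithLp.ofLp z).1

/-- The imaginary part. -/
def im (z : Cplx H) : H := (WithLp.ofLp z).2

@[simp] lemma re_mk (x y : H) : re (mk x y) = x := rfl
@[simp] lemma im_mk (x y : H) : im (mk x y) = y := rfl
@[simp] lemma re_add (z w : Cplx H) : re (z + w) = re z + re w := rfl
@[simp] lemma im_add (z w : Cplx H) : im (z + w) = im z + im w := rfl

@[ext] lemma ext {z w : Cplx H} (h₁ : re z = re w) (h₂ : im z = im w) : z = w := by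
  have : WithLp.ofLp (p := 2) (V := H × H) z = WithLp.ofLp (p := 2) (V := H × H) w :=
    Prod.ext h₁ h₂
  exact WithLp.ofLp_injective 2 this

lemma norm_sq (z : Cplx H) : ‖z‖ ^ 2 = ‖re z‖ ^ 2 + ‖im z‖ ^ 2 :=
  WithLp.prod_norm_sq_eq_of_L2 (α := H) (β := H) z

instance : SMul ℂ (Cplx H) :=
  ⟨fun a z => mk (a.re • re z - a.im • im z) (a.re • im z + a.im • re z)⟩

@[simp] lemma re_smul (a : ℂ) (z : Cplx H) : re (a • z) = a.re • re z - a.im • im z := rfl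
@[simp] lemma im_smul (a : ℂ) (z : Cplx H) : im (a • z) = a.re • im z + a.im • re z := rfl

@[simp] lemma re_zero : re (0 : Cplx H) = 0 := rfl
@[simp] lemma im_zero : im (0 : Cplx H) = 0 := rfl

instance : Module ℂ (Cplx H) where
  one_smul z := by ext <;> simp
  mul_smul a b z := by ext <;> simp <;> module
  smul_zero a := by ext <;> simp
  smul_add a z w := by ext <;> simp <;> module
  add_smul a b z := by ext <;> simp <;> module
  zero_smul z := by ext <;> simp

lemma norm_smul_eq (a : ℂ) (z : Cplx H) : ‖a • z‖ = ‖a‖ * ‖z‖ := by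
  have h : ‖a • z‖ ^ 2 = (‖a‖ * ‖z‖) ^ 2 := by
    rw [mul_pow, norm_sq, norm_sq, re_smul, im_smul, norm_sub_sq_real, norm_add_sq_real,
      Complex.sq_norm, Complex.normSq_apply]
    simp only [norm_smul, mul_pow, inner_smul_left, inner_smul_right, Real.norm_eq_abs, sq_abs,
      real_inner_comm (re z) (im z)]
    simp
    ring
  exact (sq_eq_sq₀ (norm_nonneg _) (by positivity)).1 h

instance : InnerProductSpace ℂ (Cplx H) where
  norm_smul_le a z := (norm_smul_eq a z).le
  inner z w := ⟨inner ℝ (re z) (re w) + inner ℝ (im z) (im w),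
    inner ℝ (re z) (im w) - inner ℝ (im z) (re w)⟩
  norm_sq_eq_re_inner z := by simp [norm_sq]
  conj_inner_symm z w := by
    apply Complex.ext <;> simp [real_inner_comm]
  add_left z w v := by
    apply Complex.ext <;> simp [inner_add_left] <;> ring
  smul_left z w a := by
    apply Complex.ext <;>
      simp [inner_add_left, inner_sub_left, inner_smul_left] <;> ring

lemma inner_def (z w : Cplx H) : inner ℂ z w =
    ⟨inner ℝ (re z) (re w) + inner ℝ (im z) (im w),
    inner ℝ (re z) (im w) - inner ℝ (im z) (re w)⟩ := rfl

lemma norm_re_le (z : Cplx H) : ‖re z‖ ≤ ‖z‖ := by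
  have := norm_sq z
  nlinarith [norm_nonneg z, norm_nonneg (re z), sq_nonneg ‖im z‖]

lemma norm_mk_zero (x : H) : ‖mk x 0‖ = ‖x‖ := by
  have : ‖mk x 0‖ ^ 2 = ‖x‖ ^ 2 := by simp [norm_sq]
  exact (sq_eq_sq₀ (norm_nonneg _) (norm_nonneg _)).1 this

/-- The complex-linear extension of a real operator. -/
def extend (R : H →L[ℝ] H) : Cplx H →L[ℂ] Cplx H :=
  LinearMap.mkContinuous
    { toFun := fun z => mk (R (re z)) (R (im z))
      map_add' := fun z w => by ext <;> simp
      map_smul' := fun a z => by ext <;> simp }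
    ‖R‖ (fun z => by
      have h : ‖mk (R (re z)) (R (im z))‖ ^ 2 ≤ (‖R‖ * ‖z‖) ^ 2 := by
        rw [mul_pow, norm_sq, norm_sq, re_mk, im_mk, mul_add, ← mul_pow, ← mul_pow]
        gcongr <;> exact R.le_opNorm _
      exact (sq_le_sq₀ (norm_nonneg _) (by positivity)).1 h)

@[simp] lemma re_extend (R : H →L[ℝ] H) (z : Cplx H) : re (extend R z) = R (re z) := rfl
@[simp] lemma im_extend (R : H →L[ℝ] H) (z : Cplx H) : im (extend R z) = R (im z) := rfl

lemma extend_mk_zero (R : H →L[ℝ] H) (x : H) : extend R (mk x 0) = mk (R x) 0 := by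
  ext <;> simp

/-- The compression of a complex operator to the real part. -/
def compress (T : Cplx H →L[ℂ] Cplx H) : H →L[ℝ] H :=
  LinearMap.mkContinuous
    { toFun := fun x => re (T (mk x 0))
      map_add' := fun x y => by
        have : mk (x + y) 0 = mk x 0 + mk y 0 := by ext <;> simp
        rw [this, map_add, re_add]
      map_smul' := fun a x => by
        have h : mk (a • x) 0 = (a : ℂ) • mk x 0 := by
          ext
          · simp only [re_mk, re_smul, Complex.ofReal_re, Complex.ofReal_im, zero_smul, sub_zero]
          · simp only [im_mk, im_smul, Complex.ofReal_re, Complex.ofReal_im, zero_smul, smul_zero,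
              add_zero]
        rw [h, map_smul, re_smul, Complex.ofReal_re, Complex.ofReal_im, zero_smul, sub_zero,
          RingHom.id_apply] }
    ‖T‖ (fun x => by
      refine (norm_re_le _).trans ((T.le_opNorm _).trans ?_)
      rw [norm_mk_zero])

lemma compress_apply (T : Cplx H →L[ℂ] Cplx H) (x : H) : compress T x = re (T (mk x 0)) := rfl

lemma norm_compress_apply_le (T : Cplx H →L[ℂ] Cplx H) (x : H) :
    ‖compress T x‖ ≤ ‖T‖ * ‖x‖ := by
  refine (norm_re_le _).trans ((T.le_opNorm _).trans ?_)
  rw [norm_mk_zero]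

lemma compress_sub (S T : Cplx H →L[ℂ] Cplx H) : compress (S - T) = compress S - compress T := by
  ext x
  have h : ∀ z w : Cplx H, re (z - w) = re z - re w := fun z w => rfl
  simp [compress_apply, h]

lemma compress_extend_mul (R : H →L[ℝ] H) (T : Cplx H →L[ℂ] Cplx H) (x : H) :
    compress (extend R * T) x = R (compress T x) := by
  simp [compress_apply]

lemma compress_mul_extend (R : H →L[ℝ] H) (T : Cplx H →L[ℂ] Cplx H) (x : H) :
    compress (T * extend R) x = compress T (R x) := by
  simp [compress_apply, extend_mk_zero]

variable [CompleteSpace H]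

lemma isSelfAdjoint_extend {R : H →L[ℝ] H} (hR : ∀ x y, inner ℝ (R x) y = inner ℝ x (R y)) :
    IsSelfAdjoint (extend R) := by
  rw [ContinuousLinearMap.isSelfAdjoint_iff_isSymmetric]
  intro z w
  change inner ℂ (extend R z) w = inner ℂ z (extend R w)
  simp [inner_def, hR]

/-- The inequality ‖Rx‖² ≤ ⟨Rx, x⟩, valid for R = (1 + A)⁻¹ with A ≥ 0, says both R ≥ 0 and ‖R‖ ≤ 1.
-/
lemma spectrum_extend_subset {R : H →L[ℝ] H} (hR : ∀ x y, inner ℝ (R x) y = inner ℝ x (R y))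
    (hpos : ∀ x, ‖R x‖ ^ 2 ≤ inner ℝ (R x) x) :
    spectrum ℝ (extend R) ⊆ Icc 0 1 := by
  have hsa := isSelfAdjoint_extend hR
  have hn : 0 ≤ extend R := by
    rw [ContinuousLinearMap.nonneg_iff_isPositive, ContinuousLinearMap.isPositive_def]
    refine ⟨ContinuousLinearMap.isSelfAdjoint_iff_isSymmetric.1 hsa, fun z => ?_⟩
    have h1 := hpos (re z)
    have h2 := hpos (im z)
    have : (extend R).reApplyInnerSelf z = inner ℝ (R (re z)) (re z) + inner ℝ (R (im z)) (im z) := by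
      simp [ContinuousLinearMap.reApplyInnerSelf_apply, inner_def]
    rw [this]
    nlinarith [sq_nonneg ‖R (re z)‖, sq_nonneg ‖R (im z)‖]
  intro a ha
  refine ⟨spectrum_nonneg_of_nonneg hn ha, ?_⟩
  have hle : ‖extend R‖ ≤ 1 := by
    refine LinearMap.mkContinuous_norm_le _ (norm_nonneg _) _ |>.trans ?_
    refine ContinuousLinearMap.opNorm_le_bound _ zero_le_one fun x => ?_
    have h1 := hpos x
    have h2 := real_inner_le_norm (R x) x
    by_contra! h
    have h3 := norm_nonneg x
    nlinarith
  have := spectrum.norm_le_norm_mul_of_mem ha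
  have h1 : ‖(1 : Cplx H →L[ℂ] Cplx H)‖ ≤ 1 := ContinuousLinearMap.norm_id_le
  have h2 : a ≤ ‖a‖ := le_abs_self a
  nlinarith [norm_nonneg (extend R), norm_nonneg (1 : Cplx H →L[ℂ] Cplx H)]

end Cplx

end Complexification

/-! ### The scalar functions of the resolvent that define the semigroup. -/

section HeatFunction

/-- The function `x ↦ x⁻ⁿ exp (-t (1/x - 1))`, extended by zero to `x ≤ 0`. -/
def heatFun (n : ℕ) (t x : ℝ) : ℝ := Real.exp t * ((x⁻¹) ^ n * expNegInvGlue (x / t))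

/-- The point 0 may lie in the spectrum of the resolvent, so continuity there is essential for the
functional calculus. For positive x the factor `expNegInvGlue (x / t)` is e^{-t/x}, which beats
every power x⁻ⁿ. -/
lemma continuous_heatFun (n : ℕ) {t : ℝ} (ht : 0 < t) : Continuous (heatFun n t) := by
  have h := (expNegInvGlue.continuous_polynomial_eval_inv_mul (Polynomial.X ^ n)).comp
    (continuous_id.div_const t)
  have h2 : heatFun n t = fun x => Real.exp t * t⁻¹ ^ n *
      ((fun x => Polynomial.eval x⁻¹ (Polynomial.X ^ n) * expNegInvGlue x) ∘ fun x => id x / t) x := by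
    ext x
    simp only [heatFun, Function.comp, Polynomial.eval_pow, Polynomial.eval_X, id, inv_div, div_pow]
    have : t⁻¹ ^ n * t ^ n = 1 := by rw [← mul_pow, inv_mul_cancel₀ ht.ne', one_pow]
    rw [div_eq_mul_inv (t ^ n), ← inv_pow]
    linear_combination (-(Real.exp t * (x⁻¹ ^ n * expNegInvGlue (x / t)))) * this
  rw [h2]
  exact continuous_const.mul h

lemma heatFun_of_nonpos {n : ℕ} {t x : ℝ} (ht : 0 < t) (hx : x ≤ 0) : heatFun n t x = 0 := by
  rw [heatFun, expNegInvGlue.zero_of_nonpos (div_nonpos_of_nonpos_of_nonneg hx ht.le)]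
  simp

lemma heatFun_of_pos {n : ℕ} {t x : ℝ} (ht : 0 < t) (hx : 0 < x) :
    heatFun n t x = (x⁻¹) ^ n * Real.exp (-((x⁻¹ - 1) * t)) := by
  rw [heatFun, expNegInvGlue, if_neg (not_le.2 (div_pos hx ht)), mul_left_comm, ← Real.exp_add]
  congr 2
  rw [inv_div]
  ring

lemma abs_exp_sub_one_le (y : ℝ) : |Real.exp y - 1| ≤ |y| * Real.exp |y| := by
  rcases le_total 0 y with h | h
  · rw [abs_of_nonneg h, abs_of_nonneg (by linarith [Real.add_one_le_exp y])]
    have h1 := Real.add_one_le_exp (-y)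
    have h2 : Real.exp y * Real.exp (-y) = 1 := by rw [← Real.exp_add]; simp
    nlinarith [Real.exp_pos y]
  · rw [abs_of_nonpos h, abs_of_nonpos (by linarith [Real.exp_le_one_iff.2 h])]
    have h1 := Real.add_one_le_exp y
    have h2 := Real.one_le_exp (neg_nonneg.2 h)
    nlinarith

lemma abs_exp_sub_one_sub_le (y : ℝ) : |Real.exp y - 1 - y| ≤ y ^ 2 * Real.exp |y| := by
  have h0 := Real.add_one_le_exp y
  rw [abs_of_nonneg (by linarith)]
  have h1 := Real.add_one_le_exp (-y)
  have h2 : Real.exp y * Real.exp (-y) = 1 := by rw [← Real.exp_add]; simp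
  have h3 : Real.exp y - 1 - y ≤ y * (Real.exp y - 1) := by nlinarith [Real.exp_pos y]
  have h4 : y * (Real.exp y - 1) ≤ |y| * (|y| * Real.exp |y|) := by
    refine (le_abs_self _).trans ?_
    rw [abs_mul]
    exact mul_le_mul_of_nonneg_left (abs_exp_sub_one_le y) (abs_nonneg y)
  rw [← mul_assoc, ← pow_two, sq_abs] at h4
  linarith

/-- Half of the exponential absorbs a², uniformly in a ≥ 0; this uniformity later becomes an
operator norm bound. For |h| ≤ t/2 the exponent is at most -at/2, and y²/2 ≤ e^y with y = at/2
produces the constant 8/t². -/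
lemma sq_mul_exp_le {a t h : ℝ} (ha : 0 ≤ a) (ht : 0 < t) (hh : |h| ≤ t / 2) :
    a ^ 2 * (Real.exp (-(a * t)) * Real.exp |(-(a * h))|) ≤ 8 / t ^ 2 := by
  rw [abs_neg, abs_mul, abs_of_nonneg ha, ← Real.exp_add]
  have h1 : -(a * t) + a * |h| ≤ -(a * t / 2) := by nlinarith
  have h2 : Real.exp (-(a * t) + a * |h|) ≤ Real.exp (-(a * t / 2)) := Real.exp_le_exp.2 h1
  have h3 := Real.quadratic_le_exp_of_nonneg (x := a * t / 2) (by positivity)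
  have h4 : Real.exp (a * t / 2) * Real.exp (-(a * t / 2)) = 1 := by rw [← Real.exp_add]; simp
  have h5 : a ^ 2 * Real.exp (-(a * t / 2)) ≤ 8 / t ^ 2 := by
    rw [le_div_iff₀ (by positivity)]
    have h6 : a ^ 2 * t ^ 2 ≤ 8 * Real.exp (a * t / 2) := by nlinarith [mul_nonneg ha ht.le]
    have := mul_le_mul_of_nonneg_right h6 (Real.exp_pos (-(a * t / 2))).le
    nlinarith
  nlinarith [sq_nonneg a]

lemma exp_taylor_bound {a t h : ℝ} (ha : 0 ≤ a) (ht : 0 < t) (hh : |h| ≤ t / 2) :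
    |Real.exp (-(a * (t + h))) - Real.exp (-(a * t)) + h * (a * Real.exp (-(a * t)))| ≤
      8 / t ^ 2 * h ^ 2 := by
  have h1 : Real.exp (-(a * (t + h))) - Real.exp (-(a * t)) + h * (a * Real.exp (-(a * t))) =
      Real.exp (-(a * t)) * (Real.exp (-(a * h)) - 1 - -(a * h)) := by
    rw [mul_add, neg_add, Real.exp_add]; ring
  rw [h1, abs_mul, abs_of_pos (Real.exp_pos _)]
  have h2 := mul_le_mul_of_nonneg_left (abs_exp_sub_one_sub_le (-(a * h)))
    (Real.exp_pos (-(a * t))).le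
  have h3 := mul_le_mul_of_nonneg_right (sq_mul_exp_le ha ht hh) (sq_nonneg h)
  refine h2.trans (le_trans (le_of_eq ?_) h3)
  ring

lemma exp_lipschitz_bound {a t h : ℝ} (ha : 0 ≤ a) (ht : 0 < t) (hh : |h| ≤ t / 2) :
    |a * Real.exp (-(a * (t + h))) - a * Real.exp (-(a * t))| ≤ 8 / t ^ 2 * |h| := by
  have h1 : a * Real.exp (-(a * (t + h))) - a * Real.exp (-(a * t)) =
      a * Real.exp (-(a * t)) * (Real.exp (-(a * h)) - 1) := by
    rw [mul_add, neg_add, Real.exp_add]; ring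
  rw [h1, abs_mul, abs_of_nonneg (by positivity)]
  have h2 := mul_le_mul_of_nonneg_left (abs_exp_sub_one_le (-(a * h)))
    (show 0 ≤ a * Real.exp (-(a * t)) by positivity)
  have h3 := mul_le_mul_of_nonneg_right (sq_mul_exp_le ha ht hh) (abs_nonneg h)
  refine h2.trans (le_trans (le_of_eq ?_) h3)
  rw [abs_neg (a * h), abs_mul a h, abs_of_nonneg ha]
  ring

end HeatFunction

/-! ### The heat semigroup generated by a resolvent. -/

section Semigroup

variable {H : Type*} [NormedAddCommGroup H] [InnerProductSpace ℝ H]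

/-- `R` has the properties of the resolvent `(1 + A)⁻¹` of a nonnegative self-adjoint `A`. -/
structure IsResolvent (R : H →L[ℝ] H) : Prop where
  symm : ∀ x y, inner ℝ (R x) y = inner ℝ x (R y)
  sq_le : ∀ x, ‖R x‖ ^ 2 ≤ inner ℝ (R x) x
  inj : ∀ x, R x = 0 → x = 0

/-- `E t = exp (-t A)` and `D t = -A exp (-t A)`, where `R = (1 + A)⁻¹`. -/
structure IsHeatSemigroup (R : H →L[ℝ] H) (E D : ℝ → H →L[ℝ] H) : Prop where
  zero : E 0 = 1
  norm_le : ∀ t, 0 ≤ t → ∀ x, ‖E t x‖ ≤ ‖x‖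
  continuousOn : ∀ x, ContinuousOn (fun t => E t x) (Ici 0)
  hasDerivAt : ∀ t, 0 < t → ∀ x, HasDerivAt (fun t => E t x) (D t x) t
  continuousOn_deriv : ∀ x, ContinuousOn (fun t => D t x) (Ioi 0)
  resolvent_sub : ∀ t, 0 < t → ∀ x, R (E t x - D t x) = E t x
  commute : ∀ t, 0 ≤ t → ∀ x, R (E t x) = E t (R x)
  commute_deriv : ∀ t, 0 < t → ∀ x, D t (R x) = R (E t x) - E t x
  apply_eq_self : ∀ x, R x = x → ∀ t, 0 ≤ t → E t x = x
  tendsto_zero : ∀ x, (∀ y, R y = y → inner ℝ y x = 0) → Tendsto (fun t => E t x) atTop (𝓝 0)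

/-- Symmetric operators: the kernel and the range are orthogonal complements. -/
lemma mem_closure_range_of_symm [CompleteSpace H] {S : H →L[ℝ] H}
    (hS : ∀ x y, inner ℝ (S x) y = inner ℝ x (S y)) {x : H}
    (hx : ∀ y, S y = 0 → inner ℝ y x = 0) : x ∈ closure (range S) := by
  have h1 : x ∈ (LinearMap.range (S : H →ₗ[ℝ] H))ᗮᗮ := by
    rw [Submodule.mem_orthogonal]
    intro y hy
    apply hx
    rw [Submodule.mem_orthogonal] at hy
    -- For y orthogonal to the range, pairing with S(Sy) gives ‖Sy‖² = 0.
    have := hy (S (S y)) ⟨S y, rfl⟩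
    rw [hS, real_inner_self_eq_norm_sq] at this
    simpa using this
  rw [Submodule.orthogonal_orthogonal_eq_closure] at h1
  have h2 : x ∈ ((LinearMap.range (S : H →ₗ[ℝ] H)).topologicalClosure : Set H) := h1
  rw [Submodule.topologicalClosure_coe] at h2
  exact h2

variable [CompleteSpace H]

/-- The bounded operator `heatFun n t (R)`. -/
def heatOp (R : H →L[ℝ] H) (n : ℕ) (t : ℝ) : Cplx H →L[ℂ] Cplx H :=
  cfc (heatFun n t) (Cplx.extend R)

variable {R : H →L[ℝ] H}

lemma norm_cfc_extend_le (hR : IsResolvent R) {f : ℝ → ℝ} {c : ℝ} (hc : 0 ≤ c) (h0 : |f 0| ≤ c)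
    (h : ∀ x, 0 < x → x ≤ 1 → |f x| ≤ c) : ‖cfc f (Cplx.extend R)‖ ≤ c := by
  refine norm_cfc_le hc fun x hx => ?_
  have h1 := Cplx.spectrum_extend_subset hR.symm hR.sq_le hx
  rcases h1.1.eq_or_lt with h2 | h2
  · rw [← h2]; exact h0
  · exact h x h2 h1.2

/-- With A = R⁻¹ - 1, `heatOp R 0 t` is e^{-tA} and `heatOp R 1 t` is (1 + A)e^{-tA}; their
difference is the derivative -Ae^{-tA}. -/
lemma extend_mul_heatOp (hR : IsResolvent R) (n : ℕ) {t : ℝ} (ht : 0 < t) :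
    Cplx.extend R * heatOp R (n + 1) t = heatOp R n t := by
  have hsa := Cplx.isSelfAdjoint_extend hR.symm
  have hid := cfc_id' ℝ (Cplx.extend R)
  calc Cplx.extend R * heatOp R (n + 1) t
      = cfc (fun x : ℝ => x) (Cplx.extend R) * cfc (heatFun (n + 1) t) (Cplx.extend R) := by
        rw [hid, heatOp]
    _ = cfc (fun x : ℝ => x * heatFun (n + 1) t x) (Cplx.extend R) :=
        (cfc_mul (fun x => x) (heatFun (n + 1) t) (Cplx.extend R) continuousOn_id
          (continuous_heatFun _ ht).continuousOn).symm
    _ = _ := ?_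
  rw [heatOp]
  congr 1
  ext x
  rcases le_or_gt x 0 with hx | hx
  · simp [heatFun_of_nonpos ht hx]
  · rw [heatFun_of_pos ht hx, heatFun_of_pos ht hx, pow_succ]
    field_simp

lemma heatOp_mul_extend (hR : IsResolvent R) (n : ℕ) (t : ℝ) :
    heatOp R n t * Cplx.extend R = Cplx.extend R * heatOp R n t := by
  have hsa := Cplx.isSelfAdjoint_extend hR.symm
  have hid := cfc_id' ℝ (Cplx.extend R)
  have h := (cfc_commute_cfc (heatFun n t) (fun x => x) (Cplx.extend R)).eq
  rwa [hid] at h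

lemma norm_heatOp_le_one (hR : IsResolvent R) {t : ℝ} (ht : 0 < t) : ‖heatOp R 0 t‖ ≤ 1 := by
  refine norm_cfc_extend_le hR zero_le_one (by simp [heatFun_of_nonpos ht le_rfl])
    fun x hx hx1 => ?_
  have ha : 0 ≤ x⁻¹ - 1 := by linarith [(one_le_inv₀ hx).2 hx1]
  rw [heatFun_of_pos ht hx, pow_zero, one_mul, abs_of_pos (Real.exp_pos _), Real.exp_le_one_iff]
  nlinarith

/-- On the spectrum put a = x⁻¹ - 1 ≥ 0. Then `heatFun 0 t x - heatFun 1 t x` is -a e^{-at}, and the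
scalar Taylor bound does not depend on a. -/
lemma norm_heatOp_taylor (hR : IsResolvent R) {t h : ℝ} (ht : 0 < t) (hh : |h| ≤ t / 2) :
    ‖heatOp R 0 (t + h) - heatOp R 0 t - h • (heatOp R 0 t - heatOp R 1 t)‖ ≤
      8 / t ^ 2 * h ^ 2 := by
  have hsa := Cplx.isSelfAdjoint_extend hR.symm
  have hth : 0 < t + h := by linarith [neg_abs_le h]
  have c1 := (continuous_heatFun 0 hth).continuousOn (s := spectrum ℝ (Cplx.extend R))
  have c2 := (continuous_heatFun 0 ht).continuousOn (s := spectrum ℝ (Cplx.extend R))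
  have c3 := (continuous_heatFun 1 ht).continuousOn (s := spectrum ℝ (Cplx.extend R))
  rw [heatOp, heatOp, heatOp, ← cfc_sub _ _ _ c2 c3, ← cfc_smul h (fun x => heatFun 0 t x - heatFun 1 t x) _ (c2.sub c3),
    ← cfc_sub _ _ _ c1 c2, ← cfc_sub (fun x => heatFun 0 (t + h) x - heatFun 0 t x)
      (fun x => h • (heatFun 0 t x - heatFun 1 t x)) _ (c1.sub c2)
      ((c2.sub c3).const_smul h)]
  refine norm_cfc_extend_le hR (by positivity)
    (by simp [heatFun_of_nonpos ht le_rfl, heatFun_of_nonpos hth le_rfl]; positivity)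
    fun x hx hx1 => ?_
  have ha : 0 ≤ x⁻¹ - 1 := by linarith [(one_le_inv₀ hx).2 hx1]
  refine le_trans (le_of_eq ?_) (exp_taylor_bound ha ht hh)
  simp only [heatFun_of_pos ht hx, heatFun_of_pos hth hx, smul_eq_mul]
  congr 1
  ring

lemma norm_heatOp_lipschitz (hR : IsResolvent R) {t h : ℝ} (ht : 0 < t) (hh : |h| ≤ t / 2) :
    ‖heatOp R 0 (t + h) - heatOp R 1 (t + h) - (heatOp R 0 t - heatOp R 1 t)‖ ≤
      8 / t ^ 2 * |h| := by
  have hsa := Cplx.isSelfAdjoint_extend hR.symm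
  have hth : 0 < t + h := by linarith [neg_abs_le h]
  have c1 := (continuous_heatFun 0 hth).continuousOn (s := spectrum ℝ (Cplx.extend R))
  have c2 := (continuous_heatFun 0 ht).continuousOn (s := spectrum ℝ (Cplx.extend R))
  have c3 := (continuous_heatFun 1 ht).continuousOn (s := spectrum ℝ (Cplx.extend R))
  have c4 := (continuous_heatFun 1 hth).continuousOn (s := spectrum ℝ (Cplx.extend R))
  rw [heatOp, heatOp, heatOp, heatOp, ← cfc_sub _ _ _ c2 c3, ← cfc_sub _ _ _ c1 c4,
    ← cfc_sub (fun x => heatFun 0 (t + h) x - heatFun 1 (t + h) x)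
      (fun x => heatFun 0 t x - heatFun 1 t x) _ (c1.sub c4) (c2.sub c3)]
  refine norm_cfc_extend_le hR (by positivity)
    (by simp [heatFun_of_nonpos ht le_rfl, heatFun_of_nonpos hth le_rfl]; positivity)
    fun x hx hx1 => ?_
  have ha : 0 ≤ x⁻¹ - 1 := by linarith [(one_le_inv₀ hx).2 hx1]
  refine le_trans (le_of_eq ?_) (exp_lipschitz_bound ha ht hh)
  simp only [heatFun_of_pos ht hx, heatFun_of_pos hth hx]
  rw [← abs_neg]
  congr 1
  ring

/-- This is continuity at t = 0 on the range of R: with a = x⁻¹ - 1 one has x(1 - e^{-at}) ≤ x·a·t ≤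
t. -/
lemma norm_heatOp_mul_sub_le (hR : IsResolvent R) {t : ℝ} (ht : 0 < t) :
    ‖heatOp R 0 t * Cplx.extend R - Cplx.extend R‖ ≤ t := by
  have hsa := Cplx.isSelfAdjoint_extend hR.symm
  have hid := cfc_id' ℝ (Cplx.extend R)
  have c2 := (continuous_heatFun 0 ht).continuousOn (s := spectrum ℝ (Cplx.extend R))
  have c3 : ContinuousOn (fun x : ℝ => x) (spectrum ℝ (Cplx.extend R)) := continuousOn_id
  have h : heatOp R 0 t * Cplx.extend R - Cplx.extend R =
      cfc (fun x => heatFun 0 t x * x - x) (Cplx.extend R) := by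
    rw [cfc_sub (fun x => heatFun 0 t x * x) (fun x => x) _ (c2.mul c3) c3,
      cfc_mul (heatFun 0 t) (fun x => x) _ c2 c3, hid, heatOp]
  rw [h]
  refine norm_cfc_extend_le hR ht.le (by simp [ht.le]) fun x hx hx1 => ?_
  have ha : 0 ≤ x⁻¹ - 1 := by linarith [(one_le_inv₀ hx).2 hx1]
  rw [heatFun_of_pos ht hx, pow_zero, one_mul]
  have h1 := Real.add_one_le_exp (-((x⁻¹ - 1) * t))
  have h2 : Real.exp (-((x⁻¹ - 1) * t)) ≤ 1 := Real.exp_le_one_iff.2 (by nlinarith)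
  have h3 : x * x⁻¹ = 1 := mul_inv_cancel₀ hx.ne'
  rw [abs_le]
  constructor <;> nlinarith

/-- This is decay as t → ∞ on the range of 1 - R: with a = x⁻¹ - 1 one has 1 - x ≤ a, and a e^{-at}
≤ 1/t. -/
lemma norm_heatOp_mul_one_sub_le (hR : IsResolvent R) {t : ℝ} (ht : 0 < t) :
    ‖heatOp R 0 t * (1 - Cplx.extend R)‖ ≤ 1 / t := by
  have hsa := Cplx.isSelfAdjoint_extend hR.symm
  have hid := cfc_id' ℝ (Cplx.extend R)
  have c2 := (continuous_heatFun 0 ht).continuousOn (s := spectrum ℝ (Cplx.extend R))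
  have c3 : ContinuousOn (fun x : ℝ => x) (spectrum ℝ (Cplx.extend R)) := continuousOn_id
  have h : heatOp R 0 t * (1 - Cplx.extend R) =
      cfc (fun x => heatFun 0 t x - heatFun 0 t x * x) (Cplx.extend R) := by
    rw [cfc_sub (heatFun 0 t) (fun x => heatFun 0 t x * x) _ c2 (c2.mul c3),
      cfc_mul (heatFun 0 t) (fun x => x) _ c2 c3, hid, heatOp, mul_sub, mul_one]
  rw [h]
  refine norm_cfc_extend_le hR (by positivity)
    (by simp [heatFun_of_nonpos ht le_rfl, ht.le]) fun x hx hx1 => ?_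
  have ha : 0 ≤ x⁻¹ - 1 := by linarith [(one_le_inv₀ hx).2 hx1]
  rw [heatFun_of_pos ht hx, pow_zero, one_mul]
  have h1 := Real.add_one_le_exp ((x⁻¹ - 1) * t)
  have h2 : Real.exp ((x⁻¹ - 1) * t) * Real.exp (-((x⁻¹ - 1) * t)) = 1 := by
    rw [← Real.exp_add]; simp
  have h3 : x * x⁻¹ = 1 := mul_inv_cancel₀ hx.ne'
  have h4 := Real.exp_pos (-((x⁻¹ - 1) * t))
  set e := Real.exp (-((x⁻¹ - 1) * t))
  have h5 : 1 - x ≤ x⁻¹ - 1 := by nlinarith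
  have h6 : (x⁻¹ - 1) * t * e ≤ 1 := by nlinarith
  rw [abs_of_nonneg (by nlinarith), le_div_iff₀ ht]
  have : (1 - x) * (t * e) ≤ (x⁻¹ - 1) * (t * e) :=
    mul_le_mul_of_nonneg_right h5 (by positivity)
  nlinarith

/-- The operators `exp (-t A)`. -/
def heatE (R : H →L[ℝ] H) (t : ℝ) : H →L[ℝ] H :=
  -- The value at t = 0 has to be prescribed: `x / 0 = 0` makes `heatFun 0 0` vanish identically.
  if t ≤ 0 then 1 else Cplx.compress (heatOp R 0 t)

/-- The operators `-A exp (-t A)`. -/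
def heatD (R : H →L[ℝ] H) (t : ℝ) : H →L[ℝ] H :=
  Cplx.compress (heatOp R 0 t - heatOp R 1 t)

lemma heatE_of_pos {t : ℝ} (ht : 0 < t) : heatE R t = Cplx.compress (heatOp R 0 t) :=
  if_neg (not_le.2 ht)

lemma heatE_zero : heatE R 0 = 1 := if_pos le_rfl

lemma norm_heatE_apply_le (hR : IsResolvent R) {t : ℝ} (ht : 0 ≤ t) (x : H) :
    ‖heatE R t x‖ ≤ ‖x‖ := by
  rcases ht.eq_or_lt with rfl | ht
  · simp [heatE_zero]
  · rw [heatE_of_pos ht]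
    refine (Cplx.norm_compress_apply_le _ _).trans ?_
    simpa using mul_le_mul_of_nonneg_right (norm_heatOp_le_one hR ht) (norm_nonneg x)

lemma hasDerivAt_heatE (hR : IsResolvent R) {t : ℝ} (ht : 0 < t) (x : H) :
    HasDerivAt (fun t => heatE R t x) (heatD R t x) t := by
  rw [hasDerivAt_iff_isLittleO_nhds_zero]
  have hO : (fun h => heatE R (t + h) x - heatE R t x - h • heatD R t x) =O[𝓝 0]
      fun h : ℝ => h ^ 2 := by
    refine Asymptotics.IsBigO.of_bound (8 / t ^ 2 * ‖x‖) ?_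
    have : ∀ᶠ h : ℝ in 𝓝 0, |h| < t / 2 := by
      have := (continuous_abs : Continuous fun h : ℝ => |h|).tendsto 0
      rw [abs_zero] at this
      exact this.eventually_lt_const (by positivity)
    filter_upwards [this] with h hh
    have hth : 0 < t + h := by linarith [neg_abs_le h]
    rw [heatE_of_pos ht, heatE_of_pos hth, heatD]
    have h1 : Cplx.compress (heatOp R 0 (t + h)) x - Cplx.compress (heatOp R 0 t) x -
        h • Cplx.compress (heatOp R 0 t - heatOp R 1 t) x = Cplx.compress
        (heatOp R 0 (t + h) - heatOp R 0 t - h • (heatOp R 0 t - heatOp R 1 t)) x := by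
      have h2 : ∀ T : Cplx H →L[ℂ] Cplx H, Cplx.compress (h • T) = h • Cplx.compress T := by
        intro T
        ext y
        have : (h • T) = ((h : ℂ) • T) := (Complex.coe_smul h T).symm
        rw [this]
        simp only [Cplx.compress_apply, _root_.smul_apply, Cplx.re_smul,
          Complex.ofReal_re, Complex.ofReal_im, zero_smul, sub_zero]
      rw [Cplx.compress_sub (_ - _), Cplx.compress_sub (heatOp R 0 (t + h)), h2]
      rfl
    rw [h1, Real.norm_of_nonneg (sq_nonneg h)]
    refine (Cplx.norm_compress_apply_le _ _).trans ?_
    have := mul_le_mul_of_nonneg_right (norm_heatOp_taylor hR ht hh.le) (norm_nonneg x)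
    linarith
  refine hO.trans_isLittleO ?_
  simpa using (Asymptotics.isLittleO_pow_id (n := 2) (𝕜 := ℝ) one_lt_two)

lemma continuousOn_heatD (hR : IsResolvent R) (x : H) :
    ContinuousOn (fun t => heatD R t x) (Ioi 0) := by
  intro t ht
  have ht : 0 < t := ht
  refine ContinuousAt.continuousWithinAt ?_
  rw [ContinuousAt, tendsto_iff_norm_sub_tendsto_zero]
  have h1 : Tendsto (fun s : ℝ => 8 / t ^ 2 * |s - t| * ‖x‖) (𝓝 t) (𝓝 0) := by
    have : Continuous fun s : ℝ => 8 / t ^ 2 * |s - t| * ‖x‖ := by fun_prop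
    simpa using this.tendsto t
  refine squeeze_zero' (Eventually.of_forall fun _ => norm_nonneg _) ?_ h1
  have : ∀ᶠ s : ℝ in 𝓝 t, |s - t| < t / 2 := by
    have h2 : Continuous fun s : ℝ => |s - t| := by fun_prop
    have h3 := h2.tendsto t
    simp only [sub_self, abs_zero] at h3
    exact h3.eventually_lt_const (by positivity)
  filter_upwards [this] with s hs
  have h2 := norm_heatOp_lipschitz hR ht hs.le
  rw [add_sub_cancel] at h2
  rw [← _root_.sub_apply, heatD, heatD, ← Cplx.compress_sub]
  exact (Cplx.norm_compress_apply_le _ _).trans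
    (mul_le_mul_of_nonneg_right h2 (norm_nonneg x))

/-- Pointwise convergence of contractions on a dense set extends to its closure. -/
lemma tendsto_zero_of_mem_closure {ι : Type*} {l : Filter ι} {F : ι → H →L[ℝ] H} {C : ℝ}
    (hC : ∀ᶠ i in l, ∀ x, ‖F i x‖ ≤ C * ‖x‖) {s : Set H}
    (hs : ∀ x ∈ s, Tendsto (fun i => F i x) l (𝓝 0)) {x : H} (hx : x ∈ closure s) :
    Tendsto (fun i => F i x) l (𝓝 0) := by
  rw [Metric.tendsto_nhds]
  intro ε hε
  obtain ⟨y, hy, hxy⟩ := Metric.mem_closure_iff.1 hx (ε / (2 * (|C| + 1))) (by positivity)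
  filter_upwards [hC, Metric.tendsto_nhds.1 (hs y hy) (ε / 2) (by positivity)] with i h1 h2
  rw [dist_zero_right] at h2 ⊢
  have h3 : F i x = F i (x - y) + F i y := by rw [← map_add, sub_add_cancel]
  rw [dist_eq_norm, lt_div_iff₀ (by positivity)] at hxy
  have h4 : C * ‖x - y‖ ≤ (|C| + 1) * ‖x - y‖ :=
    mul_le_mul_of_nonneg_right (by linarith [le_abs_self C]) (norm_nonneg _)
  calc ‖F i x‖ ≤ ‖F i (x - y)‖ + ‖F i y‖ := by rw [h3]; exact norm_add_le _ _
    _ < ε := by have := h1 (x - y); linarith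

lemma IsResolvent.mem_closure_range (hR : IsResolvent R) (x : H) : x ∈ closure (range R) :=
  mem_closure_range_of_symm hR.symm fun y hy => by rw [hR.inj y hy, inner_zero_left]

/-- The range of R is dense because R is symmetric and injective, and the operators are
contractions, so convergence on the range suffices. -/
lemma tendsto_heatE_nhdsGT_zero (hR : IsResolvent R) (x : H) :
    Tendsto (fun t => heatE R t x) (𝓝[>] 0) (𝓝 x) := by
  have h : Tendsto (fun t => (heatE R t - 1) x) (𝓝[>] 0) (𝓝 0) := by
    refine tendsto_zero_of_mem_closure (C := 2) ?_ (s := range R) ?_ (hR.mem_closure_range x)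
    · filter_upwards [self_mem_nhdsWithin] with t ht y
      have ht : 0 < t := ht
      have := norm_heatE_apply_le hR ht.le y
      rw [_root_.sub_apply, one_apply_eq_self]
      linarith [norm_sub_le (heatE R t y) y]
    · rintro _ ⟨y, rfl⟩
      rw [tendsto_zero_iff_norm_tendsto_zero]
      have h1 : Tendsto (fun t : ℝ => t * ‖y‖) (𝓝[>] 0) (𝓝 0) := by
        have : Continuous fun t : ℝ => t * ‖y‖ := by fun_prop
        simpa using (this.tendsto 0).mono_left nhdsWithin_le_nhds
      refine squeeze_zero' (Eventually.of_forall fun _ => norm_nonneg _) ?_ h1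
      filter_upwards [self_mem_nhdsWithin] with t ht
      have ht : 0 < t := ht
      rw [_root_.sub_apply, heatE_of_pos ht, ← Cplx.compress_mul_extend]
      have h2 : (1 : H →L[ℝ] H) (R y) = Cplx.compress (Cplx.extend R) y := by
        simp [Cplx.compress_apply]
      rw [h2, ← _root_.sub_apply, ← Cplx.compress_sub]
      exact (Cplx.norm_compress_apply_le _ _).trans
        (mul_le_mul_of_nonneg_right (norm_heatOp_mul_sub_le hR ht) (norm_nonneg y))
  simpa using h.add_const x

lemma resolvent_heatE_sub_heatD (hR : IsResolvent R) {t : ℝ} (ht : 0 < t) (x : H) :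
    R (heatE R t x - heatD R t x) = heatE R t x := by
  rw [heatE_of_pos ht, heatD, ← _root_.sub_apply, ← Cplx.compress_sub,
    sub_sub_cancel, ← Cplx.compress_extend_mul, extend_mul_heatOp hR 0 ht]

lemma resolvent_heatE (hR : IsResolvent R) {t : ℝ} (ht : 0 ≤ t) (x : H) :
    R (heatE R t x) = heatE R t (R x) := by
  rcases ht.eq_or_lt with rfl | ht
  · simp [heatE_zero]
  · rw [heatE_of_pos ht, ← Cplx.compress_extend_mul, ← heatOp_mul_extend hR,
      Cplx.compress_mul_extend]

lemma heatD_resolvent (hR : IsResolvent R) {t : ℝ} (ht : 0 < t) (x : H) :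
    heatD R t (R x) = R (heatE R t x) - heatE R t x := by
  have h1 : heatD R t (R x) = R (heatD R t x) := by
    rw [heatD, ← Cplx.compress_extend_mul, ← Cplx.compress_mul_extend, sub_mul, mul_sub,
      heatOp_mul_extend hR, heatOp_mul_extend hR]
  have h2 := resolvent_heatE_sub_heatD hR ht x
  rw [map_sub] at h2
  rw [h1]
  exact (sub_eq_iff_eq_add.2 (sub_eq_iff_eq_add'.1 h2)).symm

theorem isHeatSemigroup (hR : IsResolvent R) : IsHeatSemigroup R (heatE R) (heatD R) where
  zero := heatE_zero
  norm_le _ ht := norm_heatE_apply_le hR ht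
  continuousOn x := by
    intro t ht
    rcases (show 0 ≤ t from ht).eq_or_lt with rfl | h
    · rw [← continuousWithinAt_Ioi_iff_Ici, ContinuousWithinAt, heatE_zero]
      exact tendsto_heatE_nhdsGT_zero hR x
    · exact (hasDerivAt_heatE hR h x).continuousAt.continuousWithinAt
  hasDerivAt _ ht := hasDerivAt_heatE hR ht
  continuousOn_deriv := continuousOn_heatD hR
  resolvent_sub _ ht := resolvent_heatE_sub_heatD hR ht
  commute _ ht := resolvent_heatE hR ht
  commute_deriv _ ht := heatD_resolvent hR ht
  apply_eq_self x hx t ht := by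
    rcases ht.eq_or_lt with rfl | ht
    · simp [heatE_zero]
    -- A fixed point of R lies in the kernel of A. The orbit is then constant for positive times,
    -- and its value is the limit at time 0.
    have hD : ∀ s, 0 < s → heatD R s x = 0 := by
      intro s hs
      rw [← hx, heatD_resolvent hR hs, resolvent_heatE hR hs.le, hx, sub_self]
    have hconst : ∀ s, 0 < s → heatE R s x = heatE R t x := by
      intro s hs
      have := (convex_Ioi (0 : ℝ)).is_const_of_fderivWithin_eq_zero (𝕜 := ℝ)
        (f := fun s => heatE R s x)
        (fun r hr => (hasDerivAt_heatE hR hr x).differentiableAt.differentiableWithinAt)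
        (fun r hr => by
          have h1 := (hasDerivAt_heatE hR hr x).hasDerivWithinAt (s := Ioi 0)
          rw [hD r hr] at h1
          have h2 := h1.hasFDerivWithinAt.fderivWithin (isOpen_Ioi.uniqueDiffWithinAt hr)
          rw [h2]
          ext; simp) hs ht
      exact this
    refine tendsto_nhds_unique ?_ (tendsto_heatE_nhdsGT_zero hR x)
    refine tendsto_const_nhds.congr' ?_
    filter_upwards [self_mem_nhdsWithin] with s hs
    exact (hconst s hs).symm
  tendsto_zero x hx := by
    -- The range of 1 - R is dense in the orthogonal complement of the fixed points of R. On it the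
    -- orbits decay like 1/t, and contractivity passes to the closure.
    refine tendsto_zero_of_mem_closure (C := 1) ?_ (s := range ((1 : H →L[ℝ] H) - R : H →L[ℝ] H)) ?_ ?_
    · filter_upwards [eventually_ge_atTop 0] with t ht y
      simpa using norm_heatE_apply_le hR ht y
    · rintro _ ⟨y, rfl⟩
      rw [tendsto_zero_iff_norm_tendsto_zero]
      have h1 : Tendsto (fun t : ℝ => 1 / t * ‖y‖) atTop (𝓝 0) := by
        simpa using (tendsto_inv_atTop_zero (𝕜 := ℝ)).mul_const ‖y‖
      refine squeeze_zero' (Eventually.of_forall fun _ => norm_nonneg _) ?_ h1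
      filter_upwards [eventually_gt_atTop 0] with t ht
      have h2 : heatE R t (((1 : H →L[ℝ] H) - R) y) =
          Cplx.compress (heatOp R 0 t * (1 - Cplx.extend R)) y := by
        rw [mul_sub, mul_one, Cplx.compress_sub, heatE_of_pos ht]
        change _ = Cplx.compress (heatOp R 0 t) y -
          Cplx.compress (heatOp R 0 t * Cplx.extend R) y
        rw [Cplx.compress_mul_extend, ← map_sub]
        rfl
      rw [h2]
      exact (Cplx.norm_compress_apply_le _ _).trans
        (mul_le_mul_of_nonneg_right (norm_heatOp_mul_one_sub_le hR ht) (norm_nonneg y))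
    · refine mem_closure_range_of_symm (fun y z => ?_) fun y hy => hx y ?_
      · simp [inner_sub_left, inner_sub_right, hR.symm]
      · rw [_root_.sub_apply, one_apply_eq_self, sub_eq_zero] at hy
        exact hy.symm

end Semigroup

/-! ### The operator T*T through the projection onto the closed graph of T. -/

section Relation

variable {H G : Type*} [NormedAddCommGroup H] [InnerProductSpace ℝ H] [CompleteSpace H]
  [NormedAddCommGroup G] [InnerProductSpace ℝ G] [CompleteSpace G]

/-- A pair as an element of the Hilbert sum. -/
abbrev pair (x : H) (y : G) : WithLp 2 (H × G) := WithLp.toLp 2 (x, y)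

lemma tendsto_pair_iff {ι : Type*} {l : Filter ι} {x : ι → H} {y : ι → G} {a : H} {b : G} :
    Tendsto (fun n => pair (x n) (y n)) l (𝓝 (pair a b)) ↔
      Tendsto x l (𝓝 a) ∧ Tendsto y l (𝓝 b) := by
  constructor
  · intro h
    exact ⟨((WithLp.fstL 2 ℝ H G).continuous.tendsto _).comp h,
      ((WithLp.sndL 2 ℝ H G).continuous.tendsto _).comp h⟩
  · rintro ⟨h1, h2⟩
    have h3 : Continuous (fun q : H × G => WithLp.toLp 2 q) := WithLp.prod_continuous_toLp 2 H G
    exact (h3.tendsto (a, b)).comp (h1.prodMk_nhds h2)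

variable (Γ : Submodule ℝ (WithLp 2 (H × G)))

instance : CompleteSpace Γ.topologicalClosure := Γ.isClosed_topologicalClosure.completeSpace_coe

/-- The resolvent `(1 + T* T)⁻¹`, where the graph of `T` is the closure of `Γ`. -/
def relResolvent : H →L[ℝ] H :=
  LinearMap.mkContinuous
    { toFun := fun x => (Γ.topologicalClosure.starProjection (pair x 0)).fst
      map_add' := fun x y => by
        have : pair (x + y) (0 : G) = pair x 0 + pair y 0 := by
          rw [← WithLp.toLp_add]; simp
        rw [this, map_add]; rfl
      map_smul' := fun a x => by
        have : pair (a • x) (0 : G) = a • pair x 0 := by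
          rw [← WithLp.toLp_smul]; simp
        rw [this, map_smul]; rfl } 1
    (fun x => by
      have h1 := Γ.topologicalClosure.norm_starProjection_apply_le (pair x (0 : G))
      have h2 := WithLp.prod_norm_sq_eq_of_L2 (Γ.topologicalClosure.starProjection (pair x (0 : G)))
      have h3 := WithLp.prod_norm_sq_eq_of_L2 (pair x (0 : G))
      simp only [norm_zero, ne_eq, OfNat.ofNat_ne_zero, not_false_eq_true, zero_pow, add_zero,
        WithLp.toLp_fst, WithLp.toLp_snd] at h3
      have h4 : ‖pair x (0 : G)‖ = ‖x‖ := (sq_eq_sq₀ (norm_nonneg _) (norm_nonneg _)).1 h3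
      rw [h4] at h1
      rw [one_mul]
      refine le_trans ?_ h1
      refine (sq_le_sq₀ (norm_nonneg _) (norm_nonneg _)).1 ?_
      rw [h2]
      exact le_add_of_nonneg_right (sq_nonneg _))

variable {Γ}

lemma relResolvent_apply (x : H) :
    relResolvent Γ x = (Γ.topologicalClosure.starProjection (pair x 0)).fst := rfl

/-- The tested equation is the weak form of u + T*g = f with g = Tu. It says exactly that (f, 0) -
(u, g) is orthogonal to Γ. -/
lemma relResolvent_eq_of {u f : H} {g : G} (h1 : pair u g ∈ Γ.topologicalClosure)
    (h2 : ∀ p ∈ Γ, inner ℝ u p.fst + inner ℝ g p.snd = inner ℝ f p.fst) :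
    relResolvent Γ f = u := by
  have h3 : Γ.topologicalClosure.starProjection (pair f 0) = pair u g := by
    refine Submodule.eq_starProjection_of_mem_orthogonal h1 ?_
    rw [Submodule.orthogonal_closure, Submodule.mem_orthogonal']
    intro p hp
    have h4 := h2 p hp
    have h5 : pair f (0 : G) - pair u g = pair (f - u) (0 - g) := rfl
    rw [h5]
    change inner ℝ (f - u) p.fst + inner ℝ (0 - g) p.snd = 0
    rw [inner_sub_left, inner_sub_left, inner_zero_left]
    linarith
  rw [relResolvent_apply, h3, WithLp.toLp_fst]

lemma exists_of_relResolvent_eq {u f : H} (h : relResolvent Γ f = u) :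
    ∃ g : G, pair u g ∈ Γ.topologicalClosure ∧
      ∀ p ∈ Γ.topologicalClosure, inner ℝ u p.fst + inner ℝ g p.snd = inner ℝ f p.fst := by
  set P := Γ.topologicalClosure.starProjection (pair f (0 : G)) with hP
  have hu : P.fst = u := h
  refine ⟨P.snd, ?_, fun p hp => ?_⟩
  · rw [← hu]
    exact Submodule.starProjection_apply_mem _ _
  · have h1 := Submodule.starProjection_inner_eq_zero (pair f (0 : G)) p hp
    have h2 : inner ℝ (f - P.fst) p.fst + inner ℝ (0 - P.snd) p.snd = 0 := h1
    rw [inner_sub_left, inner_sub_left, inner_zero_left, hu] at h2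
    linarith

/-- Fixed points are the kernel of T: testing the equation with (x, g) itself leaves ‖g‖² = 0. -/
lemma relResolvent_eq_self_iff {x : H} :
    relResolvent Γ x = x ↔ pair x (0 : G) ∈ Γ.topologicalClosure := by
  constructor
  · intro h
    obtain ⟨g, hg, h1⟩ := exists_of_relResolvent_eq h
    have h2 := h1 _ hg
    simp only [add_eq_left, WithLp.toLp_snd, inner_self_eq_zero] at h2
    rwa [h2] at hg
  · intro h
    exact relResolvent_eq_of h fun p _ => by simp

/-- The closure of Γ need not be known to be a graph. Density of the domain is the only requirement,
and it enters only in the injectivity. -/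
lemma isResolvent_relResolvent (hΓ : ∀ f : H, (∀ p ∈ Γ, inner ℝ f p.fst = 0) → f = 0) :
    IsResolvent (relResolvent Γ) := by
  constructor
  · intro x y
    obtain ⟨g, hg, h1⟩ := exists_of_relResolvent_eq (Γ := Γ) (f := x) rfl
    obtain ⟨g', hg', h1'⟩ := exists_of_relResolvent_eq (Γ := Γ) (f := y) rfl
    have h2 := h1 _ hg'
    have h2' := h1' _ hg
    simp only [WithLp.toLp_fst, WithLp.toLp_snd] at h2 h2'
    rw [real_inner_comm, ← h2', ← h2, real_inner_comm (relResolvent Γ x), real_inner_comm g]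
  · intro x
    obtain ⟨g, hg, h1⟩ := exists_of_relResolvent_eq (Γ := Γ) (f := x) rfl
    have h2 := h1 _ hg
    simp only [WithLp.toLp_fst, WithLp.toLp_snd, real_inner_self_eq_norm_sq] at h2
    rw [real_inner_comm, ← h2]
    nlinarith [sq_nonneg ‖g‖]
  · intro x hx
    obtain ⟨g, hg, h1⟩ := exists_of_relResolvent_eq (Γ := Γ) hx
    have h2 := h1 _ hg
    simp only [WithLp.toLp_fst, WithLp.toLp_snd, inner_zero_right, inner_self_eq_zero,
      zero_add] at h2
    refine hΓ x fun p hp => ?_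
    rw [← h1 p (Γ.le_topologicalClosure hp), h2]
    simp

/-- A weak solution tested against `Γ` satisfies the equation tested against the operator
domain. -/
lemma hasDerivAt_inner_relResolvent {w : ℝ → H} {W : ℝ → G}
    (hW : ∀ t, 0 < t → pair (w t) (W t) ∈ Γ.topologicalClosure)
    (hbdd : ∀ t, 0 < t → ∃ C, ∀ᶠ s in 𝓝 t, ‖W s‖ ≤ C)
    (hw : ∀ p ∈ Γ, ∀ t, 0 < t →
      HasDerivAt (fun t => inner ℝ (w t) p.fst) (-inner ℝ (W t) p.snd) t)
    (g : H) {t : ℝ} (ht : 0 < t) :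
    HasDerivAt (fun t => inner ℝ (w t) (relResolvent Γ g))
      (inner ℝ (w t) (relResolvent Γ g - g)) t := by
  obtain ⟨b, hb, h1⟩ := exists_of_relResolvent_eq (Γ := Γ) (f := g) rfl
  have h2 : inner ℝ (w t) (relResolvent Γ g - g) = -inner ℝ (W t) b := by
    have := h1 _ (hW t ht)
    simp only [WithLp.toLp_fst, WithLp.toLp_snd] at this
    rw [inner_sub_right, real_inner_comm (relResolvent Γ g), real_inner_comm g,
      real_inner_comm b]
    linarith
  have h3 : pair (relResolvent Γ g) b ∈ closure (Γ : Set (WithLp 2 (H × G))) := by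
    rw [← Submodule.topologicalClosure_coe]; exact hb
  obtain ⟨p, hp, hlim⟩ := mem_closure_iff_seq_limit.1 h3
  have hlim' := (tendsto_pair_iff (x := fun n => (p n).fst) (y := fun n => (p n).snd)).1 hlim
  obtain ⟨C, hC⟩ := hbdd t ht
  obtain ⟨s, hs, hso, hts⟩ := eventually_nhds_iff.1 (hC.and (eventually_gt_nhds ht))
  rw [h2]
  -- The pair (R g, b) is a limit of elements of Γ, for which the derivative is given. Local
  -- boundedness of W makes the derivatives converge locally uniformly.
  refine hasDerivAt_of_tendstoUniformlyOn (l := atTop) (s := s)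
    (f := fun n t => inner ℝ (w t) (p n).fst) (f' := fun n t => -inner ℝ (W t) (p n).snd)
    (g := fun t => inner ℝ (w t) (relResolvent Γ g)) (g' := fun t => -inner ℝ (W t) b)
    hso ?_ ?_ ?_ hts
  · rw [Metric.tendstoUniformlyOn_iff]
    intro ε hε
    have h4 := Metric.tendsto_nhds.1 hlim'.2 (ε / (|C| + 1)) (by positivity)
    filter_upwards [h4] with n hn r hr
    rw [Real.dist_eq, neg_sub_neg, ← inner_sub_right]
    rw [dist_eq_norm, lt_div_iff₀ (by positivity)] at hn
    have h5 := abs_real_inner_le_norm (W r) ((p n).snd - b)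
    have h6 : ‖W r‖ * ‖(p n).snd - b‖ ≤ (|C| + 1) * ‖(p n).snd - b‖ :=
      mul_le_mul_of_nonneg_right (by linarith [(hs r hr).1, le_abs_self C]) (norm_nonneg _)
    linarith
  · exact Eventually.of_forall fun n r hr => hw _ (hp n) r (hs r hr).2
  · intro r hr
    exact tendsto_const_nhds.inner hlim'.1

end Relation

/-! ### Uniqueness of bounded weak solutions by duality. -/

section Uniqueness

variable {H : Type*} [NormedAddCommGroup H] [InnerProductSpace ℝ H]

/-- A bounded weakly convergent family pairs with a strongly convergent one. -/
lemma tendsto_inner_of_weak {ι : Type*} {l : Filter ι} {w z : ι → H} {a b : H} {M : ℝ}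
    (hM : ∀ᶠ i in l, ‖w i‖ ≤ M) (hw : Tendsto (fun i => inner ℝ (w i) b) l (𝓝 (inner ℝ a b)))
    (hz : Tendsto z l (𝓝 b)) :
    Tendsto (fun i => inner ℝ (w i) (z i)) l (𝓝 (inner ℝ a b)) := by
  have h1 : Tendsto (fun i => inner ℝ (w i) (z i - b)) l (𝓝 0) := by
    rw [tendsto_zero_iff_norm_tendsto_zero]
    have h2 : Tendsto (fun i => M * ‖z i - b‖) l (𝓝 0) := by
      simpa using (tendsto_iff_norm_sub_tendsto_zero.1 hz).const_mul M
    refine squeeze_zero' (Eventually.of_forall fun _ => norm_nonneg _) ?_ h2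
    filter_upwards [hM] with i hi
    exact (norm_inner_le_norm _ _).trans (mul_le_mul_of_nonneg_right hi (norm_nonneg _))
  have h3 := hw.add h1
  rw [add_zero] at h3
  refine h3.congr fun i => ?_
  rw [← inner_add_right, add_sub_cancel]

/-- Product rule for a weakly differentiable and a strongly differentiable curve. -/
lemma hasDerivAt_inner_of_weak {w z : ℝ → H} {z' : H} {D M t : ℝ}
    (hM : ∀ᶠ s in 𝓝 t, ‖w s‖ ≤ M)
    (hw : Tendsto (fun s => inner ℝ (w s) z') (𝓝 t) (𝓝 (inner ℝ (w t) z')))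
    (hD : HasDerivAt (fun s => inner ℝ (w s) (z t)) D t) (hz : HasDerivAt z z' t) :
    HasDerivAt (fun s => inner ℝ (w s) (z s)) (D + inner ℝ (w t) z') t := by
  have h1 : HasDerivAt (fun s => inner ℝ (w s) (z s - z t)) (inner ℝ (w t) z') t := by
    rw [hasDerivAt_iff_tendsto_slope] at hz ⊢
    have h2 := tendsto_inner_of_weak (hM.filter_mono nhdsWithin_le_nhds)
      (hw.mono_left nhdsWithin_le_nhds) hz
    refine h2.congr fun s => ?_
    simp [slope_def_module, inner_smul_right]
  refine (hD.add h1).congr_of_eventuallyEq (Eventually.of_forall fun s => ?_)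
  simp [inner_sub_right]

/-- Uniqueness of bounded weak solutions with zero initial value. -/
lemma eq_zero_of_weak_solution [CompleteSpace H] {R : H →L[ℝ] H} (hR : IsResolvent R)
    {w : ℝ → H} {M : ℝ} (hM : ∀ t, 0 ≤ t → ‖w t‖ ≤ M)
    (hcont : ∀ g, ContinuousOn (fun t => inner ℝ (w t) g) (Ici 0)) (h0 : w 0 = 0)
    (hw : ∀ g, ∀ t, 0 < t → HasDerivAt (fun t => inner ℝ (w t) (R g))
      (inner ℝ (w t) (R g - g)) t) {T : ℝ} (hT : 0 ≤ T) : w T = 0 := by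
  rcases hT.eq_or_lt with rfl | hT
  · exact h0
  have hE := isHeatSemigroup hR
  set E := heatE R
  set D := heatD R
  have hRw : ∀ g, inner ℝ (w T) (R g) = 0 := by
    intro g
    -- The solution is paired with the backward flow. Since E(T-τ)(R g) = R(E(T-τ) g), the weak
    -- equation applies at every τ and cancels the derivative of the backward flow.
    set F : ℝ → ℝ := fun τ => inner ℝ (w τ) (E (T - τ) (R g)) with hF
    have hz : ∀ τ ∈ Icc 0 T, ContinuousWithinAt (fun τ => E (T - τ) (R g)) (Icc 0 T) τ := by
      intro τ hτ
      refine (hE.continuousOn (R g) (T - τ) (sub_nonneg.2 hτ.2)).comp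
        (f := fun τ => T - τ) (by fun_prop) ?_
      intro s hs
      exact sub_nonneg.2 hs.2
    have hFc : ContinuousOn F (Icc 0 T) := by
      intro τ hτ
      refine tendsto_inner_of_weak (M := M) ?_ ?_ (hz τ hτ)
      · filter_upwards [self_mem_nhdsWithin] with s hs using hM s hs.1
      · exact (hcont _).mono Icc_subset_Ici_self τ hτ
    have hFd : ∀ τ ∈ Ioo 0 T, HasDerivAt F 0 τ := by
      intro τ hτ
      have hpos : 0 < T - τ := sub_pos.2 hτ.2
      have h1 : HasDerivAt (fun τ => E (T - τ) (R g)) (-(D (T - τ) (R g))) τ := by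
        have h2 := (hE.hasDerivAt _ hpos (R g)).scomp τ ((hasDerivAt_id τ).const_sub T)
        simpa [Function.comp_def] using h2
      have h3 := hasDerivAt_inner_of_weak (w := w) (M := M)
        (D := inner ℝ (w τ) (R (E (T - τ) g) - E (T - τ) g)) (t := τ) ?_ ?_ ?_ h1
      · rwa [hE.commute_deriv _ hpos, inner_neg_right, add_neg_cancel] at h3
      · filter_upwards [eventually_gt_nhds hτ.1] with s hs using hM s hs.le
      · exact (hcont _).continuousAt (Ici_mem_nhds hτ.1)
      · have := hw (E (T - τ) g) τ hτ.1
        rwa [hE.commute _ hpos.le] at this ⊢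
    -- The weak equation holds for positive times only, so F is first constant on [ε, T]; continuity
    -- at 0 then lets ε → 0.
    have hconst : ∀ ε ∈ Ioo 0 T, F T = F ε := by
      intro ε hε
      refine constant_of_has_deriv_right_zero (hFc.mono (Icc_subset_Icc_left hε.1.le))
        (fun x hx => (hFd x ⟨hε.1.trans_le hx.1, hx.2⟩).hasDerivWithinAt) T
        (right_mem_Icc.2 hε.2.le)
    have h4 : Tendsto F (𝓝[>] 0) (𝓝 (F 0)) := by
      have := (hFc 0 (left_mem_Icc.2 hT.le)).mono_left
        (nhdsWithin_mono 0 (Ioo_subset_Icc_self (a := (0 : ℝ)) (b := T)))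
      rwa [nhdsWithin_Ioo_eq_nhdsGT hT] at this
    have h5 : Tendsto F (𝓝[>] 0) (𝓝 (F T)) := by
      refine tendsto_const_nhds.congr' ?_
      filter_upwards [Ioo_mem_nhdsGT hT] with ε hε using hconst ε hε
    have h6 := tendsto_nhds_unique h4 h5
    simp only [hF, h0, inner_zero_left, sub_self, hE.zero, one_apply_eq_self] at h6
    exact h6.symm
  refine hR.inj _ ?_
  -- By symmetry this pairing is ‖R(w T)‖².
  have := hRw (R (w T))
  rwa [← hR.symm, inner_self_eq_zero] at this

end Uniqueness

/-! ### Products with functions supported in an open set. -/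

section Cutting

variable {E F : Type*} [NormedAddCommGroup E] [NormedAddCommGroup F] [NormedSpace ℝ F]

/-- Off the closed support of φ the product vanishes near the point. Hence f may be singular outside
U, as V is at the boundary and at the origin. -/
lemma continuous_smul_of_tsupport_subset {U : Set E} (hU : IsOpen U) {φ : E → ℝ}
    (hφ : Continuous φ) (hs : tsupport φ ⊆ U) {f : E → F} (hf : ContinuousOn f U) :
    Continuous fun x => φ x • f x := by
  rw [continuous_iff_continuousAt]
  intro x
  by_cases hx : x ∈ tsupport φ
  · exact hφ.continuousAt.smul (hf.continuousAt (hU.mem_nhds (hs hx)))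
  · have h : (fun x => φ x • f x) =ᶠ[𝓝 x] fun _ => 0 := by
      filter_upwards [notMem_tsupport_iff_eventuallyEq.1 hx] with y hy
      simp [hy]
    exact continuousAt_const.congr h.symm

lemma contDiff_smul_of_tsupport_subset [NormedSpace ℝ E] {U : Set E} (hU : IsOpen U) {φ : E → ℝ}
    {n : WithTop ℕ∞} (hφ : ContDiff ℝ n φ) (hs : tsupport φ ⊆ U) {f : E → F}
    (hf : ContDiffOn ℝ n f U) : ContDiff ℝ n fun x => φ x • f x := by
  rw [contDiff_iff_contDiffAt]
  intro x
  by_cases hx : x ∈ tsupport φ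
  · exact hφ.contDiffAt.smul (hf.contDiffAt (hU.mem_nhds (hs hx)))
  · have h : (fun x => φ x • f x) =ᶠ[𝓝 x] fun _ => 0 := by
      filter_upwards [notMem_tsupport_iff_eventuallyEq.1 hx] with y hy
      simp [hy]
    exact contDiffAt_const.congr_of_eventuallyEq h

end Cutting

/-! ### Test functions and the graph of φ ↦ ∇φ - φV. -/

section TestGraph

variable {N k : ℕ}

/-- The punctured corner. -/
abbrev domain (N k : ℕ) : Set (Euc N) := corner N k \ {0}

/-- Square integrable vector fields on the corner. -/
abbrev VL2 (N k : ℕ) : Type := Lp (Euc N) 2 (cornerMeasure N k)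

lemma isOpen_corner (N k : ℕ) : IsOpen (corner N k) := by
  have h : corner N k = ⋂ i : Fin N, {x : Euc N | N ≤ (i : ℕ) + k → 0 < x i} := by
    ext x; simp [corner]
  rw [h]
  refine isOpen_iInter_of_finite fun i => ?_
  by_cases hi : N ≤ (i : ℕ) + k
  · simp only [hi, true_imp_iff]
    exact isOpen_lt continuous_const (by fun_prop)
  · simp [hi]

lemma isOpen_domain (N k : ℕ) : IsOpen (domain N k) :=
  (isOpen_corner N k).sdiff isClosed_singleton

lemma measurableSet_corner (N k : ℕ) : MeasurableSet (corner N k) :=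
  (isOpen_corner N k).measurableSet

lemma ae_mem_domain (hN : 2 ≤ N) (k : ℕ) : ∀ᵐ x ∂(cornerMeasure N k), x ∈ domain N k := by
  have : Nonempty (Fin N) := ⟨⟨0, by omega⟩⟩
  have h1 : ∀ᵐ x ∂(cornerMeasure N k), x ∈ corner N k :=
    ae_restrict_mem (measurableSet_corner N k)
  have h2 : ∀ᵐ x ∂(cornerMeasure N k), x ≠ 0 :=
    ae_restrict_of_ae (by simp [ae_iff])
  filter_upwards [h1, h2] with x hx hx0 using ⟨hx, hx0⟩

lemma IsTest.continuous {φ : Euc N → ℝ} (h : IsTest N k φ) : Continuous φ := h.smooth.continuous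

lemma IsTest.differentiable {φ : Euc N → ℝ} (h : IsTest N k φ) : Differentiable ℝ φ :=
  h.smooth.differentiable (by simp)

lemma IsTest.zero : IsTest N k (0 : Euc N → ℝ) :=
  ⟨contDiff_const, HasCompactSupport.zero, by simp [tsupport]⟩

lemma IsTest.add {φ ψ : Euc N → ℝ} (h : IsTest N k φ) (h' : IsTest N k ψ) :
    IsTest N k (φ + ψ) :=
  ⟨h.smooth.add h'.smooth, h.compact.add h'.compact,
    (tsupport_add φ ψ).trans (union_subset h.support h'.support)⟩

/-- Multiples of test functions by functions that are smooth on the punctured corner. -/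
lemma IsTest.mul_smooth {φ f : Euc N → ℝ} (h : IsTest N k φ)
    (hf : ContDiffOn ℝ ∞ f (domain N k)) : IsTest N k (fun x => φ x * f x) :=
  ⟨contDiff_smul_of_tsupport_subset (isOpen_domain N k) h.smooth h.support hf,
    h.compact.mul_right, (closure_mono (by intro x; simp; tauto)).trans h.support⟩

lemma IsTest.smul {φ : Euc N → ℝ} (h : IsTest N k φ) (a : ℝ) : IsTest N k (a • φ) := by
  have := h.mul_smooth (f := fun _ => a) contDiffOn_const
  convert this using 1
  ext x; simp [mul_comm]

lemma IsTest.sub {φ ψ : Euc N → ℝ} (h : IsTest N k φ) (h' : IsTest N k ψ) :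
    IsTest N k (φ - ψ) := by
  have := h.add (h'.smul (-1))
  convert this using 1
  ext x; simp [sub_eq_add_neg]

lemma continuous_gradient {φ : Euc N → ℝ} (h : ContDiff ℝ ∞ φ) : Continuous (gradient φ) :=
  (InnerProductSpace.toDual ℝ (Euc N)).symm.continuous.comp (h.continuous_fderiv (by simp))

lemma support_gradient_subset (φ : Euc N → ℝ) : Function.support (gradient φ) ⊆ tsupport φ := by
  intro x hx
  refine support_fderiv_subset ℝ (f := φ) ?_
  intro h
  apply hx
  simp [gradient, h]

/-- The first order operator `φ ↦ ∇φ - φ V`. -/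
def gradOp (V : Euc N → Euc N) (φ : Euc N → ℝ) (x : Euc N) : Euc N := gradient φ x - φ x • V x

lemma gradOp_of_notMem_tsupport {V : Euc N → Euc N} {φ : Euc N → ℝ} {x : Euc N}
    (hx : x ∉ tsupport φ) : gradOp V φ x = 0 := by
  have h1 : gradient φ x = 0 := by
    by_contra h; exact hx (support_gradient_subset φ h)
  rw [gradOp, h1, image_eq_zero_of_notMem_tsupport hx]; simp

lemma gradOp_add {V : Euc N → Euc N} {φ ψ : Euc N → ℝ} (h : Differentiable ℝ φ)
    (h' : Differentiable ℝ ψ) : gradOp V (φ + ψ) = gradOp V φ + gradOp V ψ := by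
  ext1 x
  simp only [gradOp, gradient, Pi.add_apply, fderiv_add (h x) (h' x), map_add]
  module

lemma gradOp_smul {V : Euc N → Euc N} {φ : Euc N → ℝ} (h : Differentiable ℝ φ) (a : ℝ) :
    gradOp V (a • φ) = a • gradOp V φ := by
  ext1 x
  simp only [gradOp, gradient, Pi.smul_apply, fderiv_const_smul (h x), map_smul]
  module

lemma gradOp_sub {V : Euc N → Euc N} {φ ψ : Euc N → ℝ} (h : Differentiable ℝ φ)
    (h' : Differentiable ℝ ψ) : gradOp V (φ - ψ) = gradOp V φ - gradOp V ψ := by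
  ext1 x
  simp only [gradOp, gradient, Pi.sub_apply, fderiv_sub (h x) (h' x), map_sub]
  module

lemma IsTest.continuous_gradOp {V : Euc N → Euc N} (hV : ContinuousOn V (domain N k))
    {φ : Euc N → ℝ} (h : IsTest N k φ) : Continuous (gradOp V φ) :=
  (continuous_gradient h.smooth).sub
    (continuous_smul_of_tsupport_subset (isOpen_domain N k) h.continuous h.support hV)

lemma IsTest.hasCompactSupport_gradOp (V : Euc N → Euc N)
    {φ : Euc N → ℝ} (h : IsTest N k φ) : HasCompactSupport (gradOp V φ) :=
  HasCompactSupport.intro h.compact fun _ hx => gradOp_of_notMem_tsupport hx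

lemma IsTest.memLp {φ : Euc N → ℝ} (h : IsTest N k φ) : MemLp φ 2 (cornerMeasure N k) :=
  (h.continuous.memLp_of_hasCompactSupport (μ := volume) h.compact).restrict _

lemma IsTest.memLp_gradOp {V : Euc N → Euc N} (hV : ContinuousOn V (domain N k))
    {φ : Euc N → ℝ} (h : IsTest N k φ) : MemLp (gradOp V φ) 2 (cornerMeasure N k) :=
  ((h.continuous_gradOp hV).memLp_of_hasCompactSupport (μ := volume)
    (h.hasCompactSupport_gradOp V)).restrict _

/-- The graph of `φ ↦ ∇φ - φ V` on test functions, in `L² × L²`. -/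
def testGraph (N k : ℕ) (V : Euc N → Euc N) : Submodule ℝ (WithLp 2 (L2 N k × VL2 N k)) where
  carrier := {p | ∃ φ, IsTest N k φ ∧ p.fst =ᵐ[cornerMeasure N k] φ ∧
    p.snd =ᵐ[cornerMeasure N k] gradOp V φ}
  zero_mem' := ⟨0, IsTest.zero, Lp.coeFn_zero _ _ _, by
    have h : gradOp V (0 : Euc N → ℝ) = 0 := by
      ext1 x; exact gradOp_of_notMem_tsupport (by simp [tsupport])
    rw [h]
    exact Lp.coeFn_zero _ _ _⟩
  add_mem' := by
    rintro p q ⟨φ, h, h1, h2⟩ ⟨ψ, h', h1', h2'⟩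
    refine ⟨φ + ψ, h.add h', (Lp.coeFn_add p.fst q.fst).trans (h1.add h1'), ?_⟩
    rw [gradOp_add h.differentiable h'.differentiable]
    exact (Lp.coeFn_add p.snd q.snd).trans (h2.add h2')
  smul_mem' := by
    rintro a p ⟨φ, h, h1, h2⟩
    refine ⟨a • φ, h.smul a, (Lp.coeFn_smul a p.fst).trans (h1.const_smul a), ?_⟩
    rw [gradOp_smul h.differentiable]
    exact (Lp.coeFn_smul a p.snd).trans (h2.const_smul a)

/-- A test function as an element of `L²`. -/
def IsTest.toL2 {φ : Euc N → ℝ} (h : IsTest N k φ) : L2 N k := h.memLp.toLp φ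

/-- `∇φ - φ V` as an element of `L²`. -/
def IsTest.gradL2 {V : Euc N → Euc N} (hV : ContinuousOn V (domain N k))
    {φ : Euc N → ℝ} (h : IsTest N k φ) : VL2 N k := (h.memLp_gradOp hV).toLp _

lemma IsTest.coeFn_toL2 {φ : Euc N → ℝ} (h : IsTest N k φ) :
    h.toL2 =ᵐ[cornerMeasure N k] φ := MemLp.coeFn_toLp _

lemma IsTest.coeFn_gradL2 {V : Euc N → Euc N} (hV : ContinuousOn V (domain N k))
    {φ : Euc N → ℝ} (h : IsTest N k φ) :
    h.gradL2 hV =ᵐ[cornerMeasure N k] gradOp V φ := MemLp.coeFn_toLp _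

lemma IsTest.pair_mem {V : Euc N → Euc N} (hV : ContinuousOn V (domain N k))
    {φ : Euc N → ℝ} (h : IsTest N k φ) : pair h.toL2 (h.gradL2 hV) ∈ testGraph N k V :=
  ⟨φ, h, h.coeFn_toL2, h.coeFn_gradL2 hV⟩

lemma exists_of_mem_testGraph {V : Euc N → Euc N} (hV : ContinuousOn V (domain N k))
    {p : WithLp 2 (L2 N k × VL2 N k)} (hp : p ∈ testGraph N k V) :
    ∃ φ, ∃ h : IsTest N k φ, p = pair h.toL2 (h.gradL2 hV) := by
  obtain ⟨φ, h, h1, h2⟩ := hp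
  refine ⟨φ, h, ?_⟩
  have e1 : p.fst = h.toL2 := Lp.ext (h1.trans h.coeFn_toL2.symm)
  have e2 : p.snd = h.gradL2 hV := Lp.ext (h2.trans (h.coeFn_gradL2 hV).symm)
  rw [← e1, ← e2]
  rfl

lemma inner_toL2 {φ : Euc N → ℝ} (h : IsTest N k φ) (f : L2 N k) :
    inner ℝ f h.toL2 = ∫ x, f x * φ x ∂(cornerMeasure N k) := by
  rw [L2.inner_def]
  refine integral_congr_ae ?_
  filter_upwards [h.coeFn_toL2] with x hx
  simp [hx, mul_comm]

lemma inner_gradL2 {V : Euc N → Euc N} (hV : ContinuousOn V (domain N k))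
    {φ ψ : Euc N → ℝ} (h : IsTest N k φ) (h' : IsTest N k ψ) :
    inner ℝ (h.gradL2 hV) (h'.gradL2 hV) =
      ∫ x, inner ℝ (gradOp V φ x) (gradOp V ψ x) ∂(cornerMeasure N k) := by
  rw [L2.inner_def]
  refine integral_congr_ae ?_
  filter_upwards [h.coeFn_gradL2 hV, h'.coeFn_gradL2 hV] with x hx hx'
  rw [hx, hx']

/-- Test functions are dense in `L²`. -/
lemma eq_zero_of_inner_testGraph (hN : 2 ≤ N) {V : Euc N → Euc N}
    (hV : ContinuousOn V (domain N k)) (f : L2 N k)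
    (hf : ∀ p ∈ testGraph N k V, inner ℝ f p.fst = 0) : f = 0 := by
  have hloc : LocallyIntegrable f (cornerMeasure N k) :=
    (Lp.memLp f).locallyIntegrable (by norm_num)
  have h1 := (isOpen_domain N k).ae_eq_zero_of_integral_contDiff_smul_eq_zero
    (hloc.locallyIntegrableOn _) fun g hg hc hs => by
      have hg' : IsTest N k g := ⟨hg, hc, hs⟩
      have h2 := hf _ (hg'.pair_mem hV)
      rw [WithLp.toLp_fst, inner_toL2] at h2
      rw [← h2]
      simp [mul_comm]
  refine Lp.ext ?_
  filter_upwards [h1, ae_mem_domain hN k, Lp.coeFn_zero ℝ 2 (cornerMeasure N k)] with x hx hx' h0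
  rw [hx hx', h0]; rfl

lemma isResolvent_testGraph (hN : 2 ≤ N) {V : Euc N → Euc N}
    (hV : ContinuousOn V (domain N k)) : IsResolvent (relResolvent (testGraph N k V)) :=
  isResolvent_relResolvent (eq_zero_of_inner_testGraph hN hV)

end TestGraph

/-! ### Ground state representation of the Hardy form. -/

section HardyField

variable {N k : ℕ} {lam : ℝ}

/-- The logarithmic gradient of `h(x) = |x|^{m-(N-2)/2-k} ∏ x_i`. -/
def hardyField (N k : ℕ) (lam : ℝ) (x : Euc N) : Euc N :=
  WithLp.toLp 2 fun j => (mExp N k lam - ((N : ℝ) - 2) / 2 - k) * x j / ‖x‖ ^ 2 +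
    if N ≤ (j : ℕ) + k then (x j)⁻¹ else 0

lemma hardyField_apply (x : Euc N) (j : Fin N) : hardyField N k lam x j =
    (mExp N k lam - ((N : ℝ) - 2) / 2 - k) * x j / ‖x‖ ^ 2 +
    if N ≤ (j : ℕ) + k then (x j)⁻¹ else 0 := rfl

lemma contDiffOn_hardyField_apply (j : Fin N) :
    ContDiffOn ℝ ∞ (fun x => hardyField N k lam x j) (domain N k) := by
  simp only [hardyField_apply]
  have hj : ContDiff ℝ ∞ fun x : Euc N => x j := by fun_prop
  refine ContDiffOn.add (ContDiffOn.div (contDiff_const.mul hj).contDiffOn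
    (contDiff_norm_sq ℝ).contDiffOn fun x hx => ?_) ?_
  · have : x ≠ 0 := hx.2
    positivity
  · by_cases h : N ≤ (j : ℕ) + k
    · simp only [h, if_true]
      exact hj.contDiffOn.inv fun x hx => (hx.1 j h).ne'
    · simp only [h, if_false]
      exact contDiffOn_const

lemma continuousOn_hardyField : ContinuousOn (hardyField N k lam) (domain N k) := by
  have h : ContinuousOn (fun x => WithLp.ofLp (hardyField N k lam x)) (domain N k) :=
    continuousOn_pi.2 fun j => (contDiffOn_hardyField_apply j).continuousOn
  exact (PiLp.continuous_toLp 2 _).comp_continuousOn h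

lemma card_filter_corner (hk : k ≤ N) :
    (Finset.univ.filter (fun i : Fin N => N ≤ (i : ℕ) + k)).card = k := by
  have h : Finset.univ.filter (fun i : Fin N => N ≤ (i : ℕ) + k) =
      Finset.univ.filter (fun i : Fin N => ¬ (i : ℕ) < N - k) := by
    ext i; simp only [Finset.mem_filter, Finset.mem_univ, true_and]; omega
  rw [h, Finset.filter_not, Finset.card_sdiff_of_subset (Finset.filter_subset _ _),
    Finset.card_univ, Fintype.card_fin, Fin.card_filter_val_lt]
  omega

lemma mExp_sq (hlam : lam ≤ hardyConst N k) :
    mExp N k lam ^ 2 = (((N : ℝ) - 2) / 2 + k) ^ 2 - lam := by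
  rw [mExp, Real.sq_sqrt (by linarith)]; rfl

/-- This is Euler's identity for h, which is homogeneous of degree m - (N-2)/2. -/
lemma inner_self_hardyField (hk : k ≤ N) {x : Euc N} (hx : x ∈ domain N k) :
    inner ℝ x (hardyField N k lam x) = mExp N k lam - ((N : ℝ) - 2) / 2 := by
  have hx0 : ‖x‖ ≠ 0 := norm_ne_zero_iff.2 hx.2
  have h1 : ∀ j : Fin N, inner ℝ (x j) (hardyField N k lam x j) =
      (mExp N k lam - ((N : ℝ) - 2) / 2 - k) / ‖x‖ ^ 2 * x j ^ 2 +
        if N ≤ (j : ℕ) + k then 1 else 0 := by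
    intro j
    rw [hardyField_apply]
    have : inner ℝ (x j) = fun y => y * x j := by ext y; simp
    rw [this]
    by_cases h : N ≤ (j : ℕ) + k
    · have := (hx.1 j h).ne'
      simp only [h, if_true]
      field_simp
    · simp only [h, if_false]; ring
  rw [PiLp.inner_apply, Finset.sum_congr rfl fun j _ => h1 j, Finset.sum_add_distrib,
    ← Finset.mul_sum, ← EuclideanSpace.real_norm_sq_eq, Finset.sum_boole, card_filter_corner hk]
  field_simp
  ring

lemma hasFDerivAt_hardyField_apply {x : Euc N} (hx : x ∈ domain N k) (j : Fin N) :
    fderiv ℝ (fun x => hardyField N k lam x j) x (EuclideanSpace.single j 1) =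
      (mExp N k lam - ((N : ℝ) - 2) / 2 - k) * (1 / ‖x‖ ^ 2 - 2 * x j ^ 2 / ‖x‖ ^ 4) -
        if N ≤ (j : ℕ) + k then (x j ^ 2)⁻¹ else 0 := by
  have hx0 : ‖x‖ ≠ 0 := norm_ne_zero_iff.2 hx.2
  have hd : DifferentiableAt ℝ (fun x => hardyField N k lam x j) x :=
    ((contDiffOn_hardyField_apply j).contDiffAt ((isOpen_domain N k).mem_nhds hx)).differentiableAt
      (by simp)
  -- Along the line x + t e_j only x_j and ‖x‖² vary, so a one-variable derivative remains.
  rw [← hd.lineDeriv_eq_fderiv, lineDeriv]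
  have hc : ∀ t : ℝ, (x + t • EuclideanSpace.single j (1 : ℝ)) j = x j + t := by
    intro t; simp
  have hn : ∀ t : ℝ, ‖x + t • EuclideanSpace.single j (1 : ℝ)‖ ^ 2 = ‖x‖ ^ 2 + 2 * t * x j + t ^ 2 := by
    intro t
    rw [norm_add_sq_real, inner_smul_right, norm_smul, EuclideanSpace.inner_single_right]
    simp
    ring
  simp only [hardyField_apply, hc, hn]
  have d1 : HasDerivAt (fun t : ℝ => x j + t) 1 0 := (hasDerivAt_id 0).const_add _
  have d2 : HasDerivAt (fun t : ℝ => ‖x‖ ^ 2 + 2 * t * x j + t ^ 2) (2 * x j) 0 := by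
    have := (((hasDerivAt_id (0 : ℝ)).const_mul 2).mul_const (x j)).const_add (‖x‖ ^ 2)
    exact (this.add ((hasDerivAt_id (0 : ℝ)).pow 2)).congr_deriv (by simp)
  have d3 := (d1.const_mul (mExp N k lam - ((N : ℝ) - 2) / 2 - k)).div d2 (by simpa using hx0)
  by_cases h : N ≤ (j : ℕ) + k
  · simp only [h, if_true]
    have hj := (hx.1 j h).ne'
    have d4 := d3.add (d1.inv (by simpa using hj))
    refine d4.deriv.trans ?_
    simp
    field_simp
    ring
  · simp only [h, if_false]
    have d4 := d3.add (hasDerivAt_const (0 : ℝ) (0 : ℝ))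
    refine d4.deriv.trans ?_
    simp
    field_simp

lemma norm_sq_hardyField (hk : k ≤ N) {x : Euc N} (hx : x ∈ domain N k) :
    ‖hardyField N k lam x‖ ^ 2 =
      ((mExp N k lam - ((N : ℝ) - 2) / 2 - k) ^ 2 +
        2 * (mExp N k lam - ((N : ℝ) - 2) / 2 - k) * k) / ‖x‖ ^ 2 +
      ∑ j : Fin N, if N ≤ (j : ℕ) + k then (x j ^ 2)⁻¹ else 0 := by
  have hx0 : ‖x‖ ≠ 0 := norm_ne_zero_iff.2 hx.2
  set c := mExp N k lam - ((N : ℝ) - 2) / 2 - k with hc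
  have h1 : ∀ j : Fin N, hardyField N k lam x j ^ 2 =
      c ^ 2 / ‖x‖ ^ 4 * x j ^ 2 + 2 * c / ‖x‖ ^ 2 * (if N ≤ (j : ℕ) + k then 1 else 0) +
        if N ≤ (j : ℕ) + k then (x j ^ 2)⁻¹ else 0 := by
    intro j
    rw [hardyField_apply, ← hc]
    by_cases h : N ≤ (j : ℕ) + k
    · have := (hx.1 j h).ne'
      simp only [h, if_true]
      field_simp
      ring
    · simp only [h, if_false]; field_simp; ring
  rw [EuclideanSpace.real_norm_sq_eq, Finset.sum_congr rfl fun j _ => h1 j,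
    Finset.sum_add_distrib, Finset.sum_add_distrib, ← Finset.mul_sum, ← Finset.mul_sum,
    ← EuclideanSpace.real_norm_sq_eq, Finset.sum_boole, card_filter_corner hk]
  field_simp

/-- `div V₀ + |V₀|² = -λ / |x|²`. -/
lemma divergence_hardyField (hk : k ≤ N) (hlam : lam ≤ hardyConst N k) {x : Euc N}
    (hx : x ∈ domain N k) :
    ∑ j : Fin N, fderiv ℝ (fun x => hardyField N k lam x j) x (EuclideanSpace.single j 1) =
      -(lam / ‖x‖ ^ 2) - ‖hardyField N k lam x‖ ^ 2 := by
  have hx0 : ‖x‖ ≠ 0 := norm_ne_zero_iff.2 hx.2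
  have hm := mExp_sq hlam
  rw [norm_sq_hardyField hk hx, Finset.sum_congr rfl fun j _ => hasFDerivAt_hardyField_apply hx j,
    Finset.sum_sub_distrib, ← Finset.mul_sum, Finset.sum_sub_distrib]
  have h2 : ∑ j : Fin N, 2 * x j ^ 2 / ‖x‖ ^ 4 = 2 / ‖x‖ ^ 2 := by
    have : ∀ j : Fin N, 2 * x j ^ 2 / ‖x‖ ^ 4 = 2 / ‖x‖ ^ 4 * x j ^ 2 := fun j => by ring
    rw [Finset.sum_congr rfl fun j _ => this j, ← Finset.mul_sum,
      ← EuclideanSpace.real_norm_sq_eq]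
    field_simp
  rw [h2, Finset.sum_const, Finset.card_univ, Fintype.card_fin, nsmul_eq_mul]
  generalize mExp N k lam = m at hm ⊢
  -- The terms 1/x_j² cancel. With c = m - (N-2)/2 - k what remains is c(N-2) + c² + 2ck = m² -
  -- ((N-2)/2 + k)², which is -λ by the choice of m.
  have : lam = (((N : ℝ) - 2) / 2 + k) ^ 2 - m ^ 2 := by linarith
  rw [this]
  field_simp
  ring

/-- The integrand is the divergence of θV, by `divergence_hardyField`, and θV has compact support.
-/
lemma integral_inner_hardyField_gradient (hk : k ≤ N) (hlam : lam ≤ hardyConst N k)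
    {θ : Euc N → ℝ} (hθ : IsTest N k θ) :
    ∫ x, (inner ℝ (hardyField N k lam x) (gradient θ x) +
      θ x * (-(lam / ‖x‖ ^ 2) - ‖hardyField N k lam x‖ ^ 2)) = 0 := by
  set e : Fin N → Euc N := fun j => EuclideanSpace.single j 1
  set V : Fin N → Euc N → ℝ := fun j x => hardyField N k lam x j with hVdef
  have hU := isOpen_domain N k
  have hθ' : ∀ j, ContDiff ℝ ∞ fun x => fderiv ℝ θ x (e j) := fun j =>
    (hθ.smooth.fderiv_right (m := ∞) (by simp)).clm_apply contDiff_const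
  have hsθ' : ∀ j, tsupport (fun x => fderiv ℝ θ x (e j)) ⊆ tsupport θ := fun j =>
    closure_minimal (fun x hx => support_fderiv_subset ℝ (f := θ) (fun h => hx (by simp [h])))
      (isClosed_tsupport θ)
  have i1 : ∀ j, Integrable fun x => V j x * fderiv ℝ θ x (e j) := by
    intro j
    have hc : Continuous fun x => fderiv ℝ θ x (e j) • V j x :=
      continuous_smul_of_tsupport_subset hU (hθ' j).continuous ((hsθ' j).trans hθ.support)
        (contDiffOn_hardyField_apply j).continuousOn
    have hcs : HasCompactSupport fun x => fderiv ℝ θ x (e j) • V j x :=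
      HasCompactSupport.intro hθ.compact fun x hx => by
        rw [image_eq_zero_of_notMem_tsupport fun h => hx (hsθ' j h), zero_smul]
    refine (hc.integrable_of_hasCompactSupport hcs).congr (Eventually.of_forall fun x => ?_)
    simp [mul_comm]
  have i2 : ∀ j, Integrable fun x => fderiv ℝ (V j) x (e j) * θ x := by
    intro j
    have hc : Continuous fun x => θ x • fderiv ℝ (V j) x (e j) :=
      continuous_smul_of_tsupport_subset hU hθ.continuous hθ.support
        (((contDiffOn_hardyField_apply j).continuousOn_fderiv_of_isOpen hU (by simp)).clm_apply
          continuousOn_const)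
    refine (hc.integrable_of_hasCompactSupport hθ.compact.smul_right).congr
      (Eventually.of_forall fun x => ?_)
    simp [mul_comm]
  have i3 : ∀ j, Integrable fun x => V j x * θ x := by
    intro j
    have hc : Continuous fun x => θ x • V j x :=
      continuous_smul_of_tsupport_subset hU hθ.continuous hθ.support
        (contDiffOn_hardyField_apply j).continuousOn
    refine (hc.integrable_of_hasCompactSupport hθ.compact.smul_right).congr
      (Eventually.of_forall fun x => ?_)
    simp [mul_comm]
  have key : ∀ j, ∫ x, (V j x * fderiv ℝ θ x (e j) + fderiv ℝ (V j) x (e j) * θ x) = 0 := by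
    intro j
    rw [integral_add (i1 j) (i2 j), integral_mul_fderiv_eq_neg_fderiv_mul_of_integrable (i2 j)
      (i1 j) (i3 j) (fun x hx => ((contDiffOn_hardyField_apply j).contDiffAt
        (hU.mem_nhds (hθ.support hx))).differentiableAt (by simp))
      (fun x _ => hθ.differentiable x)]
    ring
  have hsum : ∫ x, ∑ j, (V j x * fderiv ℝ θ x (e j) + fderiv ℝ (V j) x (e j) * θ x) = 0 := by
    have hs := integral_finsetSum (μ := (volume : Measure (Euc N))) Finset.univ
      (f := fun j x => V j x * fderiv ℝ θ x (e j) + fderiv ℝ (V j) x (e j) * θ x)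
      fun j _ => (i1 j).add (i2 j)
    rw [hs]
    exact Finset.sum_eq_zero fun j _ => key j
  rw [← hsum]
  refine integral_congr_ae (Eventually.of_forall fun x => ?_)
  simp only
  rw [Finset.sum_add_distrib, ← Finset.sum_mul]
  congr 1
  · rw [real_inner_comm, inner_gradient_left]
    have : hardyField N k lam x = ∑ j, V j x • e j := by
      ext i; simp [V, e, Finset.sum_apply, Pi.single_apply]
    conv_lhs => rw [this]
    simp
  · by_cases hx : x ∈ tsupport θ
    · rw [divergence_hardyField hk hlam (hθ.support hx), mul_comm]
    · rw [image_eq_zero_of_notMem_tsupport hx]; simp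

/-- The Hardy form in terms of the ground state representation. -/
lemma hardyForm_eq (hk : k ≤ N) (hlam : lam ≤ hardyConst N k)
    {φ ψ : Euc N → ℝ} (hφ : IsTest N k φ) (hψ : IsTest N k ψ) :
    hardyForm N k lam φ ψ = inner ℝ (hφ.gradL2 (continuousOn_hardyField (lam := lam)))
      (hψ.gradL2 (continuousOn_hardyField (lam := lam))) := by
  -- The product (∇φ - φV)·(∇ψ - ψV) equals ∇φ·∇ψ - V·∇(φψ) + φψ|V|². Adding the divergence of φψV,
  -- which integrates to zero, leaves the Hardy form.
  set θ : Euc N → ℝ := fun x => φ x * ψ x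
  have hθ : IsTest N k θ := hφ.mul_smooth hψ.smooth.contDiffOn
  set g : Euc N → ℝ := fun x => inner ℝ (hardyField N k lam x) (gradient θ x) +
      θ x * (-(lam / ‖x‖ ^ 2) - ‖hardyField N k lam x‖ ^ 2) with hg
  have hg0 : ∫ x, g x ∂(cornerMeasure N k) = 0 := by
    rw [← integral_inner_hardyField_gradient hk hlam hθ]
    refine setIntegral_eq_integral_of_forall_compl_eq_zero fun x hx => ?_
    have hx' : x ∉ tsupport θ := fun h => hx (hθ.support h).1
    have h1 : gradient θ x = 0 := by
      by_contra h; exact hx' (support_gradient_subset θ h)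
    simp only [hg, h1, image_eq_zero_of_notMem_tsupport hx', inner_zero_right, zero_mul, add_zero]
  have hgi : Integrable g (cornerMeasure N k) := by
    have hU := isOpen_domain N k
    have hint : Integrable g volume := by
      have hsupp : HasCompactSupport g := HasCompactSupport.intro hθ.compact fun x hx' => by
        have h1 : gradient θ x = 0 := by
          by_contra h; exact hx' (support_gradient_subset θ h)
        simp only [hg, h1, image_eq_zero_of_notMem_tsupport hx', inner_zero_right, zero_mul, add_zero]
      refine Continuous.integrable_of_hasCompactSupport ?_ hsupp
      rw [continuous_iff_continuousAt]
      intro x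
      by_cases hx : x ∈ tsupport θ
      · have hxU := hθ.support hx
        have hx0 : ‖x‖ ^ 2 ≠ 0 := by have : x ≠ 0 := hxU.2; positivity
        have hVc := (continuousOn_hardyField (lam := lam)).continuousAt (hU.mem_nhds hxU)
        refine (hVc.inner (continuous_gradient hθ.smooth).continuousAt).add
          (hθ.continuous.continuousAt.mul ((ContinuousAt.neg ?_).sub (hVc.norm.pow 2)))
        exact continuousAt_const.div (by fun_prop) hx0
      · refine (continuousAt_const (y := (0 : ℝ))).congr ?_
        have h2 := notMem_tsupport_iff_eventuallyEq.1 hx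
        filter_upwards [h2, h2.eventuallyEq_nhds] with y hy hy2
        have h1 : gradient θ y = 0 := by rw [hy2.gradient_eq, gradient, fderiv_zero]; simp
        simp only [hg, h1, hy, Pi.zero_apply, inner_zero_right, zero_mul, add_zero]
    exact hint.restrict
  have hint2 : Integrable (fun x => inner ℝ (gradOp (hardyField N k lam) φ x)
      (gradOp (hardyField N k lam) ψ x)) (cornerMeasure N k) := by
    refine (((hφ.continuous_gradOp continuousOn_hardyField).inner
      (hψ.continuous_gradOp continuousOn_hardyField)).integrable_of_hasCompactSupport
      (HasCompactSupport.intro hφ.compact fun x hx => ?_)).restrict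
    rw [gradOp_of_notMem_tsupport hx, inner_zero_left]
  rw [inner_gradL2, hardyForm, ← add_zero (∫ x, inner ℝ (gradOp _ φ x) _ ∂_), ← hg0,
    ← integral_add hint2 hgi]
  refine integral_congr_ae ?_
  filter_upwards [] with x
  have h1 : gradient θ x = φ x • gradient ψ x + ψ x • gradient φ x := by
    simp only [gradient, θ, fderiv_fun_mul (hφ.differentiable x) (hψ.differentiable x), map_add,
      map_smul]
  simp only [hg, gradOp, h1, inner_sub_left, inner_sub_right, inner_add_right, inner_smul_left,
    inner_smul_right, real_inner_self_eq_norm_sq, RCLike.conj_to_real, θ,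
    real_inner_comm (hardyField N k lam x)]
  ring

end HardyField

/-! ### The operator A_λ, and existence and uniqueness of solutions. -/

section Operator

variable {N k : ℕ} {lam : ℝ}

/-- The resolvent `(1 + A_λ)⁻¹`. -/
abbrev hardyResolvent (N k : ℕ) (lam : ℝ) : L2 N k →L[ℝ] L2 N k :=
  relResolvent (testGraph N k (hardyField N k lam))

lemma tendsto_toL2_iff {φ : ℕ → Euc N → ℝ} (h : ∀ n, IsTest N k (φ n)) (u : L2 N k) :
    Tendsto (fun n => (h n).toL2) atTop (𝓝 u) ↔
      Tendsto (fun n => eLpNorm (fun x => φ n x - u x) 2 (cornerMeasure N k)) atTop (𝓝 0) := by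
  rw [Lp.tendsto_Lp_iff_tendsto_eLpNorm']
  refine tendsto_congr fun n => eLpNorm_congr_ae ?_
  filter_upwards [(h n).coeFn_toL2] with x hx
  simp [hx]

lemma gradL2_sub {V : Euc N → Euc N} (hV : ContinuousOn V (domain N k)) {φ ψ : Euc N → ℝ}
    (h : IsTest N k φ) (h' : IsTest N k ψ) :
    (h.sub h').gradL2 hV = h.gradL2 hV - h'.gradL2 hV := by
  refine Lp.ext ?_
  filter_upwards [(h.sub h').coeFn_gradL2 hV, h.coeFn_gradL2 hV, h'.coeFn_gradL2 hV,
    Lp.coeFn_sub (h.gradL2 hV) (h'.gradL2 hV)] with x h1 h2 h3 h4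
  rw [h1, h4, Pi.sub_apply, h2, h3, gradOp_sub h.differentiable h'.differentiable, Pi.sub_apply]

lemma tendsto_prod_atTop_iff {α : Type*} {l : Filter α} {f : ℕ × ℕ → α}
    (h : Tendsto f atTop l) : ∀ s ∈ l, ∃ M, ∀ n ≥ M, ∀ m ≥ M, f (n, m) ∈ s := by
  intro s hs
  obtain ⟨⟨a, b⟩, hab⟩ := (eventually_atTop (α := ℕ × ℕ)).1 (h hs)
  refine ⟨max a b, fun n hn m hm => hab (n, m) ?_⟩
  exact ⟨(le_max_left a b).trans hn, (le_max_right a b).trans hm⟩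

/-- The operator `A_λ` is characterized by its resolvent. -/
lemma hardyOperator_iff (hk : k ≤ N) (hlam : lam ≤ hardyConst N k) {u f : L2 N k} :
    HardyOperator lam u f ↔ hardyResolvent N k lam (u + f) = u := by
  have hV := continuousOn_hardyField (N := N) (k := k) (lam := lam)
  constructor
  · rintro ⟨φ, hφ, hlim⟩
    -- By the ground state representation, Cauchy in the form means that the images under S₀ are
    -- Cauchy in L². The limit gives a point of the closed graph, and the form equation becomes the
    -- orthogonality that characterizes `relResolvent`.
    set g : ℕ → VL2 N k := fun n => (hφ.test n).gradL2 hV with hg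
    have hform : ∀ n m, hardyForm N k lam (φ n - φ m) (φ n - φ m) = ‖g n - g m‖ ^ 2 := by
      intro n m
      rw [hardyForm_eq hk hlam ((hφ.test n).sub (hφ.test m)) ((hφ.test n).sub (hφ.test m)),
        gradL2_sub, real_inner_self_eq_norm_sq]
    have hcauchy : CauchySeq g := by
      rw [Metric.cauchySeq_iff]
      intro ε hε
      obtain ⟨M, hM⟩ := tendsto_prod_atTop_iff hφ.cauchy (Iio (ε ^ 2)) (Iio_mem_nhds (by positivity))
      refine ⟨M, fun n hn m hm => ?_⟩
      have h1 : hardyForm N k lam (φ n - φ m) (φ n - φ m) < ε ^ 2 := hM n hn m hm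
      rw [hform] at h1
      rw [dist_eq_norm]
      exact (sq_lt_sq₀ (norm_nonneg _) hε.le).1 h1
    obtain ⟨b, hb⟩ := cauchySeq_tendsto_of_complete hcauchy
    have hu := (tendsto_toL2_iff hφ.test u).2 hφ.tendsto
    refine relResolvent_eq_of (g := b) ?_ ?_
    · rw [← SetLike.mem_coe, Submodule.topologicalClosure_coe]
      exact mem_closure_of_tendsto (tendsto_pair_iff.2 ⟨hu, hb⟩)
        (Eventually.of_forall fun n => (hφ.test n).pair_mem hV)
    · intro p hp
      obtain ⟨ψ, hψ, rfl⟩ := exists_of_mem_testGraph hV hp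
      simp only [WithLp.toLp_fst, WithLp.toLp_snd]
      have h1 : Tendsto (fun n => inner ℝ (g n) (hψ.gradL2 hV)) atTop
          (𝓝 (inner ℝ b (hψ.gradL2 hV))) := hb.inner tendsto_const_nhds
      have h2 := hlim ψ hψ
      rw [← inner_toL2 hψ] at h2
      have h3 := tendsto_nhds_unique h1
        (h2.congr fun n => hardyForm_eq hk hlam (hφ.test n) hψ)
      rw [h3, inner_add_left]
  · intro h
    obtain ⟨b, hb, h1⟩ := exists_of_relResolvent_eq h
    have hb' : pair u b ∈ closure (testGraph N k (hardyField N k lam) : Set _) := by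
      rw [← Submodule.topologicalClosure_coe]; exact hb
    obtain ⟨p, hp, hlim⟩ := mem_closure_iff_seq_limit.1 hb'
    choose φ hφ hpe using fun n => exists_of_mem_testGraph hV (hp n)
    have hlim' : Tendsto (fun n => pair (hφ n).toL2 ((hφ n).gradL2 hV)) atTop (𝓝 (pair u b)) :=
      hlim.congr hpe
    rw [tendsto_pair_iff] at hlim'
    refine ⟨φ, ⟨hφ, ?_, (tendsto_toL2_iff hφ u).1 hlim'.1⟩, fun ψ hψ => ?_⟩
    · have h2 : Tendsto (fun q : ℕ × ℕ => ‖(hφ q.1).gradL2 hV - (hφ q.2).gradL2 hV‖ ^ 2)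
          atTop (𝓝 0) := by
        rw [← prod_atTop_atTop_eq]
        have h3 := ((hlim'.2.comp tendsto_fst).sub
          (hlim'.2.comp (tendsto_snd (f := (atTop : Filter ℕ)) (g := (atTop : Filter ℕ))))).norm.pow 2
        simpa using h3
      refine h2.congr fun q => ?_
      rw [hardyForm_eq hk hlam ((hφ q.1).sub (hφ q.2)) ((hφ q.1).sub (hφ q.2)),
        gradL2_sub, real_inner_self_eq_norm_sq]
    · rw [← inner_toL2 hψ]
      have h2 := h1 _ ((testGraph N k (hardyField N k lam)).le_topologicalClosure (hψ.pair_mem hV))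
      simp only [WithLp.toLp_fst, WithLp.toLp_snd, inner_add_left] at h2
      have h3 : inner ℝ f hψ.toL2 = inner ℝ b (hψ.gradL2 hV) := by linarith
      rw [h3]
      exact (hlim'.2.inner tendsto_const_nhds).congr fun n =>
        (hardyForm_eq hk hlam (hφ n) hψ).symm

/-- Solutions satisfy the equation tested against the operator domain. -/
lemma IsSolution.hasDerivAt_inner (hN : 2 ≤ N) (hk : k ≤ N) (hlam : lam ≤ hardyConst N k)
    {u₀ : L2 N k} {u : ℝ → L2 N k} (hu : IsSolution lam u₀ u) (g : L2 N k) {s : ℝ} (hs : 0 < s) :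
    HasDerivAt (fun t => inner ℝ (u t) (hardyResolvent N k lam g))
      (inner ℝ (u s) (hardyResolvent N k lam g - g)) s := by
  have hR := isResolvent_testGraph hN (continuousOn_hardyField (N := N) (k := k) (lam := lam))
  have h1 := ((hu.differentiable s hs).hasDerivAt).inner ℝ
    (hasDerivAt_const s (hardyResolvent N k lam g))
  refine h1.congr_deriv ?_
  have h2 := (hardyOperator_iff hk hlam).1 (hu.equation s hs)
  -- The equation R(u - u') = u is solved for R u' = R u - u, and the symmetry of R carries this
  -- over to g.
  rw [map_add, map_neg, ← sub_eq_add_neg, sub_eq_iff_eq_add, ← sub_eq_iff_eq_add'] at h2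
  rw [inner_zero_right, zero_add, ← hR.symm, inner_sub_right, ← hR.symm, ← inner_sub_left, h2]

/-- Bounded weak solutions agree with solutions. -/
lemma IsSolution.eq_of_weak (hN : 2 ≤ N) (hk : k ≤ N) (hlam : lam ≤ hardyConst N k)
    {u₀ : L2 N k} {u w : ℝ → L2 N k} (hu : IsSolution lam u₀ u) (hbu : ∀ t, 0 ≤ t → ‖u t‖ ≤ ‖u₀‖)
    {M : ℝ} (hM : ∀ t, 0 ≤ t → ‖w t‖ ≤ M) (h0 : w 0 = u₀)
    (hcont : ∀ g, ContinuousOn (fun t => inner ℝ (w t) g) (Ici 0))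
    (hw : ∀ g, ∀ t, 0 < t → HasDerivAt (fun t => inner ℝ (w t) (hardyResolvent N k lam g))
      (inner ℝ (w t) (hardyResolvent N k lam g - g)) t) {t : ℝ} (ht : 0 ≤ t) : w t = u t := by
  have hR := isResolvent_testGraph hN (continuousOn_hardyField (N := N) (k := k) (lam := lam))
  rw [← sub_eq_zero]
  refine eq_zero_of_weak_solution hR (w := fun t => w t - u t) (M := M + ‖u₀‖) ?_ ?_ ?_ ?_ ht
  · intro s hs
    exact (norm_sub_le _ _).trans (add_le_add (hM s hs) (hbu s hs))
  · intro g
    simp only [inner_sub_left]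
    exact (hcont g).sub (hu.continuous.inner continuousOn_const)
  · simp [h0, hu.initial]
  · intro g s hs
    simp only [inner_sub_left]
    exact (hw g s hs).sub (hu.hasDerivAt_inner hN hk hlam g hs)

/-- Strong solutions are contractions. -/
lemma exists_isSolution (hN : 2 ≤ N) (hk : k ≤ N) (hlam : lam ≤ hardyConst N k) (u₀ : L2 N k) :
    ∃ u : ℝ → L2 N k, IsSolution lam u₀ u ∧ ∀ t, 0 ≤ t → ‖u t‖ ≤ ‖u₀‖ := by
  have hR := isResolvent_testGraph hN (continuousOn_hardyField (N := N) (k := k) (lam := lam))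
  have hE := isHeatSemigroup hR
  refine ⟨fun t => heatE (hardyResolvent N k lam) t u₀, ⟨?_, hE.continuousOn u₀, ?_, ?_, ?_⟩,
    fun t ht => hE.norm_le t ht u₀⟩
  · simp [hE.zero]
  · exact fun t ht => (hE.hasDerivAt t ht u₀).differentiableAt
  · refine (hE.continuousOn_deriv u₀).congr fun t ht => (hE.hasDerivAt t ht u₀).deriv
  · intro t ht
    rw [hardyOperator_iff hk hlam, (hE.hasDerivAt t ht u₀).deriv, ← sub_eq_add_neg]
    exact hE.resolvent_sub t ht u₀

/-- The derivative of ‖u‖² is -2⟨A u, u⟩. With z = (1 + A)u and R z = u, its sign is the inequality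
‖R z‖² ≤ ⟨R z, z⟩. Boundedness of all solutions is what the uniqueness theorem needs. -/
lemma IsSolution.norm_le (hN : 2 ≤ N) (hk : k ≤ N) (hlam : lam ≤ hardyConst N k)
    {u₀ : L2 N k} {u : ℝ → L2 N k} (hu : IsSolution lam u₀ u) {t : ℝ} (ht : 0 ≤ t) :
    ‖u t‖ ≤ ‖u₀‖ := by
  have hR := isResolvent_testGraph hN (continuousOn_hardyField (N := N) (k := k) (lam := lam))
  have hanti : AntitoneOn (fun t => ‖u t‖ ^ 2) (Ici 0) := by
    refine antitoneOn_of_deriv_nonpos (convex_Ici 0) (hu.continuous.norm.pow 2) ?_ ?_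
    · intro s hs
      rw [interior_Ici] at hs
      exact ((hu.differentiable s hs).norm_sq ℝ).differentiableWithinAt
    · intro s hs
      rw [interior_Ici] at hs
      rw [((hu.differentiable s hs).hasDerivAt.norm_sq).deriv]
      have h2 := (hardyOperator_iff hk hlam).1 (hu.equation s hs)
      set z := u s + -deriv u s with hz
      have h3 := hR.sq_le z
      have h4 : deriv u s = u s - z := by rw [hz]; abel
      rw [h4, inner_sub_right, real_inner_self_eq_norm_sq]
      rw [h2] at h3
      linarith
  have := hanti (mem_Ici.2 le_rfl) ht ht
  simp only [hu.initial] at this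
  exact (sq_le_sq₀ (norm_nonneg _) (norm_nonneg _)).1 this

lemma IsSolution.unique (hN : 2 ≤ N) (hk : k ≤ N) (hlam : lam ≤ hardyConst N k)
    {u₀ : L2 N k} {u w : ℝ → L2 N k} (hu : IsSolution lam u₀ u) (hw : IsSolution lam u₀ w)
    {t : ℝ} (ht : 0 ≤ t) : w t = u t := by
  have hR := isResolvent_testGraph hN (continuousOn_hardyField (N := N) (k := k) (lam := lam))
  refine hu.eq_of_weak hN hk hlam (fun t ht => hu.norm_le hN hk hlam ht)
    (fun t ht => hw.norm_le hN hk hlam ht) hw.initial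
    (fun g => hw.continuous.inner continuousOn_const)
    (fun g s hs => hw.hasDerivAt_inner hN hk hlam g hs) ht

end Operator

/-! ### The ground state α: logarithmic gradient, pointwise bounds, integrability. -/

section GroundState

variable {N k : ℕ} {lam : ℝ}

/-- The logarithmic gradient of `α_{k,λ}`. -/
def oscField (N k : ℕ) (lam : ℝ) (x : Euc N) : Euc N := hardyField N k lam x - (1 / 4 : ℝ) • x

lemma continuousOn_oscField : ContinuousOn (oscField N k lam) (domain N k) :=
  continuousOn_hardyField.sub (by fun_prop)

/-- The coordinates that are positive on the corner. -/
abbrev cornerIdx (N k : ℕ) : Finset (Fin N) :=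
  Finset.univ.filter (fun i : Fin N => N ≤ (i : ℕ) + k)

lemma mem_cornerIdx {i : Fin N} : i ∈ cornerIdx N k ↔ N ≤ (i : ℕ) + k := by simp

/-- The logarithm of `α_{k,λ}` on the punctured corner. -/
def logAlpha (N k : ℕ) (lam : ℝ) (x : Euc N) : ℝ :=
  -‖x‖ ^ 2 / 8 + (mExp N k lam - ((N : ℝ) - 2) / 2 - k) * (Real.log (‖x‖ ^ 2) / 2) +
    ∑ i ∈ cornerIdx N k, Real.log (x i)

lemma alpha_eq_exp {x : Euc N} (hx : x ∈ domain N k) :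
    alpha N k lam x = Real.exp (logAlpha N k lam x) := by
  have hx0 : 0 < ‖x‖ := norm_pos_iff.2 hx.2
  have h1 : Real.log (‖x‖ ^ 2) / 2 = Real.log ‖x‖ := by rw [Real.log_pow]; push_cast; ring
  rw [alpha, logAlpha, Real.exp_add, Real.exp_add, Real.exp_sum, h1, mul_comm _ (Real.log ‖x‖),
    ← Real.rpow_def_of_pos hx0, Real.rpow_sub_natCast hx0.ne',
    Finset.prod_congr rfl fun i hi => Real.exp_log (hx.1 i (mem_cornerIdx.1 hi))]
  ring

lemma alpha_pos {x : Euc N} (hx : x ∈ domain N k) : 0 < alpha N k lam x := by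
  rw [alpha_eq_exp hx]; exact Real.exp_pos _

lemma contDiffOn_alpha : ContDiffOn ℝ ∞ (alpha N k lam) (domain N k) := by
  have h : ContDiffOn ℝ ∞ (fun x => Real.exp (logAlpha N k lam x)) (domain N k) := by
    refine ContDiffOn.exp ?_
    refine ContDiffOn.add (ContDiffOn.add ?_ ?_) ?_
    · exact ((contDiff_norm_sq ℝ).neg.div_const 8).contDiffOn
    · refine contDiffOn_const.mul (ContDiffOn.div_const (ContDiffOn.log
        (contDiff_norm_sq ℝ).contDiffOn fun x hx => ?_) 2)
      have : x ≠ 0 := hx.2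
      positivity
    · refine ContDiffOn.sum fun i hi => ContDiffOn.log (by fun_prop) fun x hx => ?_
      exact (hx.1 i (mem_cornerIdx.1 hi)).ne'
  exact h.congr fun x hx => alpha_eq_exp hx

lemma hasGradientAt_logAlpha {x : Euc N} (hx : x ∈ domain N k) :
    HasGradientAt (logAlpha N k lam) (oscField N k lam x) x := by
  have hx0 : ‖x‖ ≠ 0 := norm_ne_zero_iff.2 hx.2
  have d1 : HasFDerivAt (fun x : Euc N => ‖x‖ ^ 2) (2 • innerSL ℝ x) x :=
    (hasStrictFDerivAt_norm_sq x).hasFDerivAt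
  have d2 := d1.log (by positivity)
  have d3 : HasFDerivAt (fun x : Euc N => ∑ i ∈ cornerIdx N k, Real.log (x i))
      (∑ i ∈ cornerIdx N k, (x i)⁻¹ • (EuclideanSpace.proj i : Euc N →L[ℝ] ℝ)) x := by
    refine HasFDerivAt.fun_sum fun i hi => ?_
    exact (EuclideanSpace.proj i : Euc N →L[ℝ] ℝ).hasFDerivAt.log
      (hx.1 i (mem_cornerIdx.1 hi)).ne'
  have d4 := (((d1.neg.mul_const (1 / 8 : ℝ))).add ((d2.mul_const (1 / 2 : ℝ)).const_mul
    (mExp N k lam - ((N : ℝ) - 2) / 2 - k))).add d3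
  rw [hasGradientAt_iff_hasFDerivAt]
  have e : logAlpha N k lam = fun x => (-‖x‖ ^ 2) * (1 / 8) +
      (mExp N k lam - ((N : ℝ) - 2) / 2 - k) * (Real.log (‖x‖ ^ 2) * (1 / 2)) +
      ∑ i ∈ cornerIdx N k, Real.log (x i) := by
    ext x; simp only [logAlpha]; ring
  rw [e]
  refine d4.congr_fderiv ?_
  ext y
  have h1 : inner ℝ (hardyField N k lam x) y = (mExp N k lam - ((N : ℝ) - 2) / 2 - k) / ‖x‖ ^ 2 *
      inner ℝ x y + ∑ i ∈ cornerIdx N k, (x i)⁻¹ * y i := by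
    rw [PiLp.inner_apply, PiLp.inner_apply, Finset.mul_sum, Finset.sum_filter,
      ← Finset.sum_add_distrib]
    refine Finset.sum_congr rfl fun j _ => ?_
    rw [hardyField_apply]
    have : ∀ a b : ℝ, inner ℝ a b = b * a := fun a b => by simp
    rw [this, this]
    split_ifs <;> ring
  simp [oscField, h1]
  field_simp
  ring

lemma hasGradientAt_alpha {x : Euc N} (hx : x ∈ domain N k) :
    HasGradientAt (alpha N k lam) (alpha N k lam x • oscField N k lam x) x := by
  have h1 := (hasGradientAt_iff_hasFDerivAt.1 (hasGradientAt_logAlpha (lam := lam) hx)).exp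
  rw [hasGradientAt_iff_hasFDerivAt, map_smul, alpha_eq_exp hx]
  refine h1.congr_of_eventuallyEq ?_
  filter_upwards [(isOpen_domain N k).mem_nhds hx] with y hy using alpha_eq_exp hy

/-- `S (α χ) = α ∇χ`. -/
lemma gradOp_oscField {φ χ : Euc N → ℝ} {x : Euc N} (hx : x ∈ domain N k) {g : Euc N}
    (hχ : HasGradientAt χ g x) (hφ : φ =ᶠ[𝓝 x] fun x => alpha N k lam x * χ x) :
    gradOp (oscField N k lam) φ x = alpha N k lam x • g := by
  have h1 : HasGradientAt φ (alpha N k lam x • g + χ x • (alpha N k lam x • oscField N k lam x))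
      x := by
    rw [hasGradientAt_iff_hasFDerivAt]
    refine (((hasGradientAt_iff_hasFDerivAt.1 (hasGradientAt_alpha hx)).mul
      (hasGradientAt_iff_hasFDerivAt.1 hχ)).congr_of_eventuallyEq hφ).congr_fderiv ?_
    simp only [map_add, map_smul]
  rw [gradOp, h1.gradient, hφ.eq_of_nhds]
  module

lemma prod_div_norm_le_one (hk : k ≤ N) {x : Euc N} (hx : x ∈ domain N k) :
    (∏ i ∈ cornerIdx N k, x i) / ‖x‖ ^ k ≤ 1 := by
  have hx0 : 0 < ‖x‖ := norm_pos_iff.2 hx.2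
  rw [div_le_one (by positivity)]
  calc ∏ i ∈ cornerIdx N k, x i ≤ ∏ i ∈ cornerIdx N k, ‖x‖ := by
        refine Finset.prod_le_prod (fun i hi => (hx.1 i (mem_cornerIdx.1 hi)).le) fun i _ => ?_
        exact (le_abs_self _).trans (PiLp.norm_apply_le x i)
    _ = ‖x‖ ^ k := by rw [Finset.prod_const, card_filter_corner hk]

/-- Keeping one factor x_i compensates the singular component 1/x_i of the logarithmic gradient, so
that |∇α| stays bounded up to the boundary away from the origin. -/
lemma prod_div_norm_le (hk : k ≤ N) {x : Euc N} (hx : x ∈ domain N k) {i : Fin N}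
    (hi : i ∈ cornerIdx N k) : (∏ i ∈ cornerIdx N k, x i) / ‖x‖ ^ k ≤ x i / ‖x‖ := by
  have hx0 : 0 < ‖x‖ := norm_pos_iff.2 hx.2
  have h0 : k ≠ 0 := by
    rintro rfl
    have := i.2
    have := mem_cornerIdx.1 hi
    omega
  have hcard : ((cornerIdx N k).erase i).card = k - 1 := by
    rw [Finset.card_erase_of_mem hi, card_filter_corner hk]
  have h1 : ∏ j ∈ (cornerIdx N k).erase i, x j ≤ ‖x‖ ^ (k - 1) := by
    rw [← hcard, ← Finset.prod_const]
    refine Finset.prod_le_prod (fun j hj =>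
      (hx.1 j (mem_cornerIdx.1 (Finset.mem_of_mem_erase hj))).le) fun j _ => ?_
    exact (le_abs_self _).trans (PiLp.norm_apply_le x j)
  rw [← Finset.mul_prod_erase _ _ hi, div_le_div_iff₀ (by positivity) hx0]
  have h2 : ‖x‖ ^ k = ‖x‖ ^ (k - 1) * ‖x‖ := by
    rw [← pow_succ, Nat.sub_add_cancel (Nat.one_le_iff_ne_zero.2 h0)]
  rw [h2]
  have h3 := hx.1 i (mem_cornerIdx.1 hi)
  have h4 := mul_le_mul_of_nonneg_left h1 (mul_pos h3 hx0).le
  linarith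

lemma alpha_le (hk : k ≤ N) {x : Euc N} (hx : x ∈ domain N k) :
    alpha N k lam x ≤
      Real.exp (-‖x‖ ^ 2 / 8) * ‖x‖ ^ (mExp N k lam - ((N : ℝ) - 2) / 2) := by
  have h := prod_div_norm_le_one hk hx
  exact mul_le_of_le_one_right (by positivity) h

lemma alpha_div_le (hk : k ≤ N) {x : Euc N} (hx : x ∈ domain N k) {i : Fin N}
    (hi : i ∈ cornerIdx N k) : alpha N k lam x * (x i)⁻¹ ≤
      Real.exp (-‖x‖ ^ 2 / 8) * ‖x‖ ^ (mExp N k lam - ((N : ℝ) - 2) / 2) * ‖x‖⁻¹ := by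
  have hpos := hx.1 i (mem_cornerIdx.1 hi)
  have h := prod_div_norm_le hk hx hi
  have h1 : alpha N k lam x ≤ Real.exp (-‖x‖ ^ 2 / 8) *
      ‖x‖ ^ (mExp N k lam - ((N : ℝ) - 2) / 2) * (x i / ‖x‖) :=
    mul_le_mul_of_nonneg_left h (by positivity)
  calc alpha N k lam x * (x i)⁻¹ ≤ _ * (x i)⁻¹ := mul_le_mul_of_nonneg_right h1 (by positivity)
    _ = _ := by field_simp

/-- Bound for `|∇α|`. -/
lemma alpha_mul_norm_oscField_le (hk : k ≤ N) {x : Euc N} (hx : x ∈ domain N k) :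
    alpha N k lam x * ‖oscField N k lam x‖ ≤
      Real.exp (-‖x‖ ^ 2 / 8) * ‖x‖ ^ (mExp N k lam - ((N : ℝ) - 2) / 2) * ‖x‖⁻¹ *
        (|mExp N k lam - ((N : ℝ) - 2) / 2 - k| + k + ‖x‖ ^ 2) := by
  have hx0 : 0 < ‖x‖ := norm_pos_iff.2 hx.2
  set c := mExp N k lam - ((N : ℝ) - 2) / 2 - k with hc
  set B := Real.exp (-‖x‖ ^ 2 / 8) * ‖x‖ ^ (mExp N k lam - ((N : ℝ) - 2) / 2) with hB
  have hB0 : 0 ≤ B := by positivity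
  have ha := (alpha_pos (lam := lam) hx).le
  have e : hardyField N k lam x = (c / ‖x‖ ^ 2) • x +
      ∑ i ∈ cornerIdx N k, (x i)⁻¹ • EuclideanSpace.single i (1 : ℝ) := by
    ext j
    rw [hardyField_apply]
    simp [Finset.sum_apply, Pi.single_apply, Finset.sum_ite_eq, Finset.mem_filter, hc]
    ring_nf
  have h1 : ‖oscField N k lam x‖ ≤ |c| / ‖x‖ + ∑ i ∈ cornerIdx N k, (x i)⁻¹ + ‖x‖ := by
    rw [oscField, e]
    refine (norm_sub_le _ _).trans (add_le_add ((norm_add_le _ _).trans (add_le_add ?_ ?_)) ?_)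
    · rw [norm_smul, norm_div, Real.norm_eq_abs, norm_pow, norm_norm]
      apply le_of_eq; field_simp
    · refine (norm_sum_le _ _).trans (Finset.sum_le_sum fun i hi => ?_)
      rw [norm_smul, PiLp.norm_single, norm_one, mul_one, Real.norm_of_nonneg]
      exact inv_nonneg.2 (hx.1 i (mem_cornerIdx.1 hi)).le
    · rw [norm_smul]; norm_num; linarith
  calc alpha N k lam x * ‖oscField N k lam x‖
      ≤ alpha N k lam x * (|c| / ‖x‖ + ∑ i ∈ cornerIdx N k, (x i)⁻¹ + ‖x‖) :=
        mul_le_mul_of_nonneg_left h1 ha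
    _ = alpha N k lam x * (|c| / ‖x‖) + ∑ i ∈ cornerIdx N k, alpha N k lam x * (x i)⁻¹ +
        alpha N k lam x * ‖x‖ := by rw [mul_add, mul_add, Finset.mul_sum]
    _ ≤ B * (|c| / ‖x‖) + ∑ i ∈ cornerIdx N k, B * ‖x‖⁻¹ + B * ‖x‖ := by
        refine add_le_add (add_le_add ?_ (Finset.sum_le_sum fun i hi => alpha_div_le hk hx hi)) ?_
        · exact mul_le_mul_of_nonneg_right (alpha_le hk hx) (by positivity)
        · exact mul_le_mul_of_nonneg_right (alpha_le hk hx) hx0.le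
    _ = _ := by
        rw [Finset.sum_const, card_filter_corner hk, nsmul_eq_mul]
        field_simp

lemma measurable_alpha : Measurable (alpha N k lam) := by
  unfold alpha
  fun_prop

/-- In polar coordinates the radial factor is r^{N-1} r^{2m-(N-2)} = r^{2m+1}, integrable at 0
because m ≥ 0. -/
lemma integrable_alpha_bound (hN : 2 ≤ N) : Integrable (fun x : Euc N =>
    Real.exp (-‖x‖ ^ 2 / 4) * ‖x‖ ^ (2 * (mExp N k lam - ((N : ℝ) - 2) / 2))) := by
  have : Nonempty (Fin N) := ⟨⟨0, by omega⟩⟩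
  have h := integrable_fun_norm_addHaar (volume : Measure (Euc N)) (f := fun y : ℝ =>
    Real.exp (-y ^ 2 / 4) * y ^ (2 * (mExp N k lam - ((N : ℝ) - 2) / 2)))
  refine h.2 ?_
  have hm : 0 ≤ mExp N k lam := Real.sqrt_nonneg _
  have h2 := integrableOn_rpow_mul_exp_neg_mul_sq (b := 1 / 4) (by norm_num)
    (s := 2 * mExp N k lam + 1) (by linarith)
  refine h2.congr_fun (fun y hy => ?_) measurableSet_Ioi
  have hy : 0 < y := hy
  simp only [finrank_euclideanSpace, Fintype.card_fin, smul_eq_mul]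
  rw [← Real.rpow_natCast y (N - 1), mul_comm (Real.exp _), ← mul_assoc, ← Real.rpow_add hy]
  congr 2
  · rw [Nat.cast_sub (by omega)]; push_cast; ring
  · ring

lemma alpha_sq_le (hk : k ≤ N) {x : Euc N} (hx : x ∈ domain N k) : alpha N k lam x ^ 2 ≤
    Real.exp (-‖x‖ ^ 2 / 4) * ‖x‖ ^ (2 * (mExp N k lam - ((N : ℝ) - 2) / 2)) := by
  have hx0 : 0 < ‖x‖ := norm_pos_iff.2 hx.2
  refine (pow_le_pow_left₀ (alpha_pos hx).le (alpha_le hk hx) 2).trans (le_of_eq ?_)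
  rw [mul_pow, ← Real.rpow_natCast (‖x‖ ^ _), ← Real.rpow_mul hx0.le, pow_two, ← Real.exp_add]
  congr 2
  · ring
  · push_cast; ring

lemma memLp_alpha (hN : 2 ≤ N) (hk : k ≤ N) : MemLp (alpha N k lam) 2 (cornerMeasure N k) := by
  rw [memLp_two_iff_integrable_sq measurable_alpha.aestronglyMeasurable]
  refine ((integrable_alpha_bound (k := k) (lam := lam) hN).restrict (s := corner N k)).mono'
    (measurable_alpha.pow_const 2).aestronglyMeasurable ?_
  filter_upwards [ae_mem_domain hN k] with x hx
  rw [Real.norm_of_nonneg (sq_nonneg _)]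
  exact alpha_sq_le hk hx

end GroundState

/-! ### Dominated convergence in L². -/

section Dominated

variable {X E : Type*} [MeasurableSpace X] {μ : Measure X} [NormedAddCommGroup E]

/-- Dominated convergence in `L²`. -/
lemma tendsto_eLpNorm_two_of_dominated {f : ℕ → X → E} {F : X → E} {g : X → ℝ}
    (hf : ∀ n, AEStronglyMeasurable (f n) μ) (hF : AEStronglyMeasurable F μ) (hg : MemLp g 2 μ)
    (hle : ∀ n, ∀ᵐ x ∂μ, ‖f n x - F x‖ ≤ g x)
    (hlim : ∀ᵐ x ∂μ, Tendsto (fun n => f n x) atTop (𝓝 (F x))) :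
    Tendsto (fun n => eLpNorm (fun x => f n x - F x) 2 μ) atTop (𝓝 0) := by
  have h1 : Tendsto (fun n => ∫⁻ x, ‖f n x - F x‖ₑ ^ (2 : ℝ) ∂μ) atTop (𝓝 (∫⁻ x, 0 ∂μ)) := by
    refine tendsto_lintegral_of_dominated_convergence' (fun x => ‖g x‖ₑ ^ (2 : ℝ))
      (fun n => (((hf n).sub hF).enorm.pow_const _)) ?_ ?_ ?_
    · intro n
      filter_upwards [hle n] with x hx
      gcongr
      exact enorm_le_iff_norm_le.2 (hx.trans (le_abs_self _))
    · have := (lintegral_rpow_enorm_lt_top_of_eLpNorm_lt_top (p := 2) (by simp) (by simp)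
        hg.eLpNorm_lt_top)
      simpa using this.ne
    · filter_upwards [hlim] with x hx
      have h2 : Tendsto (fun n => ‖f n x - F x‖ₑ) atTop (𝓝 0) := by
        have := (hx.sub_const (F x)).enorm
        simpa using this
      have h3 := (ENNReal.continuous_rpow_const (y := 2)).tendsto (0 : ℝ≥0∞) |>.comp h2
      simpa [Function.comp_def] using h3
  rw [lintegral_zero] at h1
  have h4 := (ENNReal.continuous_rpow_const (y := 1 / 2)).tendsto (0 : ℝ≥0∞) |>.comp h1
  rw [ENNReal.zero_rpow_of_pos (by norm_num)] at h4
  refine h4.congr fun n => ?_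
  rw [eLpNorm_eq_lintegral_rpow_enorm_toReal (by simp) (by simp)]
  simp

lemma toLp_tendsto_of_dominated {f : ℕ → X → E} {F : X → E} {g : X → ℝ}
    (hf : ∀ n, MemLp (f n) 2 μ) (hF : MemLp F 2 μ) (hg : MemLp g 2 μ)
    (hle : ∀ n, ∀ᵐ x ∂μ, ‖f n x - F x‖ ≤ g x)
    (hlim : ∀ᵐ x ∂μ, Tendsto (fun n => f n x) atTop (𝓝 (F x))) :
    Tendsto (fun n => (hf n).toLp (f n)) atTop (𝓝 (hF.toLp F)) := by
  rw [Lp.tendsto_Lp_iff_tendsto_eLpNorm'']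
  exact tendsto_eLpNorm_two_of_dominated (fun n => (hf n).1) hF.1 hg hle hlim

end Dominated

/-! ### Cutoffs of the ground state. -/

section Cutoff

variable {N k : ℕ} {lam : ℝ}

lemma isTest_indicator {f : Euc N → ℝ} (hf : ContDiffOn ℝ ∞ f (domain N k)) {K : Set (Euc N)}
    (hK : IsCompact K) (hKU : K ⊆ domain N k) (h0 : ∀ x ∈ domain N k, x ∉ K → f x = 0) :
    IsTest N k ((domain N k).indicator f) := by
  have hz : ∀ x, x ∉ K → (domain N k).indicator f x = 0 := by
    intro x hx
    by_cases h : x ∈ domain N k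
    · rw [indicator_of_mem h, h0 x h hx]
    · exact indicator_of_notMem h f
  refine ⟨?_, HasCompactSupport.intro hK hz, (closure_minimal ?_ hK.isClosed).trans hKU⟩
  · rw [contDiff_iff_contDiffAt]
    intro x
    by_cases h : x ∈ domain N k
    · have hn := (isOpen_domain N k).mem_nhds h
      refine (hf.contDiffAt hn).congr_of_eventuallyEq ?_
      filter_upwards [hn] with y hy using indicator_of_mem hy f
    · refine (contDiffAt_const (c := (0 : ℝ))).congr_of_eventuallyEq ?_
      filter_upwards [hK.isClosed.isOpen_compl.mem_nhds fun hx => h (hKU hx)] with y hy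
      exact hz y hy
  · intro x hx
    by_contra h
    exact hx (hz x h)

/-- A smooth cutoff function on the line. -/
def cutoff : ContDiffBump (0 : ℝ) := ⟨1, 2, one_pos, one_lt_two⟩

lemma cutoff_eq_one {t : ℝ} (ht : |t| ≤ 1) : cutoff t = 1 :=
  cutoff.one_of_mem_closedBall (by simpa [cutoff] using ht)

lemma cutoff_eq_zero {t : ℝ} (ht : 2 ≤ |t|) : cutoff t = 0 :=
  cutoff.zero_of_le_dist (by simpa [cutoff] using ht)

lemma contDiff_cutoff : ContDiff ℝ ∞ cutoff := cutoff.contDiff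

lemma abs_cutoff_le (t : ℝ) : |cutoff t| ≤ 1 := by
  rw [abs_of_nonneg cutoff.nonneg]; exact cutoff.le_one

lemma deriv_cutoff_eq_zero {t : ℝ} (ht : 2 < |t|) : deriv cutoff t = 0 := by
  have h : cutoff =ᶠ[𝓝 t] fun _ => (0 : ℝ) := by
    filter_upwards [(isOpen_lt continuous_const continuous_abs).mem_nhds ht] with s hs
    exact cutoff_eq_zero (le_of_lt hs)
  rw [h.deriv_eq, deriv_const]

lemma exists_bound_deriv_cutoff : ∃ C, 0 ≤ C ∧ ∀ t, |deriv cutoff t| ≤ C := by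
  have h : HasCompactSupport (deriv cutoff) := cutoff.hasCompactSupport.deriv
  obtain ⟨C, hC⟩ := h.exists_bound_of_continuous
    (contDiff_cutoff.continuous_deriv (by simp))
  exact ⟨C, (norm_nonneg _).trans (hC 0), hC⟩

/-- The logarithmic radial cutoff. -/
def radialCutoff (n : ℝ) (x : Euc N) : ℝ := cutoff (Real.log (‖x‖ ^ 2) / n)

/-- The gradient of the radial cutoff. -/
def radialCutoffGrad (n : ℝ) (x : Euc N) : Euc N :=
  (deriv cutoff (Real.log (‖x‖ ^ 2) / n) * (2 / n)) • (‖x‖ ^ 2)⁻¹ • x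

/-- The cutoff of the ground state near the boundary, near the origin and near infinity. -/
def groundCutoff (n ε a : ℝ) (x : Euc N) : ℝ := radialCutoff n x * (1 - cutoff (a / ε))

lemma contDiffOn_radialCutoff (n : ℝ) : ContDiffOn ℝ ∞ (radialCutoff n) (domain N k) := by
  refine contDiff_cutoff.comp_contDiffOn (ContDiffOn.div_const (ContDiffOn.log
    (contDiff_norm_sq ℝ).contDiffOn fun x hx => ?_) n)
  have : x ≠ 0 := hx.2
  positivity

lemma hasGradientAt_radialCutoff (n : ℝ) {x : Euc N} (hx : x ≠ 0) :
    HasGradientAt (radialCutoff n) (radialCutoffGrad n x) x := by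
  have d1 : HasFDerivAt (fun x : Euc N => ‖x‖ ^ 2) (2 • innerSL ℝ x) x :=
    (hasStrictFDerivAt_norm_sq x).hasFDerivAt
  have d2 := (d1.log (by positivity)).mul_const n⁻¹
  have d3 : HasDerivAt cutoff (deriv cutoff (Real.log (‖x‖ ^ 2) * n⁻¹))
      (Real.log (‖x‖ ^ 2) * n⁻¹) :=
    (contDiff_cutoff.differentiable (by simp)).differentiableAt.hasDerivAt
  have d4 := d3.comp_hasFDerivAt x d2
  rw [hasGradientAt_iff_hasFDerivAt]
  have e : (radialCutoff n : Euc N → ℝ) = cutoff ∘ fun x => Real.log (‖x‖ ^ 2) * n⁻¹ := by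
    ext x; simp [radialCutoff, div_eq_mul_inv]
  rw [e]
  refine d4.congr_fderiv ?_
  ext y
  simp [radialCutoffGrad, div_eq_mul_inv]
  ring

/-- The boundary cutoff is a function of α/ε rather than of the distance to the boundary. Its
gradient contains s·χ'(s) with s = α/ε, which is bounded; multiplied by α it is controlled by |∇α|,
uniformly in ε. -/
lemma hasGradientAt_groundCutoff (n ε : ℝ) {x : Euc N} (hx : x ∈ domain N k) :
    HasGradientAt (fun x => groundCutoff n ε (alpha N k lam x) x)
      ((1 - cutoff (alpha N k lam x / ε)) • radialCutoffGrad n x -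
        (radialCutoff n x * (deriv cutoff (alpha N k lam x / ε) * (alpha N k lam x / ε))) •
          oscField N k lam x) x := by
  have d1 := hasGradientAt_iff_hasFDerivAt.1 (hasGradientAt_radialCutoff n hx.2)
  have d2 := (hasGradientAt_iff_hasFDerivAt.1 (hasGradientAt_alpha (lam := lam) hx)).mul_const ε⁻¹
  have d3 : HasDerivAt cutoff (deriv cutoff (alpha N k lam x * ε⁻¹)) (alpha N k lam x * ε⁻¹) :=
    (contDiff_cutoff.differentiable (by simp)).differentiableAt.hasDerivAt
  have d4 := d1.mul ((d3.comp_hasFDerivAt x d2).const_sub 1)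
  rw [hasGradientAt_iff_hasFDerivAt]
  have e : (fun x => groundCutoff n ε (alpha N k lam x) x) =
      (radialCutoff n * fun x : Euc N => 1 - (cutoff ∘ fun x => alpha N k lam x * ε⁻¹) x) := by
    ext x; simp [groundCutoff, div_eq_mul_inv]
  rw [e]
  refine d4.congr_fderiv ?_
  ext y
  simp [div_eq_mul_inv]
  ring

lemma continuousOn_alpha_annulus {r : ℝ} (hr : 0 < r) :
    ContinuousOn (alpha N k lam) {x | r ≤ ‖x‖} := by
  unfold alpha
  have h0 : ∀ x ∈ {x : Euc N | r ≤ ‖x‖}, ‖x‖ ≠ 0 := fun x hx => (hr.trans_le hx).ne'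
  refine ContinuousOn.mul (ContinuousOn.mul (by fun_prop) ?_) (ContinuousOn.div (by fun_prop)
    (by fun_prop) fun x hx => pow_ne_zero _ (h0 x hx))
  exact continuous_norm.continuousOn.rpow_const fun x hx => Or.inl (h0 x hx)

/-- The set on which the truncated ground state lives. -/
def cutoffSet (N k : ℕ) (lam n ε : ℝ) : Set (Euc N) :=
  {x | Real.exp (-n) ≤ ‖x‖} ∩ alpha N k lam ⁻¹' Ici ε ∩
    (Metric.closedBall 0 (Real.exp n) ∩ ⋂ i ∈ cornerIdx N k, {x | 0 ≤ x i})

lemma isCompact_cutoffSet (n ε : ℝ) : IsCompact (cutoffSet N k lam n ε) := by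
  have hc : IsClosed {x : Euc N | Real.exp (-n) ≤ ‖x‖} :=
    isClosed_le continuous_const continuous_norm
  refine IsCompact.of_isClosed_subset (isCompact_closedBall (0 : Euc N) (Real.exp n)) ?_
    fun x hx => hx.2.1
  refine ((continuousOn_alpha_annulus (Real.exp_pos _)).preimage_isClosed_of_isClosed hc
    isClosed_Ici).inter (Metric.isClosed_closedBall.inter ?_)
  exact isClosed_biInter fun i _ => isClosed_le continuous_const (by fun_prop)

/-- In the closed corner α vanishes wherever one of the restricted coordinates does, so α ≥ ε keeps
the set off the boundary. -/
lemma cutoffSet_subset_domain {n ε : ℝ} (hε : 0 < ε) :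
    cutoffSet N k lam n ε ⊆ domain N k := by
  rintro x ⟨⟨h1, h2⟩, -, h3⟩
  have h1 : Real.exp (-n) ≤ ‖x‖ := h1
  have h2 : ε ≤ alpha N k lam x := h2
  refine ⟨fun i hi => ?_, norm_pos_iff.1 ((Real.exp_pos _).trans_le h1)⟩
  have h4 : 0 ≤ x i := mem_iInter₂.1 h3 i (mem_cornerIdx.2 hi)
  rcases h4.eq_or_lt with h5 | h5
  · rw [alpha, Finset.prod_eq_zero (mem_cornerIdx.2 hi) h5.symm] at h2
    simp only [zero_div, mul_zero] at h2
    linarith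
  · exact h5

/-- Since log ‖x‖² = 2 log ‖x‖, the support condition |·| ≤ 2 of the cutoff means |log ‖x‖| ≤ n. -/
lemma abs_log_norm_sq_le_of_radialCutoff {n : ℝ} (hn : 0 < n) {x : Euc N} (hx : x ≠ 0)
    (h : |Real.log (‖x‖ ^ 2) / n| ≤ 2) : Real.exp (-n) ≤ ‖x‖ ∧ ‖x‖ ≤ Real.exp n := by
  have hx0 : 0 < ‖x‖ := norm_pos_iff.2 hx
  rw [Real.log_pow, abs_le, le_div_iff₀ hn, div_le_iff₀ hn] at h
  push_cast at h
  rw [← Real.le_log_iff_exp_le hx0, ← Real.log_le_iff_le_exp hx0]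
  constructor <;> linarith [h.1, h.2]

lemma isTest_groundCutoff {n ε : ℝ} (hn : 0 < n) (hε : 0 < ε) :
    IsTest N k ((domain N k).indicator fun x =>
      alpha N k lam x * groundCutoff n ε (alpha N k lam x) x) := by
  refine isTest_indicator ?_ (isCompact_cutoffSet (lam := lam) n ε) (cutoffSet_subset_domain hε) ?_
  · exact contDiffOn_alpha.mul ((contDiffOn_radialCutoff n).mul (contDiffOn_const.sub
      (contDiff_cutoff.comp_contDiffOn (contDiffOn_alpha.div_const ε))))
  · intro x hx hK
    by_contra h
    apply hK
    have h1 : radialCutoff n x ≠ 0 := by rintro h1; simp [groundCutoff, h1] at h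
    have h2 : cutoff (alpha N k lam x / ε) ≠ 1 := by rintro h1; simp [groundCutoff, h1] at h
    have h3 : |Real.log (‖x‖ ^ 2) / n| ≤ 2 := by
      by_contra! h4
      exact h1 (cutoff_eq_zero h4.le)
    have h4 := abs_log_norm_sq_le_of_radialCutoff hn hx.2 h3
    refine ⟨⟨h4.1, ?_⟩, mem_closedBall_zero_iff.2 h4.2,
      mem_iInter₂.2 fun i hi => (hx.1 i (mem_cornerIdx.1 hi)).le⟩
    by_contra h5
    have h5 : alpha N k lam x < ε := not_le.1 h5
    refine h2 (cutoff_eq_one ?_)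
    have ha := alpha_pos (lam := lam) hx
    rw [abs_of_pos (by positivity), div_le_one hε]
    exact h5.le

/-- The ground state and its gradient are bounded on annuli. -/
lemma exists_bound_annulus (hk : k ≤ N) {n : ℝ} (hn : 0 < n) :
    ∃ M, 0 ≤ M ∧ ∀ x ∈ domain N k,
    Real.exp (-n) ≤ ‖x‖ → ‖x‖ ≤ Real.exp n → alpha N k lam x ≤ M ∧
      alpha N k lam x * ‖x‖⁻¹ ≤ M ∧ alpha N k lam x * ‖oscField N k lam x‖ ≤ M := by
  set d := mExp N k lam - ((N : ℝ) - 2) / 2 with hd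
  set F : ℝ → ℝ := fun r => Real.exp (-r ^ 2 / 8) * r ^ d * (1 + r⁻¹ +
    r⁻¹ * (|d - k| + k + r ^ 2)) with hF
  have hFc : ContinuousOn F (Icc (Real.exp (-n)) (Real.exp n)) := by
    have h0 : ∀ r ∈ Icc (Real.exp (-n)) (Real.exp n), r ≠ 0 := fun r hr =>
      ((Real.exp_pos _).trans_le hr.1).ne'
    have h1 : ContinuousOn (fun r : ℝ => r⁻¹) (Icc (Real.exp (-n)) (Real.exp n)) :=
      continuousOn_id.inv₀ h0
    have h2 : ContinuousOn (fun r : ℝ => r ^ d) (Icc (Real.exp (-n)) (Real.exp n)) :=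
      continuousOn_id.rpow_const fun r hr => Or.inl (h0 r hr)
    exact ((by fun_prop : ContinuousOn (fun r : ℝ => Real.exp (-r ^ 2 / 8)) _).mul h2).mul
      ((continuousOn_const.add h1).add (h1.mul (by fun_prop)))
  obtain ⟨M, hM⟩ := isCompact_Icc.exists_bound_of_continuousOn hFc
  refine ⟨M, (norm_nonneg _).trans (hM 1
    ⟨Real.exp_le_one_iff.2 (by linarith), Real.one_le_exp hn.le⟩), fun x hx h1 h2 => ?_⟩
  have hx0 : 0 < ‖x‖ := norm_pos_iff.2 hx.2
  have h3 := (le_abs_self _).trans (hM ‖x‖ ⟨h1, h2⟩)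
  set B := Real.exp (-‖x‖ ^ 2 / 8) * ‖x‖ ^ d with hB
  have hB0 : 0 ≤ B := by positivity
  have h4 : F ‖x‖ = B + B * ‖x‖⁻¹ + B * ‖x‖⁻¹ * (|d - k| + k + ‖x‖ ^ 2) := by
    simp only [hF, ← hB]; ring
  have h5 : 0 ≤ B * ‖x‖⁻¹ := by positivity
  have h6 : 0 ≤ B * ‖x‖⁻¹ * (|d - k| + k + ‖x‖ ^ 2) := by positivity
  have h7 := alpha_le (lam := lam) hk hx
  have h8 := alpha_mul_norm_oscField_le (lam := lam) hk hx
  rw [← hd, ← hB] at h7 h8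
  have h9 : alpha N k lam x * ‖x‖⁻¹ ≤ B * ‖x‖⁻¹ :=
    mul_le_mul_of_nonneg_right h7 (by positivity)
  refine ⟨?_, ?_, ?_⟩ <;> linarith

end Cutoff

/-! ### The ground state lies in the kernel. -/

section GroundStateInDomain

variable {N k : ℕ} {lam : ℝ}

lemma measurable_radialCutoff (n : ℝ) : Measurable (radialCutoff n : Euc N → ℝ) :=
  contDiff_cutoff.continuous.measurable.comp (by fun_prop)

lemma measurable_radialCutoffGrad (n : ℝ) : Measurable (radialCutoffGrad n : Euc N → Euc N) := by
  have h : Measurable fun x : Euc N => deriv cutoff (Real.log (‖x‖ ^ 2) / n) :=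
    (measurable_deriv _).comp (by fun_prop)
  unfold radialCutoffGrad
  fun_prop

lemma abs_radialCutoff_le (n : ℝ) (x : Euc N) : |radialCutoff n x| ≤ 1 := abs_cutoff_le _

lemma radialCutoff_ne_zero_annulus {n : ℝ} (hn : 0 < n) {x : Euc N} (hx : x ≠ 0)
    (h : radialCutoff n x ≠ 0) : Real.exp (-n) ≤ ‖x‖ ∧ ‖x‖ ≤ Real.exp n := by
  refine abs_log_norm_sq_le_of_radialCutoff hn hx ?_
  by_contra! h4
  exact h (cutoff_eq_zero h4.le)

lemma radialCutoffGrad_ne_zero_annulus {n : ℝ} (hn : 0 < n) {x : Euc N} (hx : x ≠ 0)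
    (h : radialCutoffGrad n x ≠ 0) : Real.exp (-n) ≤ ‖x‖ ∧ ‖x‖ ≤ Real.exp n := by
  refine abs_log_norm_sq_le_of_radialCutoff hn hx ?_
  by_contra! h4
  exact h (by rw [radialCutoffGrad, deriv_cutoff_eq_zero h4]; simp)

lemma norm_radialCutoffGrad_le {C : ℝ} (hC : ∀ t, |deriv cutoff t| ≤ C) {n : ℝ} (hn : 0 < n)
    (x : Euc N) : ‖radialCutoffGrad n x‖ ≤ C * (2 / n) * ‖x‖⁻¹ := by
  rcases eq_or_ne x 0 with rfl | hx
  · simp [radialCutoffGrad]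
  have hx0 : 0 < ‖x‖ := norm_pos_iff.2 hx
  rw [radialCutoffGrad, norm_smul, norm_smul, norm_mul, Real.norm_of_nonneg
    (show (0 : ℝ) ≤ 2 / n by positivity), norm_inv, norm_pow, norm_norm]
  have h1 : (‖x‖ ^ 2)⁻¹ * ‖x‖ = ‖x‖⁻¹ := by field_simp
  rw [h1]
  gcongr
  exact hC _

lemma memLp_const_indicator_closedBall (M r : ℝ) :
    MemLp ((Metric.closedBall (0 : Euc N) r).indicator fun _ => M) 2 (cornerMeasure N k) :=
  (memLp_indicator_const (μ := volume) 2 Metric.isClosed_closedBall.measurableSet M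
    (Or.inr (isCompact_closedBall (0 : Euc N) r).measure_lt_top.ne)).restrict _

lemma memLp_alpha_mul_radialCutoff (hN : 2 ≤ N) (hk : k ≤ N) (n : ℝ) :
    MemLp (fun x => alpha N k lam x * radialCutoff n x) 2 (cornerMeasure N k) := by
  refine (memLp_alpha (lam := lam) hN hk).mono
    (measurable_alpha.mul (measurable_radialCutoff n)).aestronglyMeasurable
    (Eventually.of_forall fun x => ?_)
  rw [norm_mul]
  exact mul_le_of_le_one_right (norm_nonneg _) (abs_radialCutoff_le n x)

lemma memLp_alpha_smul_radialCutoffGrad (hN : 2 ≤ N) (hk : k ≤ N) {n : ℝ} (hn : 0 < n) :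
    MemLp (fun x => alpha N k lam x • radialCutoffGrad n x) 2 (cornerMeasure N k) := by
  obtain ⟨C, hC0, hC⟩ := exists_bound_deriv_cutoff
  obtain ⟨M, hM0, hM⟩ := exists_bound_annulus (lam := lam) hk hn
  refine (memLp_const_indicator_closedBall (C * (2 / n) * M) (Real.exp n)).mono
    (measurable_alpha.smul (measurable_radialCutoffGrad n)).aestronglyMeasurable ?_
  filter_upwards [ae_mem_domain hN k] with x hx
  by_cases h : radialCutoffGrad n x = 0
  · rw [h, smul_zero, norm_zero]; exact norm_nonneg _
  · obtain ⟨h1, h2⟩ := radialCutoffGrad_ne_zero_annulus hn hx.2 h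
    rw [indicator_of_mem (mem_closedBall_zero_iff.2 h2), norm_smul,
      Real.norm_of_nonneg (alpha_pos hx).le]
    refine le_trans ?_ (le_abs_self _)
    have h3 := mul_le_mul_of_nonneg_left (norm_radialCutoffGrad_le hC hn x)
      (alpha_pos (lam := lam) hx).le
    have h4 := mul_le_mul_of_nonneg_left (hM x hx h1 h2).2.1
      (show 0 ≤ C * (2 / n) by positivity)
    linarith

/-- The radially truncated ground state lies in the closure of the graph. -/
lemma pair_radialCutoff_mem (hN : 2 ≤ N) (hk : k ≤ N) {n : ℝ} (hn : 0 < n) :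
    pair ((memLp_alpha_mul_radialCutoff (lam := lam) hN hk n).toLp _)
      ((memLp_alpha_smul_radialCutoffGrad (lam := lam) hN hk hn).toLp _) ∈
      (testGraph N k (oscField N k lam)).topologicalClosure := by
  obtain ⟨C, hC0, hC⟩ := exists_bound_deriv_cutoff
  obtain ⟨M, hM0, hM⟩ := exists_bound_annulus (lam := lam) hk hn
  have hV := continuousOn_oscField (N := N) (k := k) (lam := lam)
  set ε : ℕ → ℝ := fun j => 1 / ((j : ℝ) + 1) with hεdef
  have hε : ∀ j, 0 < ε j := fun j => by positivity
  have hε0 : Tendsto ε atTop (𝓝 0) := tendsto_one_div_add_atTop_nhds_zero_nat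
  have hT : ∀ j, IsTest N k _ := fun j => isTest_groundCutoff (lam := lam) hn (hε j)
  -- At a fixed point α/ε_j eventually exceeds 2, so pointwise convergence is eventual equality.
  have hfin : ∀ x ∈ domain N k, ∀ᶠ j in atTop, cutoff (alpha N k lam x / ε j) = 0 ∧
      deriv cutoff (alpha N k lam x / ε j) = 0 := by
    intro x hx
    have ha := alpha_pos (lam := lam) hx
    filter_upwards [hε0.eventually_lt_const (show 0 < alpha N k lam x / 2 by positivity)] with j hj
    have h1 : 2 < |alpha N k lam x / ε j| := by
      rw [abs_of_pos (div_pos ha (hε j)), lt_div_iff₀ (hε j)]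
      linarith
    exact ⟨cutoff_eq_zero h1.le, deriv_cutoff_eq_zero h1⟩
  rw [← SetLike.mem_coe, Submodule.topologicalClosure_coe]
  refine mem_closure_of_tendsto (b := (atTop : Filter ℕ))
    (f := fun j => pair (hT j).toL2 ((hT j).gradL2 hV)) (tendsto_pair_iff.2 ⟨?_, ?_⟩)
    (Eventually.of_forall fun j => (hT j).pair_mem hV)
  · refine toLp_tendsto_of_dominated _ _ ((memLp_alpha (lam := lam) hN hk).norm) (fun j => ?_) ?_
    · filter_upwards [ae_mem_domain hN k] with x hx
      rw [indicator_of_mem hx, ← mul_sub, norm_mul]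
      refine mul_le_of_le_one_right (norm_nonneg _) ?_
      have h1 : groundCutoff n (ε j) (alpha N k lam x) x - radialCutoff n x =
          -(radialCutoff n x * cutoff (alpha N k lam x / ε j)) := by
        rw [groundCutoff]; ring
      rw [h1, norm_neg, norm_mul]
      exact mul_le_one₀ (abs_radialCutoff_le n x) (norm_nonneg _) (abs_cutoff_le _)
    · filter_upwards [ae_mem_domain hN k] with x hx
      refine tendsto_const_nhds.congr' ?_
      filter_upwards [hfin x hx] with j hj
      rw [indicator_of_mem hx, groundCutoff, hj.1, sub_zero, mul_one]
  · have hgrad : ∀ j, ∀ x ∈ domain N k, gradOp (oscField N k lam) ((domain N k).indicator fun x =>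
        alpha N k lam x * groundCutoff n (ε j) (alpha N k lam x) x) x =
        alpha N k lam x • ((1 - cutoff (alpha N k lam x / ε j)) • radialCutoffGrad n x -
        (radialCutoff n x * (deriv cutoff (alpha N k lam x / ε j) * (alpha N k lam x / ε j))) •
          oscField N k lam x) := by
      intro j x hx
      refine gradOp_oscField hx (hasGradientAt_groundCutoff n (ε j) hx) ?_
      filter_upwards [(isOpen_domain N k).mem_nhds hx] with y hy using indicator_of_mem hy _
    -- The two constants bound the two parts of the gradient error, α|∇(radial cutoff)| and 2C·α|∇
    -- log α|, on the annulus; neither depends on j.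
    refine toLp_tendsto_of_dominated (g := (Metric.closedBall (0 : Euc N) (Real.exp n)).indicator
      fun _ => C * (2 / n) * M + 2 * C * M) _ _ (memLp_const_indicator_closedBall _ _)
      (fun j => ?_) ?_
    · filter_upwards [ae_mem_domain hN k] with x hx
      have ha := alpha_pos (lam := lam) hx
      rw [hgrad j x hx, ← smul_sub]
      set s := alpha N k lam x / ε j with hs
      have e1 : (1 - cutoff s) • radialCutoffGrad n x -
          (radialCutoff n x * (deriv cutoff s * s)) • oscField N k lam x - radialCutoffGrad n x =
          -(cutoff s • radialCutoffGrad n x +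
          (radialCutoff n x * (deriv cutoff s * s)) • oscField N k lam x) := by module
      rw [e1, smul_neg, norm_neg, smul_add]
      by_cases hann : Real.exp (-n) ≤ ‖x‖ ∧ ‖x‖ ≤ Real.exp n
      · rw [indicator_of_mem (mem_closedBall_zero_iff.2 hann.2)]
        obtain ⟨-, h2, h3⟩ := hM x hx hann.1 hann.2
        refine (norm_add_le _ _).trans (add_le_add ?_ ?_)
        · rw [norm_smul, norm_smul, Real.norm_of_nonneg ha.le]
          have h4 : ‖cutoff s‖ * ‖radialCutoffGrad n x‖ ≤ 1 * (C * (2 / n) * ‖x‖⁻¹) :=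
            mul_le_mul (abs_cutoff_le _) (norm_radialCutoffGrad_le hC hn x) (norm_nonneg _)
              zero_le_one
          have h5 := mul_le_mul_of_nonneg_left h4 ha.le
          have h6 := mul_le_mul_of_nonneg_left h2 (show 0 ≤ C * (2 / n) by positivity)
          linarith
        · rw [norm_smul, norm_smul, Real.norm_of_nonneg ha.le, mul_left_comm]
          have h7 : ‖deriv cutoff s * s‖ ≤ 2 * C := by
            by_cases hs2 : 2 < |s|
            · rw [deriv_cutoff_eq_zero hs2, zero_mul, norm_zero]; positivity
            · rw [norm_mul, mul_comm]
              exact mul_le_mul (not_lt.1 hs2) (hC s) (norm_nonneg _) zero_le_two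
          have h8 : ‖radialCutoff n x * (deriv cutoff s * s)‖ ≤ 2 * C := by
            rw [norm_mul]
            exact (mul_le_of_le_one_left (norm_nonneg _) (abs_radialCutoff_le n x)).trans h7
          exact mul_le_mul h8 h3 (by positivity) (by positivity)
      · have h1 : radialCutoffGrad n x = 0 := by
          by_contra h; exact hann (radialCutoffGrad_ne_zero_annulus hn hx.2 h)
        have h2 : radialCutoff n x = 0 := by
          by_contra h; exact hann (radialCutoff_ne_zero_annulus hn hx.2 h)
        rw [h1, h2, zero_mul, zero_smul, smul_zero, smul_zero, add_zero, norm_zero]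
        refine indicator_nonneg (fun y _ => ?_) x
        positivity
    · filter_upwards [ae_mem_domain hN k] with x hx
      refine tendsto_const_nhds.congr' ?_
      filter_upwards [hfin x hx] with j hj
      rw [hgrad j x hx, hj.1, hj.2]
      simp

/-- With `alpha_sq_le` this gives α² ≤ D|x|^{2-N}, including the critical case m = 0. -/
lemma exists_bound_rpow_mul_exp {m : ℝ} (hm : 0 ≤ m) :
    ∃ C, 0 ≤ C ∧ ∀ r : ℝ, 0 < r → r ^ (2 * m) * Real.exp (-r ^ 2 / 4) ≤ C := by
  obtain ⟨M, hM⟩ := exists_nat_ge m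
  refine ⟨1 + M.factorial * 4 ^ M, by positivity, fun r hr => ?_⟩
  rw [Real.rpow_mul hr.le, Real.rpow_two]
  have h1 : (r ^ 2) ^ m ≤ 1 + (r ^ 2) ^ M := by
    rcases le_total (r ^ 2) 1 with h | h
    · have := Real.rpow_le_one (sq_nonneg r) h hm
      have : 0 ≤ (r ^ 2) ^ M := by positivity
      linarith
    · have := Real.rpow_le_rpow_of_exponent_le h hM
      rw [Real.rpow_natCast] at this
      linarith
  have h2 := Real.pow_div_factorial_le_exp (x := r ^ 2 / 4) (by positivity) M
  rw [div_le_iff₀ (by positivity), div_pow, div_le_iff₀ (by positivity)] at h2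
  have h3 : Real.exp (r ^ 2 / 4) * Real.exp (-r ^ 2 / 4) = 1 := by
    rw [← Real.exp_add]; ring_nf; simp
  have h4 : Real.exp (-r ^ 2 / 4) ≤ 1 := Real.exp_le_one_iff.2 (by nlinarith [sq_nonneg r])
  have h5 := Real.exp_pos (-r ^ 2 / 4)
  calc (r ^ 2) ^ m * Real.exp (-r ^ 2 / 4)
      ≤ (1 + (r ^ 2) ^ M) * Real.exp (-r ^ 2 / 4) := mul_le_mul_of_nonneg_right h1 h5.le
    _ = Real.exp (-r ^ 2 / 4) + (r ^ 2) ^ M * Real.exp (-r ^ 2 / 4) := by ring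
    _ ≤ 1 + (Real.exp (r ^ 2 / 4) * M.factorial * 4 ^ M) * Real.exp (-r ^ 2 / 4) := by
        gcongr
    _ = 1 + M.factorial * 4 ^ M := by linear_combination (M.factorial * 4 ^ M : ℝ) * h3

/-- The scale invariant integral over an annulus. -/
lemma integral_annulus (hN : 2 ≤ N) {n : ℝ} (hn : 0 < n) :
    Integrable (fun x : Euc N => (Icc (Real.exp (-n)) (Real.exp n)).indicator
      (fun r : ℝ => (r ^ N)⁻¹) ‖x‖) ∧
    ∫ x : Euc N, (Icc (Real.exp (-n)) (Real.exp n)).indicator (fun r : ℝ => (r ^ N)⁻¹) ‖x‖ =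
      N * (volume.real (Metric.ball (0 : Euc N) 1)) * (2 * n) := by
  have : Nonempty (Fin N) := ⟨⟨0, by omega⟩⟩
  set I := Icc (Real.exp (-n)) (Real.exp n)
  have hI : I ⊆ Ioi 0 := fun r hr => (Real.exp_pos _).trans_le hr.1
  have e : ∀ r : ℝ, r ^ (N - 1) • I.indicator (fun r : ℝ => (r ^ N)⁻¹) r =
      I.indicator (fun r => r⁻¹) r := by
    intro r
    by_cases hr : r ∈ I
    · have h0 : r ≠ 0 := (hI hr).ne'
      rw [indicator_of_mem hr, indicator_of_mem hr, smul_eq_mul]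
      have : r ^ N = r ^ (N - 1) * r := by rw [← pow_succ, Nat.sub_add_cancel (by omega)]
      rw [this]
      field_simp
    · simp [indicator_of_notMem hr]
  have hle : Real.exp (-n) ≤ Real.exp n := Real.exp_le_exp.2 (by linarith)
  have hint : IntegrableOn (fun r : ℝ => r⁻¹) I :=
    (continuousOn_id.inv₀ fun r hr => (hI hr).ne').integrableOn_Icc
  constructor
  · refine (integrable_fun_norm_addHaar (volume : Measure (Euc N))
      (f := I.indicator fun r : ℝ => (r ^ N)⁻¹)).2 ?_
    simp only [finrank_euclideanSpace, Fintype.card_fin, e]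
    exact (hint.integrable_indicator measurableSet_Icc).integrableOn
  · rw [integral_fun_norm_addHaar]
    simp only [finrank_euclideanSpace, Fintype.card_fin, e]
    have h1 : ∫ r in Ioi (0 : ℝ), I.indicator (fun r => r⁻¹) r = 2 * n := by
      rw [setIntegral_indicator measurableSet_Icc, inter_eq_right.2 hI, integral_Icc_eq_integral_Ioc,
        ← intervalIntegral.integral_of_le hle,
        integral_inv_of_pos (Real.exp_pos _) (Real.exp_pos _), ← Real.exp_sub, Real.log_exp]
      ring
    rw [h1]
    simp [mul_assoc]

/-- The ground state belongs to the kernel. -/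
lemma pair_alpha_mem (hN : 2 ≤ N) (hk : k ≤ N) :
    pair ((memLp_alpha (lam := lam) hN hk).toLp _) (0 : VL2 N k) ∈
      (testGraph N k (oscField N k lam)).topologicalClosure := by
  obtain ⟨C, hC0, hC⟩ := exists_bound_deriv_cutoff
  obtain ⟨D, hD0, hD⟩ := exists_bound_rpow_mul_exp (m := mExp N k lam) (Real.sqrt_nonneg _)
  set B := N * (volume.real (Metric.ball (0 : Euc N) 1)) with hB
  have hpos : ∀ j : ℕ, (0 : ℝ) < j + 1 := fun j => by positivity
  refine (Submodule.isClosed_topologicalClosure _).mem_of_tendsto (b := (atTop : Filter ℕ))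
    (f := fun j : ℕ => pair
      ((memLp_alpha_mul_radialCutoff (lam := lam) hN hk ((j : ℝ) + 1)).toLp _)
      ((memLp_alpha_smul_radialCutoffGrad (lam := lam) hN hk (hpos j)).toLp _))
    (tendsto_pair_iff.2 ⟨?_, ?_⟩)
    (Eventually.of_forall fun j => pair_radialCutoff_mem hN hk (hpos j))
  · refine toLp_tendsto_of_dominated _ _ ((memLp_alpha (lam := lam) hN hk).norm.const_mul 2)
      (fun j => Eventually.of_forall fun x => ?_) ?_
    · rw [← mul_sub_one, norm_mul, mul_comm]
      refine mul_le_mul_of_nonneg_right ?_ (norm_nonneg _)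
      have := abs_le.1 (abs_radialCutoff_le ((j : ℝ) + 1) x)
      rw [Real.norm_eq_abs, abs_le]
      constructor <;> linarith [this.1, this.2]
    · filter_upwards [] with x
      refine tendsto_const_nhds.congr' ?_
      have h1 : Tendsto (fun j : ℕ => (j : ℝ)) atTop atTop := tendsto_natCast_atTop_atTop
      filter_upwards [h1.eventually_ge_atTop |Real.log (‖x‖ ^ 2)|] with j hj
      rw [radialCutoff, cutoff_eq_one, mul_one]
      rw [abs_div, abs_of_pos (hpos j), div_le_one (hpos j)]
      linarith
  · rw [tendsto_zero_iff_norm_tendsto_zero]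
    -- The logarithmic cutoff has gradient at most (2C/n)/|x| and α² ≤ D|x|^{2-N}, so the integrand
    -- is at most (4C²D/n²)|x|^{-N}. Over the annulus |x|^{-N} integrates to 2nB, and the total
    -- 8C²DB/n tends to 0. A cutoff of the origin at a single scale would give only a bounded
    -- quantity when m = 0.
    have hsq : ∀ j : ℕ, ‖(memLp_alpha_smul_radialCutoffGrad (lam := lam) hN hk (hpos j)).toLp _‖ ^ 2 ≤
        (8 * C ^ 2 * D * B) * (1 / ((j : ℝ) + 1)) := by
      intro j
      set n : ℝ := (j : ℝ) + 1 with hn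
      have hn0 : 0 < n := hpos j
      obtain ⟨i1, i2⟩ := integral_annulus (N := N) hN hn0
      rw [← real_inner_self_eq_norm_sq, L2.inner_def]
      have hnn : ∀ x : Euc N, 0 ≤ (Icc (Real.exp (-n)) (Real.exp n)).indicator
          (fun r : ℝ => (r ^ N)⁻¹) ‖x‖ := fun x =>
        indicator_nonneg (fun r hr => by
          have : 0 < r := (Real.exp_pos _).trans_le hr.1
          positivity) _
      calc _ ≤ ∫ x, (4 * C ^ 2 * D / n ^ 2) * (Icc (Real.exp (-n)) (Real.exp n)).indicator
            (fun r : ℝ => (r ^ N)⁻¹) ‖x‖ ∂(cornerMeasure N k) := by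
            refine integral_mono_ae (L2.integrable_inner _ _) (i1.restrict.const_mul _) ?_
            filter_upwards [ae_mem_domain hN k, MemLp.coeFn_toLp
              (memLp_alpha_smul_radialCutoffGrad (lam := lam) hN hk hn0)] with x hx hxe
            rw [hxe, real_inner_self_eq_norm_sq, norm_smul, mul_pow, Real.norm_eq_abs, sq_abs]
            by_cases h : radialCutoffGrad n x = 0
            · rw [h, norm_zero]
              have := hnn x
              simp only [ne_eq, OfNat.ofNat_ne_zero, not_false_eq_true, zero_pow, mul_zero]
              positivity
            · have hx0 : 0 < ‖x‖ := norm_pos_iff.2 hx.2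
              rw [indicator_of_mem (mem_Icc.2 (radialCutoffGrad_ne_zero_annulus hn0 hx.2 h))]
              have h1 := alpha_sq_le (lam := lam) hk hx
              have h2 := pow_le_pow_left₀ (norm_nonneg _) (norm_radialCutoffGrad_le hC hn0 x) 2
              have h3 := hD ‖x‖ hx0
              have h4 : Real.exp (-‖x‖ ^ 2 / 4) *
                  ‖x‖ ^ (2 * (mExp N k lam - ((N : ℝ) - 2) / 2)) ≤
                  D * ((‖x‖ ^ N)⁻¹ * ‖x‖ ^ 2) := by
                have e1 : 2 * (mExp N k lam - ((N : ℝ) - 2) / 2) =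
                    2 * mExp N k lam + ((2 : ℕ) : ℝ) - (N : ℕ) := by push_cast; ring
                rw [e1, Real.rpow_sub_natCast hx0.ne', Real.rpow_add_natCast hx0.ne']
                have := mul_le_mul_of_nonneg_right h3
                  (show 0 ≤ (‖x‖ ^ N)⁻¹ * ‖x‖ ^ 2 by positivity)
                refine le_trans (le_of_eq ?_) this
                field_simp
              calc _ ≤ (D * ((‖x‖ ^ N)⁻¹ * ‖x‖ ^ 2)) * (C * (2 / n) * ‖x‖⁻¹) ^ 2 :=
                    mul_le_mul (h1.trans h4) h2 (sq_nonneg _) (by positivity)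
                _ = _ := by field_simp; ring
        _ ≤ ∫ x, (4 * C ^ 2 * D / n ^ 2) * (Icc (Real.exp (-n)) (Real.exp n)).indicator
            (fun r : ℝ => (r ^ N)⁻¹) ‖x‖ := by
            refine setIntegral_le_integral (i1.const_mul _) (Eventually.of_forall fun x => ?_)
            have := hnn x
            simp only [Pi.zero_apply]
            positivity
        _ = _ := by
            rw [integral_const_mul, i2]
            field_simp
            ring
    have hlim : Tendsto (fun j : ℕ => Real.sqrt ((8 * C ^ 2 * D * B) * (1 / ((j : ℝ) + 1)))) atTop
        (𝓝 0) := by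
      have h1 := (tendsto_one_div_add_atTop_nhds_zero_nat (𝕜 := ℝ)).const_mul (8 * C ^ 2 * D * B)
      have h2 := (Real.continuous_sqrt.tendsto _).comp h1
      simpa [Function.comp_def] using h2
    refine squeeze_zero (fun _ => norm_nonneg _) (fun j => ?_) hlim
    exact Real.le_sqrt_of_sq_le (hsq j)

end GroundStateInDomain

/-! ### Limits of functions with vanishing gradient are constant. -/

section Translation

variable {N : ℕ}

lemma lintegral_ball_translate_le {F : Euc N → ℝ≥0∞} (x₀ : Euc N) {r : ℝ} {y : Euc N}
    (hy : ‖y‖ ≤ r) :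
    ∫⁻ x in Metric.ball x₀ r, F (x + y) ≤ ∫⁻ x in Metric.ball x₀ (2 * r), F x := by
  rw [← lintegral_indicator Metric.isOpen_ball.measurableSet,
    ← lintegral_indicator Metric.isOpen_ball.measurableSet,
    ← lintegral_add_right_eq_self (fun x => (Metric.ball x₀ (2 * r)).indicator F x) y]
  refine lintegral_mono fun x => ?_
  by_cases hx : x ∈ Metric.ball x₀ r
  · have hx2 : x + y ∈ Metric.ball x₀ (2 * r) := by
      rw [Metric.mem_ball, dist_eq_norm] at hx ⊢
      have h6 : x + y - x₀ = (x - x₀) + y := by abel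
      rw [h6]
      linarith [norm_add_le (x - x₀) y]
    rw [indicator_of_mem hx, indicator_of_mem hx2]
  · rw [indicator_of_notMem hx]; exact bot_le

/-- The `L¹` modulus of continuity is controlled by the gradient. -/
lemma lintegral_translate_sub_le {f : Euc N → ℝ} (hf : ContDiff ℝ ∞ f) (x₀ : Euc N) {r : ℝ}
    {y : Euc N} (hy : ‖y‖ ≤ r) :
    ∫⁻ x in Metric.ball x₀ r, ‖f (x + y) - f x‖ₑ ≤
      ‖y‖ₑ * ∫⁻ x in Metric.ball x₀ (2 * r), ‖gradient f x‖ₑ := by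
  have hgc : Continuous (gradient f) := continuous_gradient hf
  have h1 : ∀ x, ‖f (x + y) - f x‖ₑ ≤ ∫⁻ t in Ioc (0 : ℝ) 1, ‖y‖ₑ * ‖gradient f (x + t • y)‖ₑ := by
    intro x
    have hd : ∀ t ∈ uIcc (0 : ℝ) 1, HasDerivAt (fun t : ℝ => f (x + t • y))
        (inner ℝ (gradient f (x + t • y)) y) t := by
      intro t _
      have h2 : HasDerivAt (fun t : ℝ => x + t • y) y t := by
        simpa using ((hasDerivAt_id t).smul_const y).const_add x
      have h3 := ((hf.differentiable (by simp)) (x + t • y)).hasFDerivAt.comp_hasDerivAt t h2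
      rw [inner_gradient_left]
      exact h3
    have hc : Continuous fun t : ℝ => inner ℝ (gradient f (x + t • y)) y := by fun_prop
    have h4 := intervalIntegral.integral_eq_sub_of_hasDerivAt hd (hc.intervalIntegrable _ _)
    rw [one_smul, zero_smul, add_zero] at h4
    rw [← h4, intervalIntegral.integral_of_le zero_le_one]
    refine (enorm_integral_le_lintegral_enorm _).trans (lintegral_mono fun t => ?_)
    rw [mul_comm, ← enorm_norm (gradient f _), ← enorm_norm y, ← enorm_mul]
    exact enorm_le_iff_norm_le.2 ((norm_inner_le_norm _ _).trans (le_abs_self _))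
  calc ∫⁻ x in Metric.ball x₀ r, ‖f (x + y) - f x‖ₑ
      ≤ ∫⁻ x in Metric.ball x₀ r, ∫⁻ t in Ioc (0 : ℝ) 1, ‖y‖ₑ * ‖gradient f (x + t • y)‖ₑ :=
        lintegral_mono h1
    _ = ∫⁻ t in Ioc (0 : ℝ) 1, ∫⁻ x in Metric.ball x₀ r, ‖y‖ₑ * ‖gradient f (x + t • y)‖ₑ := by
        refine lintegral_lintegral_swap (Measurable.aemeasurable ?_)
        have : Continuous fun p : Euc N × ℝ => gradient f (p.1 + p.2 • y) := by fun_prop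
        exact this.measurable.enorm.const_mul _
    _ ≤ ∫⁻ t in Ioc (0 : ℝ) 1, ‖y‖ₑ * ∫⁻ x in Metric.ball x₀ (2 * r), ‖gradient f x‖ₑ := by
        refine setLIntegral_mono measurable_const fun t ht => ?_
        rw [lintegral_const_mul' _ _ enorm_ne_top]
        refine mul_le_mul' le_rfl
          (lintegral_ball_translate_le (F := fun x => ‖gradient f x‖ₑ) x₀ ?_)
        rw [norm_smul, Real.norm_of_nonneg ht.1.le]
        nlinarith [norm_nonneg y, ht.2, ht.1]
    _ = _ := by simp

/-- `L¹` limits of smooth functions with vanishing gradients are constant on balls. -/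
lemma exists_const_of_tendsto_gradient {f : ℕ → Euc N → ℝ} (hf : ∀ n, ContDiff ℝ ∞ (f n))
    {g : Euc N → ℝ} (hg : Measurable g) {x₀ : Euc N} {r : ℝ} (hr : 0 < r)
    (h1 : Tendsto (fun n => ∫⁻ x in Metric.ball x₀ (2 * r), ‖f n x - g x‖ₑ) atTop (𝓝 0))
    (h2 : Tendsto (fun n => ∫⁻ x in Metric.ball x₀ (2 * r), ‖gradient (f n) x‖ₑ) atTop (𝓝 0)) :
    ∃ c, ∀ᵐ x ∂volume.restrict (Metric.ball x₀ (r / 2)), g x = c := by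
  -- In L¹ a small translation moves f_n by at most ‖y‖ times the norm of its gradient, so the limit
  -- g is invariant under each small translation.
  have hae : ∀ y, ‖y‖ ≤ r → ∀ᵐ x ∂volume.restrict (Metric.ball x₀ r), g (x + y) = g x := by
    intro y hy
    have hle : ∀ n, ∫⁻ x in Metric.ball x₀ r, ‖g (x + y) - g x‖ₑ ≤
        (∫⁻ x in Metric.ball x₀ (2 * r), ‖f n x - g x‖ₑ) +
        ‖y‖ₑ * (∫⁻ x in Metric.ball x₀ (2 * r), ‖gradient (f n) x‖ₑ) +
        ∫⁻ x in Metric.ball x₀ (2 * r), ‖f n x - g x‖ₑ := by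
      intro n
      have m1 : Measurable fun x => ‖f n (x + y) - g (x + y)‖ₑ :=
        (((hf n).continuous.measurable.sub hg).comp (measurable_add_const y)).enorm
      have m2 : Measurable fun x => ‖f n (x + y) - f n x‖ₑ := by
        have := (hf n).continuous
        fun_prop
      calc ∫⁻ x in Metric.ball x₀ r, ‖g (x + y) - g x‖ₑ
          ≤ ∫⁻ x in Metric.ball x₀ r, (‖f n (x + y) - g (x + y)‖ₑ + ‖f n (x + y) - f n x‖ₑ +
              ‖f n x - g x‖ₑ) := by
            refine lintegral_mono fun x => ?_
            have e : g (x + y) - g x = -(f n (x + y) - g (x + y)) + (f n (x + y) - f n x) +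
                (f n x - g x) := by ring
            rw [e]
            refine (enorm_add_le _ _).trans (add_le_add ((enorm_add_le _ _).trans ?_) le_rfl)
            rw [enorm_neg]
        _ = (∫⁻ x in Metric.ball x₀ r, ‖f n (x + y) - g (x + y)‖ₑ) +
              (∫⁻ x in Metric.ball x₀ r, ‖f n (x + y) - f n x‖ₑ) +
              ∫⁻ x in Metric.ball x₀ r, ‖f n x - g x‖ₑ := by
            have m12 : Measurable fun x =>
                ‖f n (x + y) - g (x + y)‖ₑ + ‖f n (x + y) - f n x‖ₑ := m1.add m2
            rw [lintegral_add_left m12, lintegral_add_left m1]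
        _ ≤ _ := by
            refine add_le_add (add_le_add ?_ (lintegral_translate_sub_le (hf n) x₀ hy)) ?_
            · exact lintegral_ball_translate_le (F := fun x => ‖f n x - g x‖ₑ) x₀ hy
            · exact lintegral_mono_set (Metric.ball_subset_ball (by linarith))
    have hlim : Tendsto (fun n => (∫⁻ x in Metric.ball x₀ (2 * r), ‖f n x - g x‖ₑ) +
        ‖y‖ₑ * (∫⁻ x in Metric.ball x₀ (2 * r), ‖gradient (f n) x‖ₑ) +
        ∫⁻ x in Metric.ball x₀ (2 * r), ‖f n x - g x‖ₑ) atTop (𝓝 0) := by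
      have := (h1.add (ENNReal.Tendsto.const_mul h2 (Or.inr (enorm_ne_top (x := y))))).add h1
      simpa using this
    have h0 : ∫⁻ x in Metric.ball x₀ r, ‖g (x + y) - g x‖ₑ = 0 :=
      le_antisymm (ge_of_tendsto' hlim hle) bot_le
    have m3 : Measurable fun x => ‖g (x + y) - g x‖ₑ :=
      ((hg.comp (measurable_add_const y)).sub hg).enorm
    rw [lintegral_eq_zero_iff m3] at h0
    filter_upwards [h0] with x hx
    simpa [sub_eq_zero] using hx
  have hms : MeasurableSet {p : Euc N × Euc N | g (p.1 + p.2) = g p.1} :=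
    measurableSet_eq_fun (by fun_prop) (by fun_prop)
  -- Fubini exchanges the null sets: some x₁ within r/2 of x₀ satisfies g(x₁ + y) = g(x₁) for almost
  -- every |y| < r, and the ball of radius r about x₁ contains the ball of radius r/2 about x₀.
  have hswap : ∀ᵐ x ∂volume.restrict (Metric.ball x₀ r),
      ∀ᵐ y ∂volume.restrict (Metric.ball (0 : Euc N) r), g (x + y) = g x := by
    rw [Measure.ae_ae_comm hms]
    filter_upwards [ae_restrict_mem Metric.isOpen_ball.measurableSet] with y hy
    exact hae y (mem_ball_zero_iff.1 hy).le
  have hswap' : ∀ᵐ x ∂volume.restrict (Metric.ball x₀ (r / 2)),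
      ∀ᵐ y ∂volume.restrict (Metric.ball (0 : Euc N) r), g (x + y) = g x :=
    ae_restrict_of_ae_restrict_of_subset (Metric.ball_subset_ball (by linarith)) hswap
  have hne : (volume.restrict (Metric.ball x₀ (r / 2))) ≠ 0 := by
    rw [Ne, Measure.restrict_eq_zero]
    exact (Metric.measure_ball_pos volume x₀ (by linarith)).ne'
  have : NeBot (ae (volume.restrict (Metric.ball x₀ (r / 2)))) := ae_neBot.2 hne
  obtain ⟨x₁, hx₁, hx₁'⟩ := (hswap'.and (ae_restrict_mem Metric.isOpen_ball.measurableSet)).exists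
  refine ⟨g x₁, ?_⟩
  rw [ae_restrict_iff' Metric.isOpen_ball.measurableSet] at hx₁ ⊢
  have h3 : ∀ᵐ z : Euc N, z - x₁ ∈ Metric.ball (0 : Euc N) r → g (x₁ + (z - x₁)) = g x₁ :=
    (measurePreserving_sub_right volume x₁).quasiMeasurePreserving.ae hx₁
  filter_upwards [h3] with z hz hzb
  rw [add_sub_cancel] at hz
  refine hz ?_
  rw [mem_ball_zero_iff]
  rw [Metric.mem_ball, dist_eq_norm] at hzb hx₁'
  have e : z - x₁ = (z - x₀) - (x₁ - x₀) := by abel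
  rw [e]
  linarith [norm_sub_le (z - x₀) (x₁ - x₀)]

/-- Locally constant functions on connected open sets, up to null sets. -/
lemma exists_const_of_locally_const {U : Set (Euc N)} (hU : IsOpen U) (hconn : IsPreconnected U)
    {g : Euc N → ℝ}
    (h : ∀ x ∈ U, ∃ r > 0, ∃ c, ∀ᵐ z ∂volume.restrict (Metric.ball x r), g z = c) :
    ∃ c, ∀ᵐ z, z ∈ U → g z = c := by
  choose! r hr c hc using h
  have hloc : ∀ x ∈ U, ∀ y ∈ U, y ∈ Metric.ball x (r x) → c y = c x := by
    intro x hx y hy hyx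
    have ho : IsOpen (Metric.ball x (r x) ∩ Metric.ball y (r y)) :=
      Metric.isOpen_ball.inter Metric.isOpen_ball
    have hpos := ho.measure_pos volume ⟨y, hyx, Metric.mem_ball_self (hr y hy)⟩
    have : NeBot (ae (volume.restrict (Metric.ball x (r x) ∩ Metric.ball y (r y)))) := by
      rw [ae_neBot, Ne, Measure.restrict_eq_zero]
      exact hpos.ne'
    obtain ⟨z, h1, h2⟩ := ((ae_restrict_of_ae_restrict_of_subset inter_subset_left (hc x hx)).and
      (ae_restrict_of_ae_restrict_of_subset inter_subset_right (hc y hy))).exists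
    rw [← h1, ← h2]
  have hlc : IsLocallyConstant fun x : U => c x := by
    rw [IsLocallyConstant.iff_eventually_eq]
    intro x
    have h1 : ∀ᶠ y : U in 𝓝 x, (y : Euc N) ∈ Metric.ball (x : Euc N) (r x) :=
      continuous_subtype_val.continuousAt.eventually
        (Metric.isOpen_ball.mem_nhds (Metric.mem_ball_self (hr x x.2)))
    filter_upwards [h1] with y hy using hloc x x.2 y y.2 hy
  rcases U.eq_empty_or_nonempty with rfl | ⟨x₀, hx₀⟩
  · exact ⟨0, by simp⟩
  have hconst : ∀ x ∈ U, c x = c x₀ := by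
    intro x hx
    have := isPreconnected_iff_preconnectedSpace.1 hconn
    exact hlc.apply_eq_of_preconnectedSpace ⟨x, hx⟩ ⟨x₀, hx₀⟩
  refine ⟨c x₀, ?_⟩
  have hnull : volume {z | z ∈ U ∧ g z ≠ c x₀} = 0 := by
    refine measure_null_of_locally_null _ fun x hx => ?_
    refine ⟨{z | z ∈ U ∧ g z ≠ c x₀} ∩ Metric.ball x (r x),
      inter_mem_nhdsWithin _ (Metric.ball_mem_nhds x (hr x hx.1)), ?_⟩
    have h1 := hc x hx.1
    rw [ae_restrict_iff' Metric.isOpen_ball.measurableSet, ae_iff] at h1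
    refine measure_mono_null ?_ h1
    rintro z ⟨⟨hzU, hz⟩, hzb⟩
    simp only [mem_ofPred_eq, Classical.not_imp]
    exact ⟨hzb, by rwa [hconst x hx.1]⟩
  rw [ae_iff]
  simpa only [Classical.not_imp] using hnull

end Translation

/-! ### The kernel is one-dimensional. -/

section Kernel

variable {N k : ℕ} {lam : ℝ}

/-- For k = 0 this is the punctured space, connected because N ≥ 2; for k ≥ 1 the corner is convex
and does not contain the origin. -/
lemma isPreconnected_domain (hN : 2 ≤ N) (k : ℕ) : IsPreconnected (domain N k) := by
  rcases Nat.eq_zero_or_pos k with rfl | hk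
  · have e : domain N 0 = {0}ᶜ := by
      ext x
      simp only [corner, Set.mem_sdiff, mem_ofPred_eq, mem_compl_iff, and_iff_right_iff_imp]
      intro _ i hi
      have := i.2
      omega
    rw [e]
    refine (isConnected_compl_singleton_of_one_lt_rank ?_ 0).isPreconnected
    rw [← Module.finrank_eq_rank, finrank_euclideanSpace, Fintype.card_fin]
    exact_mod_cast hN
  · have e : domain N k = corner N k := by
      refine sdiff_singleton_eq_self fun h => ?_
      have := h ⟨N - 1, by omega⟩ (by simp only; omega)
      simp at this
    rw [e]
    refine Convex.isPreconnected ?_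
    intro x hx y hy a b ha hb hab i hi
    have h1 := hx i hi
    have h2 := hy i hi
    change 0 < a * x i + b * y i
    rcases ha.eq_or_lt with rfl | ha
    · have : b = 1 := by linarith
      subst this; simpa using h2
    · have := mul_pos ha h1
      have := mul_nonneg hb h2.le
      linarith

/-- Hölder's inequality on a ball of finite measure passes to L¹, where the translation argument
takes place. -/
lemma tendsto_lintegral_ball {E : Type*} [NormedAddCommGroup E] {h : ℕ → Euc N → E}
    (hm : ∀ n, AEStronglyMeasurable (h n) (cornerMeasure N k))
    (hlim : Tendsto (fun n => eLpNorm (h n) 2 (cornerMeasure N k)) atTop (𝓝 0))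
    {x₀ : Euc N} {r : ℝ} (hB : Metric.ball x₀ r ⊆ corner N k) :
    Tendsto (fun n => ∫⁻ x in Metric.ball x₀ r, ‖h n x‖ₑ) atTop (𝓝 0) := by
  have hle : ∀ n, ∫⁻ x in Metric.ball x₀ r, ‖h n x‖ₑ ≤
      eLpNorm (h n) 2 (cornerMeasure N k) * volume (Metric.ball x₀ r) ^ (1 / 2 : ℝ) := by
    intro n
    have hm' : AEStronglyMeasurable (h n) (volume.restrict (Metric.ball x₀ r)) :=
      (hm n).mono_measure (Measure.restrict_mono hB le_rfl)
    have h1 := eLpNorm_le_eLpNorm_mul_rpow_measure_univ (p := 1) (q := 2) (by norm_num) hm'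
    rw [eLpNorm_one_eq_lintegral_enorm, Measure.restrict_apply_univ] at h1
    refine h1.trans (mul_le_mul' (eLpNorm_mono_measure _ (Measure.restrict_mono hB le_rfl)) ?_)
    norm_num
  have h2 : Tendsto (fun n => eLpNorm (h n) 2 (cornerMeasure N k) *
      volume (Metric.ball x₀ r) ^ (1 / 2 : ℝ)) atTop (𝓝 0) := by
    have := ENNReal.Tendsto.mul_const hlim (b := volume (Metric.ball x₀ r) ^ (1 / 2 : ℝ))
      (Or.inr (ENNReal.rpow_ne_top_of_nonneg (by norm_num) measure_ball_lt_top.ne))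
    simpa using this
  exact tendsto_of_tendsto_of_tendsto_of_le_of_le tendsto_const_nhds h2 (fun _ => bot_le) hle

/-- The kernel is spanned by the ground state. -/
lemma exists_eq_smul_of_pair_mem (hN : 2 ≤ N) (hk : k ≤ N) {v : L2 N k}
    (hv : pair v (0 : VL2 N k) ∈ (testGraph N k (oscField N k lam)).topologicalClosure) :
    ∃ c : ℝ, v = c • (memLp_alpha (lam := lam) hN hk).toLp _ := by
  have hV := continuousOn_oscField (N := N) (k := k) (lam := lam)
  rw [← SetLike.mem_coe, Submodule.topologicalClosure_coe] at hv
  obtain ⟨p, hp, hlim⟩ := mem_closure_iff_seq_limit.1 hv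
  choose φ hφ hpe using fun n => exists_of_mem_testGraph hV (hp n)
  have hlim' : Tendsto (fun n => pair (hφ n).toL2 ((hφ n).gradL2 hV)) atTop (𝓝 (pair v 0)) :=
    hlim.congr hpe
  rw [tendsto_pair_iff, tendsto_toL2_iff] at hlim'
  obtain ⟨l1, l2⟩ := hlim'
  have l2' : Tendsto (fun n => eLpNorm (gradOp (oscField N k lam) (φ n)) 2 (cornerMeasure N k))
      atTop (𝓝 0) := by
    rw [Lp.tendsto_Lp_iff_tendsto_eLpNorm'] at l2
    refine l2.congr fun n => eLpNorm_congr_ae ?_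
    filter_upwards [(hφ n).coeFn_gradL2 hV, Lp.coeFn_zero (Euc N) 2 (cornerMeasure N k)] with x h1 h2
    rw [Pi.sub_apply, h1, h2]; simp
  have hinv : ContDiffOn ℝ ∞ (fun x => (alpha N k lam x)⁻¹) (domain N k) :=
    contDiffOn_alpha.inv fun x hx => (alpha_pos hx).ne'
  -- Dividing by α turns the first order operator into a plain gradient: ∇φ_n - φ_n ∇ log α = α∇f_n.
  -- So g = v/α is a local limit of functions whose gradients tend to 0.
  set f : ℕ → Euc N → ℝ := fun n x => φ n x * (alpha N k lam x)⁻¹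
  have hf : ∀ n, IsTest N k (f n) := fun n => (hφ n).mul_smooth hinv
  set g : Euc N → ℝ := fun x => v x * (alpha N k lam x)⁻¹
  have hg : Measurable g := (Lp.stronglyMeasurable v).measurable.mul measurable_alpha.inv
  have hgrad : ∀ n, ∀ x ∈ domain N k,
      gradOp (oscField N k lam) (φ n) x = alpha N k lam x • gradient (f n) x := by
    intro n x hx
    refine gradOp_oscField hx ((hf n).differentiable x).hasGradientAt ?_
    filter_upwards [(isOpen_domain N k).mem_nhds hx] with y hy
    have := (alpha_pos (lam := lam) hy).ne'
    simp only [f]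
    field_simp
  obtain ⟨c, hc⟩ := exists_const_of_locally_const (g := g) (isOpen_domain N k)
    (isPreconnected_domain hN k) (by
      intro x₀ hx₀
      obtain ⟨R, hR, hball⟩ := Metric.isOpen_iff.1 (isOpen_domain N k) x₀ hx₀
      set r := R / 4
      have hr : 0 < r := by positivity
      have hsub : Metric.closedBall x₀ (2 * r) ⊆ domain N k :=
        (Metric.closedBall_subset_ball (by simp only [r]; linarith)).trans hball
      obtain ⟨z, hz, hmin⟩ := (isCompact_closedBall x₀ (2 * r)).exists_isMinOn
        ⟨x₀, Metric.mem_closedBall_self (by linarith)⟩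
        ((contDiffOn_alpha (lam := lam)).continuousOn.mono hsub)
      set δ := alpha N k lam z
      have hδ : 0 < δ := alpha_pos (hsub hz)
      have hsub' : Metric.ball x₀ (2 * r) ⊆ domain N k := Metric.ball_subset_closedBall.trans hsub
      -- On a compact ball inside the domain α ≥ δ > 0, so L¹ convergence survives division by α.
      have hscale : ∀ {E : Type} [NormedAddCommGroup E] [NormedSpace ℝ E] (a b : ℕ → Euc N → E),
          (∀ n, ∀ x ∈ domain N k, b n x = alpha N k lam x • a n x) →
          Tendsto (fun n => ∫⁻ x in Metric.ball x₀ (2 * r), ‖b n x‖ₑ) atTop (𝓝 0) →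
          Tendsto (fun n => ∫⁻ x in Metric.ball x₀ (2 * r), ‖a n x‖ₑ) atTop (𝓝 0) := by
        intro E _ _ a b hab hb
        have h1 := ENNReal.Tendsto.const_mul (a := ‖δ⁻¹‖ₑ) hb (Or.inr enorm_ne_top)
        rw [mul_zero] at h1
        refine tendsto_of_tendsto_of_tendsto_of_le_of_le tendsto_const_nhds h1 (fun _ => bot_le)
          fun n => ?_
        simp only
        rw [← lintegral_const_mul' _ _ enorm_ne_top]
        refine setLIntegral_mono' Metric.isOpen_ball.measurableSet fun x hx => ?_
        rw [← enorm_smul]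
        refine enorm_le_iff_norm_le.2 ?_
        have hmx : δ ≤ alpha N k lam x := hmin (Metric.ball_subset_closedBall hx)
        rw [hab n x (hsub' hx), smul_smul, norm_smul, Real.norm_of_nonneg
          (mul_pos (inv_pos.2 hδ) (alpha_pos (hsub' hx))).le]
        refine le_mul_of_one_le_left (norm_nonneg _) ?_
        rw [inv_mul_eq_div, one_le_div hδ]
        exact hmx
      have t1 : Tendsto (fun n => ∫⁻ x in Metric.ball x₀ (2 * r), ‖f n x - g x‖ₑ) atTop (𝓝 0) := by
        refine hscale (fun n x => f n x - g x) (fun n x => φ n x - v x) ?_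
          (tendsto_lintegral_ball (fun n => ((hφ n).continuous.aestronglyMeasurable).sub
            (Lp.aestronglyMeasurable v)) l1 (hsub'.trans sdiff_subset))
        intro n x hx
        have := (alpha_pos (lam := lam) hx).ne'
        simp only [f, g, smul_eq_mul]
        field_simp
      have t2 : Tendsto (fun n => ∫⁻ x in Metric.ball x₀ (2 * r), ‖gradient (f n) x‖ₑ)
          atTop (𝓝 0) := by
        refine hscale (fun n x => gradient (f n) x) (fun n => gradOp (oscField N k lam) (φ n)) hgrad
          (tendsto_lintegral_ball (fun n => ((hφ n).continuous_gradOp hV).aestronglyMeasurable) l2'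
            (hsub'.trans sdiff_subset))
      obtain ⟨c, hc⟩ := exists_const_of_tendsto_gradient (fun n => (hf n).smooth) hg hr t1 t2
      exact ⟨r / 2, by linarith, c, hc⟩)
  refine ⟨c, Lp.ext ?_⟩
  filter_upwards [ae_restrict_of_ae (s := corner N k) hc, ae_mem_domain hN k,
    Lp.coeFn_smul c ((memLp_alpha (lam := lam) hN hk).toLp _),
    MemLp.coeFn_toLp (memLp_alpha (lam := lam) hN hk)] with x h1 hx h2 h3
  have := (alpha_pos (lam := lam) hx).ne'
  rw [h2, Pi.smul_apply, h3, smul_eq_mul, ← h1 hx]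
  simp only [g]
  field_simp

end Kernel

open scoped Pointwise

/-! ### Dilations and Gaussian factors acting on test functions. -/

section GaussDil

variable {N k : ℕ} {lam : ℝ}

lemma smul_mem_corner {ρ : ℝ} (hρ : 0 < ρ) {x : Euc N} : ρ • x ∈ corner N k ↔ x ∈ corner N k := by
  simp [corner, hρ]

lemma smul_mem_domain {ρ : ℝ} (hρ : 0 < ρ) {x : Euc N} : ρ • x ∈ domain N k ↔ x ∈ domain N k := by
  simp only [Set.mem_sdiff, smul_mem_corner hρ, mem_singleton_iff, smul_eq_zero, hρ.ne', false_or]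

lemma smul_corner {ρ : ℝ} (hρ : 0 < ρ) : ρ • corner N k = corner N k := by
  ext x
  rw [mem_smul_set_iff_inv_smul_mem₀ hρ.ne', smul_mem_corner (inv_pos.2 hρ)]

/-- As the logarithmic gradient of a homogeneous function, V is homogeneous of degree -1. -/
lemma smul_hardyField_smul {ρ : ℝ} (hρ : 0 < ρ) (x : Euc N) :
    ρ • hardyField N k lam (ρ • x) = hardyField N k lam x := by
  ext j
  rw [PiLp.smul_apply, hardyField_apply, hardyField_apply, PiLp.smul_apply, norm_smul,
    Real.norm_of_nonneg hρ.le, smul_eq_mul, smul_eq_mul, mul_pow, mul_inv, mul_add, mul_ite,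
    mul_inv_cancel_left₀ hρ.ne', mul_zero]
  congr 1
  rcases eq_or_ne (‖x‖ ^ 2) 0 with h | h
  · simp [h]
  · field_simp

/-- Dilation followed by multiplication with a Gaussian. -/
def gaussDil (c b ρ : ℝ) (φ : Euc N → ℝ) (x : Euc N) : ℝ :=
  c * Real.exp (-(b * ‖x‖ ^ 2)) * φ (ρ • x)

lemma IsTest.comp_smul {φ : Euc N → ℝ} (h : IsTest N k φ) {ρ : ℝ} (hρ : 0 < ρ) :
    IsTest N k fun x => φ (ρ • x) := by
  refine ⟨h.smooth.comp (contDiff_const_smul ρ),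
    h.compact.comp_homeomorph (Homeomorph.smulOfNeZero ρ hρ.ne'), ?_⟩
  intro x hx
  have h1 := tsupport_comp_subset_preimage φ (f := fun x : Euc N => ρ • x) (by fun_prop) hx
  exact (smul_mem_domain hρ).1 (h.support h1)

lemma IsTest.gaussDil {φ : Euc N → ℝ} (h : IsTest N k φ) (c b : ℝ) {ρ : ℝ} (hρ : 0 < ρ) :
    IsTest N k (gaussDil c b ρ φ) := by
  have h1 : ContDiff ℝ ∞ fun x : Euc N => c * Real.exp (-(b * ‖x‖ ^ 2)) := by
    have := contDiff_norm_sq ℝ (E := Euc N) (n := ∞)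
    fun_prop
  have h2 := (h.comp_smul hρ).mul_smooth h1.contDiffOn
  convert h2 using 1
  ext x
  rw [HardyHeat.gaussDil, mul_comm]

/-- By the homogeneity of V, dilation commutes with φ ↦ ∇φ - φV up to the factor ρ. The Gaussian
adds a multiple of x, which is how V and V - x/4 become related. -/
lemma gradOp_gaussDil {φ : Euc N → ℝ} (h : Differentiable ℝ φ) (c b : ℝ) {ρ : ℝ} (hρ : 0 < ρ)
    (x : Euc N) : gradOp (hardyField N k lam) (gaussDil c b ρ φ) x =
      (c * Real.exp (-(b * ‖x‖ ^ 2))) •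
        (ρ • gradOp (hardyField N k lam) φ (ρ • x) - (2 * b * φ (ρ • x)) • x) := by
  have h1 : HasFDerivAt (fun x : Euc N => φ (ρ • x))
      ((fderiv ℝ φ (ρ • x)).comp (ρ • ContinuousLinearMap.id ℝ (Euc N))) x :=
    (h (ρ • x)).hasFDerivAt.comp x ((hasFDerivAt_id x).const_smul ρ)
  have h2 := (((hasStrictFDerivAt_norm_sq x).hasFDerivAt.const_mul b).neg.exp.const_mul c).mul h1
  have h3 : gradient (gaussDil c b ρ φ) x = (c * Real.exp (-(b * ‖x‖ ^ 2))) •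
      (ρ • gradient φ (ρ • x) - (2 * b * φ (ρ • x)) • x) := by
    refine ext_inner_right ℝ fun y => ?_
    rw [inner_gradient_left]
    rw [HasFDerivAt.fderiv (f := gaussDil c b ρ φ) h2]
    simp only [inner_smul_left, inner_sub_left, inner_gradient_left]
    simp
    ring
  rw [gradOp, h3, gradOp, gaussDil, ← smul_hardyField_smul hρ x]
  module

lemma oscField_eq (x : Euc N) (φ : Euc N → ℝ) : gradOp (oscField N k lam) φ x =
    gradOp (hardyField N k lam) φ x + (φ x / 4) • x := by
  simp only [gradOp, oscField]
  module

/-- Euler's operator, in terms of the first order operator of the Hardy form. -/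
lemma inner_self_gradOp (hk : k ≤ N) {φ : Euc N → ℝ} (h : IsTest N k φ) (x : Euc N) :
    inner ℝ x (gradOp (hardyField N k lam) φ x) =
      fderiv ℝ φ x x - (mExp N k lam - ((N : ℝ) - 2) / 2) * φ x := by
  by_cases hx : x ∈ domain N k
  · rw [gradOp, inner_sub_right, inner_smul_right, inner_self_hardyField hk hx,
      inner_gradient_right]
    simp
    ring
  · have h1 : x ∉ tsupport φ := fun h' => hx (h.support h')
    rw [gradOp_of_notMem_tsupport h1, image_eq_zero_of_notMem_tsupport h1,
      image_eq_zero_of_notMem_tsupport fun h' => h1 (tsupport_fderiv_subset ℝ h')]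
    simp

end GaussDil

/-! ### Dilations and bounded multipliers on L². -/

section Dilation

variable {N k : ℕ} {E F : Type*} [NormedAddCommGroup E] [NormedAddCommGroup F]

lemma map_smul_cornerMeasure {ρ : ℝ} (hρ : 0 < ρ) :
    Measure.map (fun x : Euc N => ρ • x) (cornerMeasure N k) =
      ENNReal.ofReal ((ρ ^ N)⁻¹) • cornerMeasure N k := by
  have h1 : (fun x : Euc N => ρ • x) ⁻¹' corner N k = corner N k := by
    ext x; exact smul_mem_corner hρ
  have h2 := Measure.restrict_map (μ := (volume : Measure (Euc N))) (measurable_const_smul ρ)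
    (measurableSet_corner N k)
  rw [h1] at h2
  have h3 := Measure.map_addHaar_smul (volume : Measure (Euc N)) hρ.ne'
  rw [finrank_euclideanSpace, Fintype.card_fin, abs_of_pos (by positivity)] at h3
  change Measure.map (ρ • ·) _ = _
  rw [← h2, h3, Measure.restrict_smul]

lemma quasiMeasurePreserving_smul {ρ : ℝ} (hρ : 0 < ρ) :
    Measure.QuasiMeasurePreserving (fun x : Euc N => ρ • x) (cornerMeasure N k)
      (cornerMeasure N k) := by
  refine ⟨measurable_const_smul ρ, ?_⟩
  rw [map_smul_cornerMeasure hρ]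
  exact Measure.smul_absolutelyContinuous

lemma eLpNorm_comp_smul {ρ : ℝ} (hρ : 0 < ρ) {f : Euc N → F}
    (hf : AEStronglyMeasurable f (cornerMeasure N k)) :
    eLpNorm (fun x => f (ρ • x)) 2 (cornerMeasure N k) =
      ENNReal.ofReal (ρ ^ (-(N : ℝ) / 2)) * eLpNorm f 2 (cornerMeasure N k) := by
  have h1 : AEStronglyMeasurable f (Measure.map (fun x : Euc N => ρ • x) (cornerMeasure N k)) := by
    rw [map_smul_cornerMeasure hρ]
    exact hf.smul_measure _
  have h2 := eLpNorm_map_measure (p := 2) h1 (measurable_const_smul ρ).aemeasurable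
  change eLpNorm (f ∘ fun x : Euc N => ρ • x) _ _ = _
  rw [← h2, map_smul_cornerMeasure hρ, eLpNorm_smul_measure_of_ne_top (by norm_num),
    smul_eq_mul, ENNReal.ofReal_rpow_of_pos (by positivity)]
  congr 2
  rw [← Real.rpow_natCast, ← Real.rpow_neg hρ.le, ← Real.rpow_mul hρ.le]
  congr 1
  norm_num
  ring

lemma memLp_comp_smul {ρ : ℝ} (hρ : 0 < ρ) {f : Euc N → F} (hf : MemLp f 2 (cornerMeasure N k)) :
    MemLp (fun x => f (ρ • x)) 2 (cornerMeasure N k) := by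
  refine ⟨hf.1.comp_quasiMeasurePreserving (quasiMeasurePreserving_smul hρ), ?_⟩
  rw [eLpNorm_comp_smul hρ hf.1]
  exact ENNReal.mul_lt_top ENNReal.ofReal_lt_top hf.2

variable [NormedSpace ℝ E] [NormedSpace ℝ F]

lemma integral_comp_smul {ρ : ℝ} (hρ : 0 < ρ) (f : Euc N → F) :
    ∫ x, f (ρ • x) ∂(cornerMeasure N k) = (ρ ^ N)⁻¹ • ∫ x, f x ∂(cornerMeasure N k) := by
  have h := Measure.setIntegral_comp_smul_of_pos (volume : Measure (Euc N)) f (corner N k) hρ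
  rw [finrank_euclideanSpace, Fintype.card_fin, smul_corner hρ] at h
  exact h

variable (k F) in
/-- Dilation on `L²`. -/
def dilation (ρ : ℝ) (hρ : 0 < ρ) :
    Lp F 2 (cornerMeasure N k) →L[ℝ] Lp F 2 (cornerMeasure N k) :=
  LinearMap.mkContinuous
    { toFun := fun f => (memLp_comp_smul hρ (Lp.memLp f)).toLp _
      map_add' := fun f g => by
        rw [← MemLp.toLp_add, MemLp.toLp_eq_toLp_iff]
        filter_upwards [(quasiMeasurePreserving_smul hρ).ae (Lp.coeFn_add f g)] with x hx using hx
      map_smul' := fun a f => by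
        rw [RingHom.id_apply, ← MemLp.toLp_const_smul, MemLp.toLp_eq_toLp_iff]
        filter_upwards [(quasiMeasurePreserving_smul hρ).ae (Lp.coeFn_smul a f)] with x hx using hx }
    (ρ ^ (-(N : ℝ) / 2)) fun f => by
      simp only [LinearMap.coe_mk, AddHom.coe_mk]
      rw [Lp.norm_toLp, eLpNorm_comp_smul hρ (Lp.aestronglyMeasurable f), ENNReal.toReal_mul,
        ENNReal.toReal_ofReal (by positivity), Lp.norm_def]

lemma coeFn_dilation {ρ : ℝ} (hρ : 0 < ρ) (f : Lp F 2 (cornerMeasure N k)) :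
    dilation k F ρ hρ f =ᵐ[cornerMeasure N k] fun x => f (ρ • x) :=
  MemLp.coeFn_toLp (memLp_comp_smul hρ (Lp.memLp f))

lemma norm_dilation {ρ : ℝ} (hρ : 0 < ρ) (f : Lp F 2 (cornerMeasure N k)) :
    ‖dilation k F ρ hρ f‖ = ρ ^ (-(N : ℝ) / 2) * ‖f‖ := by
  rw [dilation, LinearMap.mkContinuous_apply, LinearMap.coe_mk, AddHom.coe_mk,
    Lp.norm_toLp, eLpNorm_comp_smul hρ (Lp.aestronglyMeasurable f), ENNReal.toReal_mul,
        ENNReal.toReal_ofReal (by positivity), Lp.norm_def]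

section Multiplier

variable {X : Type*} [TopologicalSpace X] [MeasurableSpace X] [OpensMeasurableSpace X]
  [SecondCountableTopologyEither X (E →L[ℝ] F)]

lemma memLp_multiplier {μ : Measure X} (B : BoundedContinuousFunction X (E →L[ℝ] F))
    (f : Lp E 2 μ) : MemLp (fun x => B x (f x)) 2 μ :=
  (Lp.memLp f).of_le_mul (c := ‖B‖)
    ((ContinuousLinearMap.id ℝ (E →L[ℝ] F)).aestronglyMeasurable_comp₂
      B.continuous.aestronglyMeasurable (Lp.aestronglyMeasurable f))
    (ae_of_all _ fun x => (B x).le_of_opNorm_le (B.norm_coe_le_norm x) _)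

/-- Multiplication by a bounded continuous function, on `L²`. -/
def multiplier (μ : Measure X) (B : BoundedContinuousFunction X (E →L[ℝ] F)) :
    Lp E 2 μ →L[ℝ] Lp F 2 μ :=
  LinearMap.mkContinuous
    { toFun := fun f => (memLp_multiplier B f).toLp _
      map_add' := fun f g => by
        rw [← MemLp.toLp_add, MemLp.toLp_eq_toLp_iff]
        filter_upwards [Lp.coeFn_add f g] with x hx
        rw [hx, Pi.add_apply, Pi.add_apply, map_add]
      map_smul' := fun a f => by
        rw [RingHom.id_apply, ← MemLp.toLp_const_smul, MemLp.toLp_eq_toLp_iff]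
        filter_upwards [Lp.coeFn_smul a f] with x hx
        rw [hx, Pi.smul_apply, Pi.smul_apply, map_smul] }
    ‖B‖ fun f => by
      refine Lp.norm_le_mul_norm_of_ae_le_mul ?_
      simp only [LinearMap.coe_mk, AddHom.coe_mk]
      filter_upwards [MemLp.coeFn_toLp (memLp_multiplier B f)] with x hx
      rw [hx]
      exact (B x).le_of_opNorm_le (B.norm_coe_le_norm x) _

lemma coeFn_multiplier (μ : Measure X) (B : BoundedContinuousFunction X (E →L[ℝ] F))
    (f : Lp E 2 μ) : multiplier μ B f =ᵐ[μ] fun x => B x (f x) :=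
  MemLp.coeFn_toLp (memLp_multiplier B f)

lemma norm_multiplier_le (μ : Measure X) (B : BoundedContinuousFunction X (E →L[ℝ] F))
    (f : Lp E 2 μ) : ‖multiplier μ B f‖ ≤ ‖B‖ * ‖f‖ :=
  (multiplier μ B).le_of_opNorm_le (LinearMap.mkContinuous_norm_le _ (norm_nonneg B) _) f

end Multiplier

end Dilation

/-! ### The Gaussian multipliers. -/

section Gaussian

variable {N : ℕ}

/-- The multiplier `e^{-|y|²/8}`. -/
def gaussMul (N : ℕ) (E : Type*) [NormedAddCommGroup E] [NormedSpace ℝ E] :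
    BoundedContinuousFunction (Euc N) (E →L[ℝ] E) :=
  BoundedContinuousFunction.ofNormedAddCommGroup
    (fun y => Real.exp (-(1 / 8 * ‖y‖ ^ 2)) • ContinuousLinearMap.id ℝ E) (by fun_prop) 1
    fun y => by
      rw [norm_smul, Real.norm_of_nonneg (Real.exp_pos _).le]
      refine mul_le_one₀ (Real.exp_le_one_iff.2 (neg_nonpos.2 (by positivity))) (norm_nonneg _)
        ContinuousLinearMap.norm_id_le

/-- The multiplier `e^{-|y|²/8} y`, from functions to vector fields. -/
def gaussVec (N : ℕ) : BoundedContinuousFunction (Euc N) (ℝ →L[ℝ] Euc N) :=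
  BoundedContinuousFunction.ofNormedAddCommGroup
    (fun y => Real.exp (-(1 / 8 * ‖y‖ ^ 2)) • (ContinuousLinearMap.lsmul ℝ ℝ).flip y)
    -- The bound comes from 8e^{r²/8} ≥ 8 + r² ≥ r with r = ‖y‖.
    (by fun_prop) 8
    fun y => by
      have h : ‖(ContinuousLinearMap.lsmul ℝ ℝ).flip y‖ ≤ ‖y‖ :=
        ContinuousLinearMap.opNorm_le_bound _ (norm_nonneg _) fun t => by
          simp [norm_smul, mul_comm]
      rw [norm_smul, Real.norm_of_nonneg (Real.exp_pos _).le, Real.exp_neg,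
        inv_mul_le_iff₀ (Real.exp_pos _)]
      nlinarith [Real.add_one_le_exp (1 / 8 * ‖y‖ ^ 2), norm_nonneg y, sq_nonneg (‖y‖ - 1)]

lemma gaussMul_apply {E : Type*} [NormedAddCommGroup E] [NormedSpace ℝ E] (y : Euc N) (v : E) :
    gaussMul N E y v = Real.exp (-(1 / 8 * ‖y‖ ^ 2)) • v := rfl

lemma gaussVec_apply (y : Euc N) (t : ℝ) :
    gaussVec N y t = (Real.exp (-(1 / 8 * ‖y‖ ^ 2)) * t) • y := by
  rw [mul_smul]; rfl

lemma norm_gaussMul_le (N : ℕ) (E : Type*) [NormedAddCommGroup E] [NormedSpace ℝ E] :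
    ‖gaussMul N E‖ ≤ 1 :=
  BoundedContinuousFunction.norm_ofNormedAddCommGroup_le _ zero_le_one _

end Gaussian

/-! ### The similarity transform and its dual on test functions. -/

section Similarity

variable {N k : ℕ} {lam : ℝ}

/-- The amplitude of the similarity transform. -/
def simAmp (N k : ℕ) (lam s : ℝ) : ℝ := Real.exp (-(s * ((1 + mExp N k lam) / 2 + N / 4)))

/-- The similarity transform `v ↦ e^{-s(κ/2+N/4)} (e^{-|·|²/8} v)(e^{-s/2} ·)`. -/
def simil (N k : ℕ) (lam s : ℝ) : L2 N k →L[ℝ] L2 N k :=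
  simAmp N k lam s • (dilation k ℝ (Real.exp (-(s / 2))) (Real.exp_pos _)).comp
    (multiplier _ (gaussMul N ℝ))

/-- The first order part of the similarity transform. -/
def similGrad (N k : ℕ) (lam s : ℝ) (v : L2 N k) (q : VL2 N k) : VL2 N k :=
  (simAmp N k lam s * Real.exp (-(s / 2))) • dilation k (Euc N) (Real.exp (-(s / 2)))
    (Real.exp_pos _) (multiplier _ (gaussMul N (Euc N)) q -
      (1 / 2 : ℝ) • multiplier _ (gaussVec N) v)

lemma simAmp_pos (s : ℝ) : 0 < simAmp N k lam s := Real.exp_pos _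

/-- The dilation by e^{-s/2} multiplies norms by e^{sN/4}. This cancels the N/4 in the amplitude and
leaves the decay factor e^{-s(1+m)/2}. -/
lemma norm_simil (s : ℝ) (v : L2 N k) : ‖simil N k lam s v‖ =
    Real.exp (-(s * ((1 + mExp N k lam) / 2))) * ‖multiplier _ (gaussMul N ℝ) v‖ := by
  rw [simil, smul_apply, ContinuousLinearMap.comp_apply, norm_smul,
    norm_dilation, Real.norm_of_nonneg (simAmp_pos s).le, ← mul_assoc, simAmp, ← Real.exp_mul,
    ← Real.exp_add]
  congr 2
  ring

lemma coeFn_simil (s : ℝ) (v : L2 N k) : simil N k lam s v =ᵐ[cornerMeasure N k] fun x =>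
    simAmp N k lam s * (Real.exp (-(1 / 8 * ‖Real.exp (-(s / 2)) • x‖ ^ 2)) *
      v (Real.exp (-(s / 2)) • x)) := by
  filter_upwards [Lp.coeFn_smul (simAmp N k lam s) ((dilation k ℝ (Real.exp (-(s / 2)))
    (Real.exp_pos _)) (multiplier _ (gaussMul N ℝ) v)),
    coeFn_dilation (Real.exp_pos (-(s / 2))) (multiplier _ (gaussMul N ℝ) v),
    (quasiMeasurePreserving_smul (Real.exp_pos (-(s / 2)))).ae
      (coeFn_multiplier _ (gaussMul N ℝ) v)] with x h1 h2 h3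
  rw [simil, smul_apply, ContinuousLinearMap.comp_apply, h1, Pi.smul_apply, h2,
    h3, gaussMul_apply]
  rfl

lemma coeFn_similGrad (s : ℝ) (v : L2 N k) (q : VL2 N k) :
    similGrad N k lam s v q =ᵐ[cornerMeasure N k] fun x =>
      (simAmp N k lam s * Real.exp (-(s / 2)) *
        Real.exp (-(1 / 8 * ‖Real.exp (-(s / 2)) • x‖ ^ 2))) •
      (q (Real.exp (-(s / 2)) • x) -
        (1 / 2 * v (Real.exp (-(s / 2)) • x)) • Real.exp (-(s / 2)) • x) := by
  have hq := quasiMeasurePreserving_smul (N := N) (k := k) (Real.exp_pos (-(s / 2)))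
  set g := multiplier _ (gaussMul N (Euc N)) q - (1 / 2 : ℝ) • multiplier _ (gaussVec N) v
  filter_upwards [Lp.coeFn_smul (simAmp N k lam s * Real.exp (-(s / 2)))
    (dilation k (Euc N) (Real.exp (-(s / 2))) (Real.exp_pos _) g),
    coeFn_dilation (Real.exp_pos (-(s / 2))) g,
    hq.ae (coeFn_multiplier _ (gaussMul N (Euc N)) q), hq.ae (coeFn_multiplier _ (gaussVec N) v),
    hq.ae (Lp.coeFn_sub (multiplier _ (gaussMul N (Euc N)) q)
      ((1 / 2 : ℝ) • multiplier _ (gaussVec N) v)),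
    hq.ae (Lp.coeFn_smul (1 / 2 : ℝ) (multiplier _ (gaussVec N) v))] with x h1 h2 h3 h4 h5 h6
  rw [similGrad, h1, Pi.smul_apply, h2, h5, Pi.sub_apply, h6, Pi.smul_apply, h3, h4,
    gaussMul_apply, gaussVec_apply]
  module

lemma norm_similGrad_le (s : ℝ) (v : L2 N k) (q : VL2 N k) : ‖similGrad N k lam s v q‖ ≤
    simAmp N k lam s * Real.exp (-(s / 2)) * (Real.exp (-(s / 2)) ^ (-(N : ℝ) / 2) *
      (‖q‖ + 1 / 2 * (‖gaussVec N‖ * ‖v‖))) := by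
  have h0 := (simAmp_pos (N := N) (k := k) (lam := lam) s).le
  rw [similGrad, norm_smul, norm_dilation, Real.norm_of_nonneg (by positivity)]
  gcongr
  refine (norm_sub_le _ _).trans (add_le_add ?_ ?_)
  · refine (norm_multiplier_le _ _ _).trans ?_
    exact mul_le_of_le_one_left (norm_nonneg _) (norm_gaussMul_le _ _)
  · rw [norm_smul, Real.norm_of_nonneg (by norm_num)]
    gcongr
    exact norm_multiplier_le _ _ _

/-- The coefficient 1/2 in `similGrad` is a sum of two quarters: one from V versus V - y/4, the
other from differentiating e^{-|y|²/8}. -/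
lemma pair_simil_mem_of_test (s : ℝ) {φ : Euc N → ℝ} (h : IsTest N k φ) :
    pair (simil N k lam s h.toL2)
      (similGrad N k lam s h.toL2 (h.gradL2 (continuousOn_oscField (lam := lam)))) ∈
      testGraph N k (hardyField N k lam) := by
  set ρ := Real.exp (-(s / 2))
  have hρ : 0 < ρ := Real.exp_pos _
  have hq := quasiMeasurePreserving_smul (N := N) (k := k) hρ
  refine ⟨gaussDil (simAmp N k lam s) (ρ ^ 2 / 8) ρ φ, h.gaussDil _ _ hρ, ?_, ?_⟩
  · filter_upwards [coeFn_simil (lam := lam) s h.toL2, hq.ae h.coeFn_toL2] with x h1 h2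
    change simil N k lam s h.toL2 x = _
    rw [h1, h2, gaussDil, norm_smul, Real.norm_of_nonneg hρ.le]
    ring_nf
  · filter_upwards [coeFn_similGrad (lam := lam) s h.toL2 (h.gradL2 continuousOn_oscField),
      hq.ae h.coeFn_toL2, hq.ae (h.coeFn_gradL2 (continuousOn_oscField (lam := lam)))]
      with x h1 h2 h3
    change similGrad N k lam s _ _ x = _
    rw [h1, h2, h3, gradOp_gaussDil h.differentiable _ _ hρ, oscField_eq, norm_smul,
      Real.norm_of_nonneg hρ.le]
    have e : 1 / 8 * (ρ * ‖x‖) ^ 2 = ρ ^ 2 / 8 * ‖x‖ ^ 2 := by ring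
    rw [e]
    module

lemma pair_simil_mem (s : ℝ) {v : L2 N k} {q : VL2 N k}
    (h : pair v q ∈ (testGraph N k (oscField N k lam)).topologicalClosure) :
    pair (simil N k lam s v) (similGrad N k lam s v q) ∈
      (testGraph N k (hardyField N k lam)).topologicalClosure := by
  rw [← SetLike.mem_coe, Submodule.topologicalClosure_coe] at h ⊢
  obtain ⟨p, hp, hlim⟩ := mem_closure_iff_seq_limit.1 h
  refine mem_closure_iff_seq_limit.2
    ⟨fun n => pair (simil N k lam s (p n).fst) (similGrad N k lam s (p n).fst (p n).snd), ?_, ?_⟩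
  · intro n
    obtain ⟨φ, hφ, he⟩ := exists_of_mem_testGraph continuousOn_oscField (hp n)
    simp only [he]
    exact pair_simil_mem_of_test s hφ
  · have h2 : Tendsto (fun n => pair (p n).fst (p n).snd) atTop (𝓝 (pair v q)) := hlim
    rw [tendsto_pair_iff] at h2 ⊢
    refine ⟨((simil N k lam s).continuous.tendsto v).comp h2.1, ?_⟩
    simp only [similGrad]
    refine (((dilation k (Euc N) _ (Real.exp_pos _)).continuous.tendsto _).comp
      (Tendsto.sub ?_ (Tendsto.const_smul ?_ _))).const_smul _
    · exact ((multiplier _ (gaussMul N (Euc N))).continuous.tendsto q).comp h2.2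
    · exact ((multiplier _ (gaussVec N)).continuous.tendsto v).comp h2.1

/-- The adjoint of the similarity transform, on functions. -/
def simDual (N k : ℕ) (lam s : ℝ) (ψ : Euc N → ℝ) : Euc N → ℝ :=
  gaussDil (Real.exp (-(s * ((mExp N k lam - ((N : ℝ) - 2) / 2) / 2)))) (1 / 8)
    (Real.exp (s / 2)) ψ

/-- The Jacobian e^{sN/2} turns the exponent (1+m)/2 + N/4 into (1+m)/2 - N/4, which is half the
degree of homogeneity of h. -/
lemma simAmp_mul (s : ℝ) : simAmp N k lam s * (Real.exp (-(s / 2)) ^ N)⁻¹ =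
    Real.exp (-(s * ((mExp N k lam - ((N : ℝ) - 2) / 2) / 2))) := by
  rw [simAmp, ← Real.exp_nat_mul, ← Real.exp_neg, ← Real.exp_add]
  congr 1
  ring

lemma exp_smul_exp_neg_smul (s : ℝ) (x : Euc N) :
    Real.exp (s / 2) • Real.exp (-(s / 2)) • x = x := by
  rw [smul_smul, ← Real.exp_add, add_neg_cancel, Real.exp_zero, one_smul]

lemma inner_simil (s : ℝ) (f : L2 N k) {ψ : Euc N → ℝ} (h : IsTest N k ψ) :
    inner ℝ (simil N k lam s f) h.toL2 =
      ∫ y, f y * simDual N k lam s ψ y ∂(cornerMeasure N k) := by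
  have h1 := integral_comp_smul (k := k) (Real.exp_pos (-(s / 2))) fun y : Euc N =>
    simAmp N k lam s * (Real.exp (-(1 / 8 * ‖y‖ ^ 2)) * f y) * ψ (Real.exp (s / 2) • y)
  rw [inner_toL2]
  calc ∫ x, simil N k lam s f x * ψ x ∂(cornerMeasure N k) = _ := by
        refine Eq.trans (integral_congr_ae ?_) h1
        filter_upwards [coeFn_simil (lam := lam) s f] with x hx
        rw [hx, exp_smul_exp_neg_smul]
    _ = _ := by
        rw [smul_eq_mul, ← integral_const_mul]
        congr 1
        ext y
        rw [simDual, gaussDil, ← simAmp_mul]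
        ring

lemma gradOp_simDual (s : ℝ) {ψ : Euc N → ℝ} (h : IsTest N k ψ) (y : Euc N) :
    gradOp (oscField N k lam) (simDual N k lam s ψ) y =
      (Real.exp (-(s * ((mExp N k lam - ((N : ℝ) - 2) / 2) / 2))) *
        Real.exp (-(1 / 8 * ‖y‖ ^ 2)) * Real.exp (s / 2)) •
        gradOp (hardyField N k lam) ψ (Real.exp (s / 2) • y) := by
  rw [oscField_eq, simDual, gradOp_gaussDil h.differentiable _ _ (Real.exp_pos _), gaussDil]
  module

/-- Half of Euler's operator. -/
def eulerHalf (N k : ℕ) (lam : ℝ) (ψ : Euc N → ℝ) (z : Euc N) : ℝ :=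
  1 / 2 * inner ℝ z (gradOp (hardyField N k lam) ψ z)

lemma continuous_eulerHalf {ψ : Euc N → ℝ} (h : IsTest N k ψ) :
    Continuous (eulerHalf N k lam ψ) :=
  (continuous_id.inner (h.continuous_gradOp continuousOn_hardyField)).const_mul _

lemma eulerHalf_of_notMem {ψ : Euc N → ℝ} {z : Euc N} (hz : z ∉ tsupport ψ) :
    eulerHalf N k lam ψ z = 0 := by
  rw [eulerHalf, gradOp_of_notMem_tsupport hz, inner_zero_right, mul_zero]

lemma memLp_simDual_eulerHalf (s : ℝ) {ψ : Euc N → ℝ} (h : IsTest N k ψ) :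
    MemLp (simDual N k lam s (eulerHalf N k lam ψ)) 2 (cornerMeasure N k) := by
  have hc := continuous_eulerHalf (lam := lam) h
  have h1 : Continuous (simDual N k lam s (eulerHalf N k lam ψ)) := by
    unfold simDual
    unfold gaussDil
    fun_prop
  have h2 : HasCompactSupport (eulerHalf N k lam ψ) :=
    HasCompactSupport.intro h.compact fun z hz => eulerHalf_of_notMem hz
  have h3 : HasCompactSupport (simDual N k lam s (eulerHalf N k lam ψ)) :=
    (h2.comp_homeomorph (Homeomorph.smulOfNeZero (Real.exp (s / 2)) (Real.exp_ne_zero _))).mul_left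
  exact (h1.memLp_of_hasCompactSupport (μ := volume) h3).restrict _

/-- This is the change of variables in weak form. For q = Sv the first term on the right is the form
of L, the last integral is the s-derivative of the dual transform, and e^s = dt/ds. -/
lemma inner_similGrad (s : ℝ) (v : L2 N k) (q : VL2 N k) {ψ : Euc N → ℝ} (h : IsTest N k ψ)
    (h' : IsTest N k (simDual N k lam s ψ)) :
    Real.exp s * inner ℝ (similGrad N k lam s v q) (h.gradL2 (continuousOn_hardyField (lam := lam))) =
      inner ℝ q (h'.gradL2 (continuousOn_oscField (lam := lam))) -
        ∫ y, v y * simDual N k lam s (eulerHalf N k lam ψ) y ∂(cornerMeasure N k) := by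
  set G : Euc N → ℝ := fun y =>
    inner ℝ ((simAmp N k lam s * Real.exp (-(s / 2)) * Real.exp (-(1 / 8 * ‖y‖ ^ 2))) •
      (q y - (1 / 2 * v y) • y)) (gradOp (hardyField N k lam) ψ (Real.exp (s / 2) • y))
  have e1 : inner ℝ (similGrad N k lam s v q) (h.gradL2 (continuousOn_hardyField (lam := lam))) =
      (Real.exp (-(s / 2)) ^ N)⁻¹ • ∫ y, G y ∂(cornerMeasure N k) := by
    rw [L2.inner_def, ← integral_comp_smul (Real.exp_pos (-(s / 2)))]
    refine integral_congr_ae ?_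
    filter_upwards [coeFn_similGrad (lam := lam) s v q,
      h.coeFn_gradL2 (continuousOn_hardyField (lam := lam))] with x hx hx'
    simp only [G]
    rw [hx, hx', exp_smul_exp_neg_smul]
  have e2 : inner ℝ q (h'.gradL2 (continuousOn_oscField (lam := lam))) =
      ∫ y, inner ℝ (q y) (gradOp (oscField N k lam) (simDual N k lam s ψ) y)
        ∂(cornerMeasure N k) := by
    rw [L2.inner_def]
    refine integral_congr_ae ?_
    filter_upwards [h'.coeFn_gradL2 (continuousOn_oscField (lam := lam))] with x hx
    rw [hx]
  have i1 : Integrable (fun y => inner ℝ (q y)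
      (gradOp (oscField N k lam) (simDual N k lam s ψ) y)) (cornerMeasure N k) := by
    refine (L2.integrable_inner (𝕜 := ℝ) q
      (h'.gradL2 (continuousOn_oscField (lam := lam)))).congr ?_
    filter_upwards [h'.coeFn_gradL2 (continuousOn_oscField (lam := lam))] with x hx
    rw [hx]
  have i2 : Integrable (fun y => v y * simDual N k lam s (eulerHalf N k lam ψ) y)
      (cornerMeasure N k) := (Lp.memLp v).integrable_mul (memLp_simDual_eulerHalf s h)
  rw [e1, e2, ← integral_sub i1 i2, smul_eq_mul, ← integral_const_mul, ← integral_const_mul]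
  congr 1
  ext y
  have e3 : Real.exp s = Real.exp (s / 2) * Real.exp (s / 2) := by
    rw [← Real.exp_add]; ring_nf
  have e4 : Real.exp (s / 2) * Real.exp (-(s / 2)) = 1 := by
    rw [← Real.exp_add]; simp
  simp only [G]
  rw [gradOp_simDual s h, inner_smul_left, inner_sub_left, inner_smul_left, inner_smul_right,
    simDual, gaussDil, eulerHalf, inner_smul_left, ← simAmp_mul]
  simp only [conj_trivial]
  rw [e3]
  linear_combination (Real.exp (s / 2) * (Real.exp (-(s / 2)) ^ N)⁻¹ * simAmp N k lam s *
    Real.exp (-(1 / 8 * ‖y‖ ^ 2)) * (inner ℝ (q y) (gradOp (hardyField N k lam) ψ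
      (Real.exp (s / 2) • y)) - 1 / 2 * v y * inner ℝ y (gradOp (hardyField N k lam) ψ
      (Real.exp (s / 2) • y)))) * e4

/-- The amplitude decays with half the degree d of h, so differentiation gives (z·∇ψ - dψ)/2, which
is half of z·(∇ψ - ψV) by `inner_self_gradOp`. -/
lemma hasDerivAt_simDual (hk : k ≤ N) {ψ : Euc N → ℝ} (h : IsTest N k ψ) (y : Euc N) (s : ℝ) :
    HasDerivAt (fun s => simDual N k lam s ψ y) (simDual N k lam s (eulerHalf N k lam ψ) y) s := by
  set δ := (mExp N k lam - ((N : ℝ) - 2) / 2) / 2 with hδ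
  have h1 : HasDerivAt (fun s : ℝ => Real.exp (s / 2) • y)
      ((Real.exp (s / 2) * (1 / 2)) • y) s :=
    (((hasDerivAt_id s).div_const 2).exp).smul_const y
  have h2 : HasDerivAt (fun s : ℝ => ψ (Real.exp (s / 2) • y))
      (fderiv ℝ ψ (Real.exp (s / 2) • y) ((Real.exp (s / 2) * (1 / 2)) • y)) s :=
    (h.differentiable _).hasFDerivAt.comp_hasDerivAt s h1
  have h3 : HasDerivAt (fun s : ℝ => Real.exp (-(s * δ)) * Real.exp (-(1 / 8 * ‖y‖ ^ 2)))
      (Real.exp (-(s * δ)) * (-(1 * δ)) * Real.exp (-(1 / 8 * ‖y‖ ^ 2))) s :=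
    ((((hasDerivAt_id s).mul_const δ).neg).exp).mul_const _
  have h4 : HasDerivAt (fun s => simDual N k lam s ψ y) _ s := h3.mul h2
  refine h4.congr_deriv ?_
  rw [simDual, gaussDil, eulerHalf, inner_self_gradOp hk h, map_smul, map_smul, ← hδ, smul_eq_mul,
    smul_eq_mul]
  have : mExp N k lam - ((N : ℝ) - 2) / 2 = 2 * δ := by rw [hδ]; ring
  rw [this]
  ring

/-- The function f is merely in L², so the dependence on s is placed on the smooth factor before
differentiating under the integral. -/
lemma hasDerivAt_integral_simDual (hk : k ≤ N) {ψ : Euc N → ℝ} (h : IsTest N k ψ) (f : L2 N k)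
    (s : ℝ) :
    HasDerivAt (fun s => ∫ y, f y * simDual N k lam s ψ y ∂(cornerMeasure N k))
      (∫ y, f y * simDual N k lam s (eulerHalf N k lam ψ) y ∂(cornerMeasure N k)) s := by
  set δ := (mExp N k lam - ((N : ℝ) - 2) / 2) / 2 with hδ
  have hc := continuous_eulerHalf (lam := lam) h
  obtain ⟨M, hM⟩ := HasCompactSupport.exists_bound_of_continuous
    (HasCompactSupport.intro h.compact fun z hz => eulerHalf_of_notMem (lam := lam) hz) hc
  have hM0 : 0 ≤ M := (norm_nonneg _).trans (hM 0)
  obtain ⟨R, hR⟩ := h.compact.isBounded.subset_closedBall (0 : Euc N)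
  have htest : ∀ s, IsTest N k (simDual N k lam s ψ) := fun s => h.gaussDil _ _ (Real.exp_pos _)
  -- For |t - s| < 1 the amplitude e^{-tδ} is at most e^{(|s|+1)|δ|}, and the support of ψ(e^{t/2}·)
  -- lies in the ball of radius e^{-(s-1)/2} R.
  set M' := Real.exp ((|s| + 1) * |δ|) * M
  set R' := Real.exp (-((s - 1) / 2)) * R
  refine (hasDerivAt_integral_of_dominated_loc_of_deriv_le (s := Metric.ball s 1)
    (bound := fun y => ‖f y‖ * (Metric.closedBall (0 : Euc N) R').indicator (fun _ => M') y)
    (F := fun s y => f y * simDual N k lam s ψ y)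
    (F' := fun s y => f y * simDual N k lam s (eulerHalf N k lam ψ) y)
    (Metric.ball_mem_nhds s one_pos) ?_ ?_ ?_ ?_ ?_ ?_).2
  · exact Eventually.of_forall fun s => (Lp.aestronglyMeasurable f).mul
      (htest s).continuous.aestronglyMeasurable
  · exact (Lp.memLp f).integrable_mul (htest s).memLp
  · exact (Lp.aestronglyMeasurable f).mul (memLp_simDual_eulerHalf s h).1
  · refine ae_of_all _ fun y t ht => ?_
    rw [norm_mul]
    refine mul_le_mul_of_nonneg_left ?_ (norm_nonneg _)
    have ht' : |t - s| < 1 := by rwa [Metric.mem_ball, Real.dist_eq] at ht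
    by_cases hy : y ∈ Metric.closedBall (0 : Euc N) R'
    · rw [indicator_of_mem hy, simDual, gaussDil, norm_mul, norm_mul, Real.norm_of_nonneg
        (Real.exp_pos _).le, Real.norm_of_nonneg (Real.exp_pos _).le, ← hδ]
      refine mul_le_mul ?_ (hM _) (norm_nonneg _) (Real.exp_pos _).le
      rw [← mul_one (Real.exp ((|s| + 1) * |δ|))]
      refine mul_le_mul (Real.exp_le_exp.2 ?_) (Real.exp_le_one_iff.2 (neg_nonpos.2 (by positivity)))
        (Real.exp_pos _).le (Real.exp_pos _).le
      refine (neg_le_abs _).trans ?_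
      rw [abs_mul]
      refine mul_le_mul_of_nonneg_right ?_ (abs_nonneg _)
      have := abs_add_le (t - s) s
      rw [sub_add_cancel] at this
      linarith
    · rw [indicator_of_notMem hy, simDual, gaussDil, eulerHalf_of_notMem, mul_zero, norm_zero]
      intro hy'
      apply hy
      have h1 := hR hy'
      rw [mem_closedBall_zero_iff, norm_smul, Real.norm_of_nonneg (Real.exp_pos _).le] at h1
      rw [mem_closedBall_zero_iff]
      have h2 : Real.exp ((s - 1) / 2) ≤ Real.exp (t / 2) := by
        rw [Real.exp_le_exp]
        have := (abs_lt.1 ht').1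
        linarith
      have h3 : Real.exp ((s - 1) / 2) * ‖y‖ ≤ R :=
        (mul_le_mul_of_nonneg_right h2 (norm_nonneg _)).trans h1
      rw [show R' = (Real.exp ((s - 1) / 2))⁻¹ * R by rw [← Real.exp_neg], le_inv_mul_iff₀
        (Real.exp_pos _)]
      exact h3
  · exact (Lp.memLp f).norm.integrable_mul (memLp_const_indicator_closedBall _ _)
  · exact ae_of_all _ fun y t _ => (hasDerivAt_simDual hk h y t).const_mul (f y)

end Similarity

/-- Weak continuity of a bounded function has to be checked on a dense subspace only. -/
lemma continuousOn_inner_of_dense {X H G : Type*} [TopologicalSpace X] [NormedAddCommGroup H]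
    [InnerProductSpace ℝ H] [CompleteSpace H] [NormedAddCommGroup G] [InnerProductSpace ℝ G]
    {Γ : Submodule ℝ (WithLp 2 (H × G))} (hΓ : ∀ f : H, (∀ p ∈ Γ, inner ℝ f p.fst = 0) → f = 0)
    {w : X → H} {S : Set X} {M : ℝ} (hM : ∀ t ∈ S, ‖w t‖ ≤ M)
    (hw : ∀ p ∈ Γ, ContinuousOn (fun t => inner ℝ (w t) p.fst) S) (g : H) :
    ContinuousOn (fun t => inner ℝ (w t) g) S := by
  set K : Submodule ℝ H := Γ.map (WithLp.fstₗ 2 ℝ H G)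
  have hK : K.topologicalClosure = ⊤ := by
    rw [Submodule.topologicalClosure_eq_top_iff, Submodule.eq_bot_iff]
    intro f hf
    refine hΓ f fun p hp => ?_
    rw [real_inner_comm]
    exact hf _ (Submodule.mem_map_of_mem hp)
  have hg : g ∈ closure (K : Set H) := by
    rw [← Submodule.topologicalClosure_coe, hK]; trivial
  obtain ⟨x, hx, hlim⟩ := mem_closure_iff_seq_limit.1 hg
  have hcont : ∀ n, ContinuousOn (fun t => inner ℝ (w t) (x n)) S := by
    intro n
    obtain ⟨p, hp, he⟩ := hx n
    rw [← he]
    exact hw p hp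
  refine TendstoUniformlyOn.continuousOn (F := fun n t => inner ℝ (w t) (x n)) (p := atTop) ?_
    (Frequently.of_forall hcont)
  rw [Metric.tendstoUniformlyOn_iff]
  intro ε hε
  have h1 : Tendsto (fun n => |M| * ‖g - x n‖) atTop (𝓝 0) := by
    have := (tendsto_const_nhds (x := g)).sub hlim
    simpa using this.norm.const_mul |M|
  filter_upwards [h1.eventually (gt_mem_nhds hε)] with n hn t ht
  rw [Real.dist_eq, ← inner_sub_right]
  refine (abs_real_inner_le_norm _ _).trans_lt (lt_of_le_of_lt ?_ hn)
  exact mul_le_mul_of_nonneg_right ((hM t ht).trans (le_abs_self M)) (norm_nonneg _)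

/-! ### Solutions expressed through the transformed semigroup. -/

section Identification

variable {N k : ℕ} {lam : ℝ}

/-- The resolvent at `-1` of the Hardy operator with harmonic potential, ground energy removed. -/
def oscResolvent (N k : ℕ) (lam : ℝ) : L2 N k →L[ℝ] L2 N k :=
  relResolvent (testGraph N k (oscField N k lam))

lemma isHeatSemigroup_osc (hN : 2 ≤ N) (k : ℕ) (lam : ℝ) : IsHeatSemigroup (oscResolvent N k lam)
    (heatE (oscResolvent N k lam)) (heatD (oscResolvent N k lam)) :=
  isHeatSemigroup (isResolvent_testGraph hN continuousOn_oscField)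

lemma norm_simil_le (s : ℝ) (v : L2 N k) : ‖simil N k lam s v‖ ≤
    Real.exp (-(s * ((1 + mExp N k lam) / 2))) * ‖v‖ := by
  rw [norm_simil]
  gcongr
  exact (norm_multiplier_le _ _ _).trans (mul_le_of_le_one_left (norm_nonneg _) (norm_gaussMul_le _ _))

lemma IsTest.simDual {ψ : Euc N → ℝ} (h : IsTest N k ψ) (lam s : ℝ) :
    IsTest N k (simDual N k lam s ψ) :=
  h.gaussDil _ _ (Real.exp_pos _)

lemma inner_simil_eq (s : ℝ) (f : L2 N k) {ψ : Euc N → ℝ} (h : IsTest N k ψ) :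
    inner ℝ (simil N k lam s f) h.toL2 = inner ℝ (h.simDual lam s).toL2 f := by
  rw [inner_simil, real_inner_comm, inner_toL2]

/-- An adjoint has the norm bound of the operator; here this is obtained by pairing the dual
function with itself. -/
lemma norm_toL2_simDual_le {ψ : Euc N → ℝ} (h : IsTest N k ψ) (s : ℝ) :
    ‖(h.simDual lam s).toL2‖ ≤ Real.exp (-(s * ((1 + mExp N k lam) / 2))) * ‖h.toL2‖ := by
  set z := (h.simDual lam s).toL2
  have h1 : ‖z‖ * ‖z‖ ≤ Real.exp (-(s * ((1 + mExp N k lam) / 2))) * ‖z‖ * ‖h.toL2‖ := by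
    rw [← real_inner_self_eq_norm_mul_norm, ← inner_simil_eq s z h]
    refine (real_inner_le_norm _ _).trans ?_
    gcongr
    exact norm_simil_le s z
  rcases (norm_nonneg z).eq_or_lt with h0 | h0
  · rw [← h0]; positivity
  · nlinarith

lemma eventually_norm_toL2_simDual_le {ψ : Euc N → ℝ} (h : IsTest N k ψ) (s : ℝ) :
    ∀ᶠ t in 𝓝 s, ‖(h.simDual lam t).toL2‖ ≤
      Real.exp (-(s * ((1 + mExp N k lam) / 2))) * ‖h.toL2‖ + 1 := by
  have hc : Continuous fun t => Real.exp (-(t * ((1 + mExp N k lam) / 2))) * ‖h.toL2‖ := by fun_prop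
  filter_upwards [hc.continuousAt.eventually (gt_mem_nhds (lt_add_one _))] with t ht
  exact (norm_toL2_simDual_le h t).trans ht.le

lemma hasDerivAt_inner_toL2_simDual (hk : k ≤ N) {ψ : Euc N → ℝ} (h : IsTest N k ψ) (f : L2 N k)
    (s : ℝ) : HasDerivAt (fun s => inner ℝ (h.simDual lam s).toL2 f)
      (∫ y, f y * simDual N k lam s (eulerHalf N k lam ψ) y ∂(cornerMeasure N k)) s := by
  have := hasDerivAt_integral_simDual (lam := lam) hk h f s
  refine this.congr_of_eventuallyEq (Eventually.of_forall fun t => ?_)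
  simp only
  rw [real_inner_comm, inner_toL2]

/-- Here q is S applied to v(s) = e^{-sL}v₀, and ‖q‖² = ⟨Lv(s), v(s)⟩. The resulting bound is
locally uniform in s, as `hasDerivAt_inner_relResolvent` requires. -/
lemma exists_grad_osc (hN : 2 ≤ N) (v₀ : L2 N k) {s : ℝ} (hs : 0 < s) :
    ∃ q : VL2 N k, pair (heatE (oscResolvent N k lam) s v₀) q ∈
        (testGraph N k (oscField N k lam)).topologicalClosure ∧
      (∀ p ∈ testGraph N k (oscField N k lam),
        inner ℝ q p.snd = -inner ℝ (heatD (oscResolvent N k lam) s v₀) p.fst) ∧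
      ‖q‖ ≤ √(‖heatD (oscResolvent N k lam) s v₀‖ * ‖heatE (oscResolvent N k lam) s v₀‖) := by
  obtain ⟨q, hq, hp⟩ := exists_of_relResolvent_eq ((isHeatSemigroup_osc hN k lam).resolvent_sub s hs v₀)
  have hp' : ∀ p ∈ (testGraph N k (oscField N k lam)).topologicalClosure,
      inner ℝ q p.snd = -inner ℝ (heatD (oscResolvent N k lam) s v₀) p.fst := by
    intro p hpm
    have := hp p hpm
    rw [inner_sub_left] at this
    linarith
  refine ⟨q, hq, fun p h => hp' p (Submodule.le_topologicalClosure _ h), Real.le_sqrt_of_sq_le ?_⟩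
  have h1 := hp' _ hq
  rw [WithLp.toLp_fst, WithLp.toLp_snd, real_inner_self_eq_norm_sq] at h1
  rw [h1]
  exact (neg_le_abs _).trans (abs_real_inner_le_norm _ _)

lemma continuousOn_inner_simil (hN : 2 ≤ N) (hk : k ≤ N) (v₀ : L2 N k) {ψ : Euc N → ℝ}
    (h : IsTest N k ψ) :
    ContinuousOn (fun s => inner ℝ (simil N k lam s (heatE (oscResolvent N k lam) s v₀)) h.toL2)
      (Ici 0) := by
  intro s hs
  simp only [inner_simil_eq]
  change Tendsto _ _ _
  exact tendsto_inner_of_weak ((eventually_norm_toL2_simDual_le h s).filter_mono nhdsWithin_le_nhds)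
    ((hasDerivAt_inner_toL2_simDual hk h _ s).continuousAt.tendsto.mono_left nhdsWithin_le_nhds)
    ((isHeatSemigroup_osc hN k lam).continuousOn v₀ s hs)

/-- In the product rule the semigroup contributes the form of L and the dual transform contributes
Euler's operator; `inner_similGrad` merges them into the form of A_λ. -/
lemma hasDerivAt_inner_simil (hN : 2 ≤ N) (hk : k ≤ N) (v₀ : L2 N k) {ψ : Euc N → ℝ}
    (h : IsTest N k ψ) {s : ℝ} (hs : 0 < s) {q : VL2 N k}
    (hq : ∀ p ∈ testGraph N k (oscField N k lam),
      inner ℝ q p.snd = -inner ℝ (heatD (oscResolvent N k lam) s v₀) p.fst) :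
    HasDerivAt (fun s => inner ℝ (simil N k lam s (heatE (oscResolvent N k lam) s v₀)) h.toL2)
      (-(Real.exp s * inner ℝ (similGrad N k lam s (heatE (oscResolvent N k lam) s v₀) q)
        (h.gradL2 (continuousOn_hardyField (lam := lam))))) s := by
  simp only [inner_simil_eq]
  have h1 := hasDerivAt_inner_of_weak (eventually_norm_toL2_simDual_le (lam := lam) h s)
    (hasDerivAt_inner_toL2_simDual hk h _ s).continuousAt.tendsto
    (hasDerivAt_inner_toL2_simDual hk h (heatE (oscResolvent N k lam) s v₀) s)
    ((isHeatSemigroup_osc hN k lam).hasDerivAt s hs v₀)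
  refine h1.congr_deriv ?_
  have h2 := hq _ ((h.simDual lam s).pair_mem continuousOn_oscField)
  rw [WithLp.toLp_fst, WithLp.toLp_snd] at h2
  rw [inner_similGrad s _ q h (h.simDual lam s), h2, real_inner_comm]
  ring

/-- The right-hand side is only shown to be a bounded weak solution in t; `IsSolution.eq_of_weak`
then identifies it with u. -/
lemma IsSolution.eq_simil (hN : 2 ≤ N) (hk : k ≤ N) (hlam : lam ≤ hardyConst N k)
    {u₀ : L2 N k} {u : ℝ → L2 N k} (hu : IsSolution lam u₀ u) {v₀ : L2 N k}
    (h0 : simil N k lam 0 v₀ = u₀) {t : ℝ} (ht : 0 ≤ t) :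
    u t = simil N k lam (Real.log (1 + t))
      (heatE (oscResolvent N k lam) (Real.log (1 + t)) v₀) := by
  set E := heatE (oscResolvent N k lam)
  set D := heatD (oscResolvent N k lam)
  have hE : IsHeatSemigroup (oscResolvent N k lam) E D := isHeatSemigroup_osc hN k lam
  have hm : 0 ≤ mExp N k lam := Real.sqrt_nonneg _
  have hlog : ∀ t : ℝ, 0 ≤ t → 0 ≤ Real.log (1 + t) := fun t ht => Real.log_nonneg (by linarith)
  have hlog' : ∀ t : ℝ, 0 < t → 0 < Real.log (1 + t) := fun t ht => Real.log_pos (by linarith)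
  have hdlog : ∀ t : ℝ, 0 < t → HasDerivAt (fun t => Real.log (1 + t)) (1 + t)⁻¹ t := by
    intro t ht
    have := ((hasDerivAt_id t).const_add 1).log (by simp only [id]; positivity)
    simpa using this
  have hclog : ContinuousOn (fun t : ℝ => Real.log (1 + t)) (Ici 0) :=
    ContinuousOn.log (by fun_prop) fun t ht => by
      have : (0 : ℝ) ≤ t := ht
      positivity
  choose! q hq1 hq2 hq3 using fun s (hs : 0 < s) => exists_grad_osc (lam := lam) hN v₀ hs
  have hM : ∀ t, 0 ≤ t → ‖simil N k lam (Real.log (1 + t)) (E (Real.log (1 + t)) v₀)‖ ≤ ‖v₀‖ := by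
    intro t ht
    refine (norm_simil_le _ _).trans ?_
    have h1 := hE.norm_le _ (hlog t ht) v₀
    refine (mul_le_of_le_one_left (norm_nonneg _) ?_).trans h1
    rw [Real.exp_le_one_iff, neg_nonpos]
    have := hlog t ht
    positivity
  refine (hu.eq_of_weak hN hk hlam (fun t ht => hu.norm_le hN hk hlam ht) hM ?_ ?_ ?_ ht).symm
  · rw [add_zero, Real.log_one, hE.zero]
    exact h0
  · refine continuousOn_inner_of_dense
      (eq_zero_of_inner_testGraph hN (continuousOn_hardyField (lam := lam))) (fun t ht => hM t ht) ?_
    intro p hp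
    obtain ⟨ψ, h, rfl⟩ := exists_of_mem_testGraph continuousOn_hardyField hp
    exact (continuousOn_inner_simil hN hk v₀ h).comp hclog fun t ht => hlog t ht
  · intro g t ht
    refine hasDerivAt_inner_relResolvent
      (W := fun t => similGrad N k lam (Real.log (1 + t)) (E (Real.log (1 + t)) v₀)
        (q (Real.log (1 + t)))) ?_ ?_ ?_ g ht
    · exact fun t ht => pair_simil_mem _ (hq1 _ (hlog' t ht))
    · intro t ht
      -- The gradient q(s) is merely chosen for each s, so local boundedness comes from this
      -- continuous majorant.
      set G : ℝ → ℝ := fun s => simAmp N k lam s * Real.exp (-(s / 2)) *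
        (Real.exp (-(s / 2)) ^ (-(N : ℝ) / 2) *
          (√(‖D s v₀‖ * ‖E s v₀‖) + 1 / 2 * (‖gaussVec N‖ * ‖E s v₀‖)))
      have hcE : ContinuousAt (fun s => E s v₀) (Real.log (1 + t)) :=
        (hE.hasDerivAt _ (hlog' t ht) v₀).continuousAt
      have hcD : ContinuousAt (fun s => D s v₀) (Real.log (1 + t)) :=
        (hE.continuousOn_deriv v₀).continuousAt (Ioi_mem_nhds (hlog' t ht))
      have hG : ContinuousAt G (Real.log (1 + t)) := by
        have h1 : ContinuousAt (fun s : ℝ => simAmp N k lam s * Real.exp (-(s / 2)))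
            (Real.log (1 + t)) := by
          unfold simAmp
          fun_prop
        have h2 : ContinuousAt (fun s : ℝ => Real.exp (-(s / 2)) ^ (-(N : ℝ) / 2))
            (Real.log (1 + t)) :=
          ContinuousAt.rpow_const (by fun_prop) (Or.inl (Real.exp_ne_zero _))
        exact h1.mul (h2.mul ((hcD.norm.mul hcE.norm).sqrt.add
          ((hcE.norm.const_mul _).const_mul _)))
      have hG' : ContinuousAt (fun t => G (Real.log (1 + t))) t :=
        hG.comp (f := fun t => Real.log (1 + t)) (hdlog t ht).continuousAt
      refine ⟨G (Real.log (1 + t)) + 1, ?_⟩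
      filter_upwards [hG'.eventually (gt_mem_nhds (lt_add_one _)), Ioi_mem_nhds ht] with s hs hs0
      refine (norm_similGrad_le _ _ _).trans (le_trans ?_ hs.le)
      have := (simAmp_pos (N := N) (k := k) (lam := lam) (Real.log (1 + s))).le
      simp only [G]
      gcongr
      exact hq3 _ (hlog' s hs0)
    · intro p hp t ht
      obtain ⟨ψ, h, rfl⟩ := exists_of_mem_testGraph continuousOn_hardyField hp
      have h1 := (hasDerivAt_inner_simil hN hk v₀ h (hlog' t ht) (hq2 _ (hlog' t ht))).comp t
        (hdlog t ht)
      refine h1.congr_deriv ?_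
      -- The factor e^s = 1 + t cancels the derivative 1/(1+t) of s = log(1+t).
      rw [Real.exp_log (by positivity), WithLp.toLp_snd]
      field_simp
      rfl

end Identification

/-! ### Dependence of the similarity transform on s. -/

section Similarity

variable {N k : ℕ} {lam : ℝ}

lemma simil_add (s δ : ℝ) (v : L2 N k) : simil N k lam (s + δ) v = simAmp N k lam s •
    dilation k ℝ (Real.exp (-(s / 2))) (Real.exp_pos _) (simil N k lam δ v) := by
  refine Lp.ext ?_
  filter_upwards [coeFn_simil (lam := lam) (s + δ) v,
    Lp.coeFn_smul (simAmp N k lam s)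
      (dilation k ℝ (Real.exp (-(s / 2))) (Real.exp_pos _) (simil N k lam δ v)),
    coeFn_dilation (Real.exp_pos (-(s / 2))) (simil N k lam δ v),
    (quasiMeasurePreserving_smul (Real.exp_pos (-(s / 2)))).ae (coeFn_simil (lam := lam) δ v)]
    with x h1 h2 h3 h4
  have e1 : Real.exp (-(δ / 2)) • Real.exp (-(s / 2)) • x = Real.exp (-((s + δ) / 2)) • x := by
    rw [smul_smul, ← Real.exp_add]
    ring_nf
  have e2 : simAmp N k lam (s + δ) = simAmp N k lam s * simAmp N k lam δ := by
    rw [simAmp, simAmp, simAmp, ← Real.exp_add]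
    ring_nf
  rw [h1, h2, Pi.smul_apply, h3, h4, e1, e2, smul_eq_mul]
  ring

/-- A shift by δ at time s is a rescaled shift at time 0, with the full decay factor. Thus replacing
log(1+t) by log t costs o(t^{-(1+m)/2}). -/
lemma norm_simil_add_sub (s δ : ℝ) (v : L2 N k) :
    ‖simil N k lam (s + δ) v - simil N k lam s v‖ =
      Real.exp (-(s * ((1 + mExp N k lam) / 2))) * ‖simil N k lam δ v - simil N k lam 0 v‖ := by
  have h := simil_add (lam := lam) s 0 v
  rw [add_zero] at h
  rw [simil_add, h, ← smul_sub, ← map_sub, norm_smul, norm_dilation,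
    Real.norm_of_nonneg (simAmp_pos s).le, ← mul_assoc, simAmp, ← Real.exp_mul, ← Real.exp_add]
  congr 2
  ring

/-- The similarity transform is strongly continuous: it is weakly continuous, and the norms
converge. -/
lemma tendsto_simil (hN : 2 ≤ N) (hk : k ≤ N) (v : L2 N k) :
    Tendsto (fun s => simil N k lam s v) (𝓝 0) (𝓝 (simil N k lam 0 v)) := by
  set S : Set ℝ := Icc (-1) 1
  have hS : S ∈ 𝓝 (0 : ℝ) := Icc_mem_nhds (by norm_num) (by norm_num)
  have hb : ∀ s ∈ S, ‖simil N k lam s v‖ ≤ Real.exp ((1 + mExp N k lam) / 2) * ‖v‖ := by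
    intro s hs
    refine (norm_simil_le s v).trans (mul_le_mul_of_nonneg_right (Real.exp_le_exp.2 ?_)
      (norm_nonneg _))
    have hm : 0 ≤ mExp N k lam := Real.sqrt_nonneg _
    nlinarith [hs.1]
  have hw : ∀ g, ContinuousOn (fun s => inner ℝ (simil N k lam s v) g) S := by
    refine continuousOn_inner_of_dense
      (eq_zero_of_inner_testGraph hN (continuousOn_hardyField (lam := lam))) hb fun p hp s _ => ?_
    obtain ⟨ψ, h, rfl⟩ := exists_of_mem_testGraph continuousOn_hardyField hp
    simp only [WithLp.toLp_fst, inner_simil_eq]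
    exact (hasDerivAt_inner_toL2_simDual hk h v s).continuousAt.continuousWithinAt
  have h1 : Tendsto (fun s => inner ℝ (simil N k lam s v) (simil N k lam 0 v)) (𝓝 0)
      (𝓝 (inner ℝ (simil N k lam 0 v) (simil N k lam 0 v))) :=
    ((hw (simil N k lam 0 v)).continuousAt hS).tendsto
  have h2 : Tendsto (fun s => ‖simil N k lam s v‖) (𝓝 0) (𝓝 ‖simil N k lam 0 v‖) := by
    have hc : Continuous fun s => ‖simil N k lam s v‖ := by
      simp only [norm_simil]
      fun_prop
    exact hc.tendsto 0
  have h3 : Tendsto (fun s => ‖simil N k lam s v - simil N k lam 0 v‖ ^ 2) (𝓝 0) (𝓝 0) := by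
    have h4 := ((h2.pow 2).sub (h1.const_mul 2)).add_const (‖simil N k lam 0 v‖ ^ 2)
    have e : ‖simil N k lam 0 v‖ ^ 2 - 2 * inner ℝ (simil N k lam 0 v) (simil N k lam 0 v) +
        ‖simil N k lam 0 v‖ ^ 2 = 0 := by
      rw [real_inner_self_eq_norm_sq]; ring
    rw [e] at h4
    refine h4.congr fun s => ?_
    rw [norm_sub_sq_real]
  rw [tendsto_iff_norm_sub_tendsto_zero]
  have h5 := h3.sqrt
  simpa [Real.sqrt_sq (norm_nonneg _)] using h5

lemma exp_neg_log_mul {x : ℝ} (hx : 0 < x) (a : ℝ) : Real.exp (-(Real.log x * a)) = x ^ (-a) := by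
  rw [Real.rpow_def_of_pos hx, mul_neg]

end Similarity

/-! ### The ground state under the semigroup and the transform. -/

section GroundState

variable {N k : ℕ} {lam : ℝ}

/-- The ground state as an element of `L²`. -/
def alphaL2 (hN : 2 ≤ N) (hk : k ≤ N) (lam : ℝ) : L2 N k := (memLp_alpha (lam := lam) hN hk).toLp _

lemma coeFn_alphaL2 (hN : 2 ≤ N) (hk : k ≤ N) (lam : ℝ) :
    alphaL2 hN hk lam =ᵐ[cornerMeasure N k] alpha N k lam := MemLp.coeFn_toLp _

lemma neBot_ae_corner (N k : ℕ) : NeBot (ae (cornerMeasure N k)) := by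
  rw [ae_neBot, Ne, Measure.restrict_eq_zero]
  refine ((isOpen_corner N k).measure_pos volume ⟨WithLp.toLp 2 fun _ => 1, ?_⟩).ne'
  intro i _
  exact one_pos

lemma norm_pos_of_ae_pos {f : L2 N k} (h : ∀ᵐ x ∂(cornerMeasure N k), 0 < f x) : 0 < ‖f‖ := by
  rw [norm_pos_iff]
  rintro rfl
  have := neBot_ae_corner N k
  obtain ⟨x, h1, h2⟩ := (h.and (Lp.coeFn_zero ℝ 2 (cornerMeasure N k))).exists
  rw [h2] at h1
  exact lt_irrefl _ h1

lemma norm_alphaL2_pos (hN : 2 ≤ N) (hk : k ≤ N) (lam : ℝ) : 0 < ‖alphaL2 hN hk lam‖ := by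
  refine norm_pos_of_ae_pos ?_
  filter_upwards [coeFn_alphaL2 hN hk lam, ae_mem_domain hN k] with x hx h
  rw [hx]
  exact alpha_pos h

lemma norm_gaussMul_alphaL2_pos (hN : 2 ≤ N) (hk : k ≤ N) (lam : ℝ) :
    0 < ‖multiplier (cornerMeasure N k) (gaussMul N ℝ) (alphaL2 hN hk lam)‖ := by
  refine norm_pos_of_ae_pos ?_
  filter_upwards [coeFn_multiplier (cornerMeasure N k) (gaussMul N ℝ) (alphaL2 hN hk lam),
    coeFn_alphaL2 hN hk lam, ae_mem_domain hN k] with x h1 hx h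
  rw [h1, gaussMul_apply, hx]
  exact mul_pos (Real.exp_pos _) (alpha_pos h)

lemma heatE_alphaL2 (hN : 2 ≤ N) (hk : k ≤ N) (lam : ℝ) {s : ℝ} (hs : 0 ≤ s) :
    heatE (oscResolvent N k lam) s (alphaL2 hN hk lam) = alphaL2 hN hk lam :=
  (isHeatSemigroup_osc hN k lam).apply_eq_self _
    (relResolvent_eq_self_iff.2 (pair_alpha_mem hN hk)) s hs

lemma tendsto_heatE_zero (hN : 2 ≤ N) (hk : k ≤ N) {w : L2 N k}
    (hw : inner ℝ (alphaL2 hN hk lam) w = 0) :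
    Tendsto (fun s => heatE (oscResolvent N k lam) s w) atTop (𝓝 0) := by
  refine (isHeatSemigroup_osc hN k lam).tendsto_zero w fun y hy => ?_
  obtain ⟨c, rfl⟩ := exists_eq_smul_of_pair_mem hN hk (relResolvent_eq_self_iff.1 hy)
  rw [inner_smul_left]
  exact mul_eq_zero_of_right _ hw

/-- The product e^{|x|²/8} α is the homogeneous function h. -/
lemma alpha_smul (hk : k ≤ N) {ρ : ℝ} (hρ : 0 < ρ) (x : Euc N) :
    Real.exp (‖ρ • x‖ ^ 2 / 8) * alpha N k lam (ρ • x) =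
      ρ ^ (mExp N k lam - ((N : ℝ) - 2) / 2) * (Real.exp (‖x‖ ^ 2 / 8) * alpha N k lam x) := by
  have h1 : ∀ y : Euc N, Real.exp (‖y‖ ^ 2 / 8) * Real.exp (-‖y‖ ^ 2 / 8) = 1 := fun y => by
    rw [← Real.exp_add, neg_div, add_neg_cancel, Real.exp_zero]
  have h2 : (∏ i ∈ Finset.univ.filter (fun i : Fin N => N ≤ (i : ℕ) + k), (ρ • x) i) / ‖ρ • x‖ ^ k =
      (∏ i ∈ Finset.univ.filter (fun i : Fin N => N ≤ (i : ℕ) + k), x i) / ‖x‖ ^ k := by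
    simp only [PiLp.smul_apply, smul_eq_mul]
    rw [Finset.prod_mul_distrib, Finset.prod_const, card_filter_corner hk, norm_smul,
      Real.norm_of_nonneg hρ.le, mul_pow, mul_div_mul_left _ _ (pow_ne_zero k hρ.ne')]
  simp only [alpha]
  rw [h2, ← mul_assoc, ← mul_assoc, h1, norm_smul, Real.norm_of_nonneg hρ.le,
    Real.mul_rpow hρ.le (norm_nonneg _)]
  linear_combination -(ρ ^ (mExp N k lam - ((N : ℝ) - 2) / 2) *
    ‖x‖ ^ (mExp N k lam - ((N : ℝ) - 2) / 2) *
    ((∏ i ∈ Finset.univ.filter (fun i : Fin N => N ≤ (i : ℕ) + k), x i) / ‖x‖ ^ k)) * h1 x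

/-- The profile is the transform of βα at s = log t, while the solution is a transform at s =
log(1+t). -/
lemma coeFn_simil_alphaL2 (hN : 2 ≤ N) (hk : k ≤ N) (u₀ : L2 N k) {t : ℝ} (ht : 0 < t) :
    beta lam u₀ • simil N k lam (Real.log t) (alphaL2 hN hk lam) =ᵐ[cornerMeasure N k]
      profile lam u₀ t := by
  have hρ := Real.exp_pos (-(Real.log t / 2))
  filter_upwards [Lp.coeFn_smul (beta lam u₀) (simil N k lam (Real.log t) (alphaL2 hN hk lam)),
    coeFn_simil (lam := lam) (Real.log t) (alphaL2 hN hk lam),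
    (quasiMeasurePreserving_smul hρ).ae (coeFn_alphaL2 hN hk lam)] with x h1 h2 h3
  set ρ := Real.exp (-(Real.log t / 2)) with hρ'
  have hρ2 : ρ ^ 2 = t⁻¹ := by
    rw [hρ', ← Real.exp_nat_mul, ← Real.exp_log (inv_pos.2 ht), Real.log_inv]
    congr 1
    push_cast
    ring
  have h4 := alpha_smul (lam := lam) hk hρ x
  have e1 : Real.exp (-(1 / 8 * ‖ρ • x‖ ^ 2)) =
      Real.exp (-‖x‖ ^ 2 / (4 * t)) * Real.exp (‖ρ • x‖ ^ 2 / 8) := by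
    rw [← Real.exp_add, norm_smul, Real.norm_of_nonneg hρ.le, mul_pow, hρ2]
    congr 1
    field_simp
    ring
  have e2 : simAmp N k lam (Real.log t) * ρ ^ (mExp N k lam - ((N : ℝ) - 2) / 2) =
      t ^ (-(1 + mExp N k lam)) := by
    rw [simAmp, hρ', ← Real.exp_mul, ← Real.exp_add, ← exp_neg_log_mul ht]
    congr 1
    ring
  rw [h1, Pi.smul_apply, h2, h3, smul_eq_mul, profile, e1, ← e2]
  linear_combination (beta lam u₀ * simAmp N k lam (Real.log t) *
    Real.exp (-‖x‖ ^ 2 / (4 * t))) * h4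

end GroundState

/-! ### The weighted space L²(K). -/

section Weighted

variable {N k : ℕ} {lam : ℝ}

lemma memLp_weighted {u₀ : L2 N k} (h : u₀ ∈ L2K N k) :
    MemLp (fun x => u₀ x * Real.exp (‖x‖ ^ 2 / 8)) 2 (cornerMeasure N k) := by
  have hm : AEStronglyMeasurable (fun x => u₀ x * Real.exp (‖x‖ ^ 2 / 8)) (cornerMeasure N k) :=
    (Lp.aestronglyMeasurable u₀).mul (Continuous.aestronglyMeasurable (by fun_prop))
  rw [memLp_two_iff_integrable_sq hm]
  refine Integrable.congr h (ae_of_all _ fun x => ?_)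
  simp only [weightK, sq_abs, mul_pow, ← Real.exp_nat_mul]
  ring_nf

/-- Multiplication by `e^{|x|²/8}` on `L²(K)`. -/
def weighted {u₀ : L2 N k} (h : u₀ ∈ L2K N k) : L2 N k := (memLp_weighted h).toLp _

lemma coeFn_weighted {u₀ : L2 N k} (h : u₀ ∈ L2K N k) :
    weighted h =ᵐ[cornerMeasure N k] fun x => u₀ x * Real.exp (‖x‖ ^ 2 / 8) := MemLp.coeFn_toLp _

lemma norm_weighted {u₀ : L2 N k} (h : u₀ ∈ L2K N k) : ‖weighted h‖ = normK u₀ := by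
  rw [normK, ← Real.sqrt_sq (norm_nonneg (weighted h)), ← real_inner_self_eq_norm_sq, L2.inner_def]
  congr 1
  refine integral_congr_ae ?_
  filter_upwards [coeFn_weighted h] with x hx
  rw [hx, real_inner_self_eq_norm_sq, weightK, Real.norm_eq_abs, abs_mul, mul_pow,
    abs_of_pos (Real.exp_pos _), ← Real.exp_nat_mul]
  ring_nf

lemma simil_zero_weighted {u₀ : L2 N k} (h : u₀ ∈ L2K N k) :
    simil N k lam 0 (weighted h) = u₀ := by
  refine Lp.ext ?_
  filter_upwards [coeFn_simil (lam := lam) 0 (weighted h), coeFn_weighted h] with x h1 h2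
  rw [h1]
  simp only [zero_div, neg_zero, Real.exp_zero, one_smul, simAmp, zero_mul]
  rw [h2, one_mul, mul_left_comm, ← Real.exp_add]
  ring_nf
  simp

lemma integrable_mul_alpha (hN : 2 ≤ N) (hk : k ≤ N) {u₀ : L2 N k} (h : u₀ ∈ L2K N k) :
    Integrable (fun x => u₀ x * Real.exp (‖x‖ ^ 2 / 8) * alpha N k lam x) (cornerMeasure N k) :=
  (memLp_weighted h).integrable_mul (memLp_alpha hN hk)

/-- So βα is the orthogonal projection of e^{|x|²/8} u₀ onto ℝα. -/
lemma beta_eq (hN : 2 ≤ N) (hk : k ≤ N) {u₀ : L2 N k} (h : u₀ ∈ L2K N k) :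
    beta lam u₀ * ‖alphaL2 hN hk lam‖ ^ 2 = inner ℝ (alphaL2 hN hk lam) (weighted h) := by
  have h1 : ∫ x, alpha N k lam x ^ 2 ∂(cornerMeasure N k) = ‖alphaL2 hN hk lam‖ ^ 2 := by
    rw [← real_inner_self_eq_norm_sq, L2.inner_def]
    refine integral_congr_ae ?_
    filter_upwards [coeFn_alphaL2 hN hk lam] with x hx
    rw [hx, real_inner_self_eq_norm_sq, Real.norm_eq_abs, sq_abs]
  have h2 : inner ℝ (alphaL2 hN hk lam) (weighted h) =
      ∫ x, u₀ x * Real.exp (‖x‖ ^ 2 / 8) * alpha N k lam x ∂(cornerMeasure N k) := by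
    rw [L2.inner_def]
    refine integral_congr_ae ?_
    filter_upwards [coeFn_alphaL2 hN hk lam, coeFn_weighted h] with x hx hx'
    rw [hx, hx']
    simp
  have := norm_alphaL2_pos hN hk lam
  rw [beta, h1, ← h2]
  field_simp

end Weighted

/-! ### Decay rate, optimality and asymptotics. -/

section Decay

variable {N k : ℕ} {lam : ℝ}

lemma IsSolution.norm_le_rpow (hN : 2 ≤ N) (hk : k ≤ N) (hlam : lam ≤ hardyConst N k)
    {u₀ : L2 N k} (h₀ : u₀ ∈ L2K N k) {u : ℝ → L2 N k} (hu : IsSolution lam u₀ u) {t : ℝ}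
    (ht : 0 ≤ t) : ‖u t‖ ≤ (1 + t) ^ (-((1 + mExp N k lam) / 2)) * normK u₀ := by
  rw [hu.eq_simil hN hk hlam (simil_zero_weighted h₀) ht, ← norm_weighted h₀,
    ← exp_neg_log_mul (by positivity)]
  refine (norm_simil_le _ _).trans ?_
  gcongr
  exact (isHeatSemigroup_osc hN k lam).norm_le _ (Real.log_nonneg (by linarith)) _

lemma IsSolution.tendsto_profile (hN : 2 ≤ N) (hk : k ≤ N) (hlam : lam ≤ hardyConst N k)
    {u₀ : L2 N k} (h₀ : u₀ ∈ L2K N k) {u : ℝ → L2 N k} (hu : IsSolution lam u₀ u) :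
    Tendsto (fun t : ℝ => ENNReal.ofReal (t ^ ((1 + mExp N k lam) / 2)) *
      eLpNorm (fun x => u t x - profile lam u₀ t x) 2 (cornerMeasure N k)) atTop (𝓝 0) := by
  set κ := (1 + mExp N k lam) / 2 with hκ
  have hκ0 : 0 ≤ κ := by
    have : 0 ≤ mExp N k lam := Real.sqrt_nonneg _
    positivity
  set a := alphaL2 hN hk lam
  set β := beta lam u₀
  set E := heatE (oscResolvent N k lam)
  -- This is the part of the weighted datum orthogonal to the kernel, on which the semigroup tends
  -- to 0.
  set w := weighted h₀ - β • a with hw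
  have hwa : inner ℝ a w = 0 := by
    rw [hw, inner_sub_right, inner_smul_right, real_inner_self_eq_norm_sq,
      beta_eq hN hk h₀, sub_self]
  have hlog : Tendsto (fun t : ℝ => Real.log (1 + t)) atTop atTop :=
    Real.tendsto_log_atTop.comp (tendsto_atTop_add_const_left _ _ tendsto_id)
  have hratio : Tendsto (fun t : ℝ => Real.log (1 + t⁻¹)) atTop (𝓝 0) := by
    have h1 : Tendsto (fun t : ℝ => 1 + t⁻¹) atTop (𝓝 (1 + 0)) :=
      tendsto_const_nhds.add tendsto_inv_atTop_zero
    have h2 := h1.log (by norm_num)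
    simpa using h2
  have hlim : Tendsto (fun t : ℝ => ‖E (Real.log (1 + t)) w‖ +
      |β| * ‖simil N k lam (Real.log (1 + t⁻¹)) a - simil N k lam 0 a‖) atTop (𝓝 0) := by
    have h1 := ((tendsto_heatE_zero hN hk hwa).comp hlog).norm
    have h2 := (((tendsto_simil (lam := lam) hN hk a).comp hratio).sub_const
      (simil N k lam 0 a)).norm.const_mul |β|
    have h3 := h1.add h2
    simpa using h3
  have hle : ∀ᶠ t : ℝ in atTop, t ^ κ * ‖u t - β • simil N k lam (Real.log t) a‖ ≤
      ‖E (Real.log (1 + t)) w‖ +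
        |β| * ‖simil N k lam (Real.log (1 + t⁻¹)) a - simil N k lam 0 a‖ := by
    filter_upwards [eventually_gt_atTop 0] with t ht
    -- The error splits into the transform of the decaying part and the time shift log(1+t) = log t
    -- + log(1+1/t) in the transform of α.
    have e1 : u t - β • simil N k lam (Real.log t) a =
        simil N k lam (Real.log (1 + t)) (E (Real.log (1 + t)) w) +
          β • (simil N k lam (Real.log t + Real.log (1 + t⁻¹)) a - simil N k lam (Real.log t) a) := by
      have e2 : Real.log t + Real.log (1 + t⁻¹) = Real.log (1 + t) := by
        rw [← Real.log_mul (by positivity) (by positivity), mul_add, mul_inv_cancel₀ ht.ne', mul_one,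
          add_comm]
      have e3 : E (Real.log (1 + t)) a = a := heatE_alphaL2 hN hk lam (Real.log_nonneg (by linarith))
      rw [hu.eq_simil hN hk hlam (simil_zero_weighted h₀) ht.le, e2, hw, map_sub, map_sub, map_smul,
        map_smul, e3]
      module
    have h1 : ‖simil N k lam (Real.log (1 + t)) (E (Real.log (1 + t)) w)‖ ≤
        t ^ (-κ) * ‖E (Real.log (1 + t)) w‖ := by
      refine (norm_simil_le _ _).trans (mul_le_mul_of_nonneg_right ?_ (norm_nonneg _))
      rw [exp_neg_log_mul (by positivity)]
      exact Real.rpow_le_rpow_of_nonpos ht (by linarith) (by linarith)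
    have h2 : t ^ κ * t ^ (-κ) = 1 := by rw [← Real.rpow_add ht, add_neg_cancel, Real.rpow_zero]
    have h3 : 0 ≤ t ^ κ := by positivity
    rw [e1]
    refine (mul_le_mul_of_nonneg_left ((norm_add_le _ _).trans (add_le_add_left h1 _)) h3).trans
      (le_of_eq ?_)
    rw [norm_smul, norm_simil_add_sub, exp_neg_log_mul ht, ← hκ, Real.norm_eq_abs]
    linear_combination (‖E (Real.log (1 + t)) w‖ +
      |β| * ‖simil N k lam (Real.log (1 + t⁻¹)) a - simil N k lam 0 a‖) * h2
  have hreal : Tendsto (fun t : ℝ => t ^ κ * ‖u t - β • simil N k lam (Real.log t) a‖) atTop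
      (𝓝 0) := by
    refine tendsto_of_tendsto_of_tendsto_of_le_of_le' tendsto_const_nhds hlim ?_ hle
    filter_upwards [eventually_gt_atTop 0] with t ht
    positivity
  have hen := ENNReal.tendsto_ofReal hreal
  rw [ENNReal.ofReal_zero] at hen
  refine hen.congr' ?_
  filter_upwards [eventually_gt_atTop 0] with t ht
  rw [ENNReal.ofReal_mul (by positivity), Lp.norm_def, ENNReal.ofReal_toReal (Lp.eLpNorm_ne_top _)]
  congr 1
  refine eLpNorm_congr_ae ?_
  filter_upwards [Lp.coeFn_sub (u t) (β • simil N k lam (Real.log t) a),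
    coeFn_simil_alphaL2 hN hk u₀ ht] with x h1 h2
  rw [h1, Pi.sub_apply, h2]

lemma gaussMul_alphaL2_mem (hN : 2 ≤ N) (hk : k ≤ N) :
    simil N k lam 0 (alphaL2 hN hk lam) ∈ L2K N k := by
  refine (memLp_alpha (lam := lam) hN hk).integrable_sq.congr ?_
  filter_upwards [coeFn_simil (lam := lam) 0 (alphaL2 hN hk lam), coeFn_alphaL2 hN hk lam]
    with x h1 h2
  simp only [zero_div, neg_zero, Real.exp_zero, one_smul, simAmp, zero_mul] at h1
  rw [h1, h2, sq_abs, weightK, one_mul, mul_pow, ← Real.exp_nat_mul, mul_right_comm, ← Real.exp_add]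
  ring_nf
  simp

/-- For the datum e^{-|x|²/8} α the semigroup acts trivially, so the norm of the solution is exactly
c(1+t)^{-(1+m)/2} with c > 0, and no larger exponent is possible. -/
lemma isGreatest_decayExponents (hN : 2 ≤ N) (hk : k ≤ N) (hlam : lam ≤ hardyConst N k) :
    IsGreatest (decayExponents N k lam) ((1 + mExp N k lam) / 2) := by
  have hm : 0 ≤ mExp N k lam := Real.sqrt_nonneg _
  refine ⟨⟨by positivity, 1, one_pos, fun u₀ h₀ u hu t ht => ?_⟩, ?_⟩
  · rw [one_mul]
    exact hu.norm_le_rpow hN hk hlam h₀ ht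
  rintro γ ⟨-, C, -, hγ⟩
  by_contra! hlt
  set κ := (1 + mExp N k lam) / 2 with hκ
  set a := alphaL2 hN hk lam
  set c := ‖multiplier (cornerMeasure N k) (gaussMul N ℝ) a‖
  have hc : 0 < c := norm_gaussMul_alphaL2_pos hN hk lam
  obtain ⟨u, hu, -⟩ := exists_isSolution hN hk hlam (simil N k lam 0 a)
  have hbound : ∀ t : ℝ, 0 ≤ t → (1 + t) ^ (γ - κ) * c ≤ C * normK (simil N k lam 0 a) := by
    intro t ht
    have h1 := hγ _ (gaussMul_alphaL2_mem hN hk) u hu t ht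
    have ht' : 0 < 1 + t := by linarith
    rw [hu.eq_simil hN hk hlam rfl ht, heatE_alphaL2 hN hk lam (Real.log_nonneg (by linarith)),
      norm_simil, exp_neg_log_mul ht', ← hκ] at h1
    have h2 : (1 + t) ^ γ * (1 + t) ^ (-γ) = 1 := by
      rw [← Real.rpow_add ht', add_neg_cancel, Real.rpow_zero]
    have h3 := mul_le_mul_of_nonneg_left h1 (Real.rpow_nonneg ht'.le γ)
    rw [sub_eq_add_neg, Real.rpow_add ht']
    calc (1 + t) ^ γ * (1 + t) ^ (-κ) * c = (1 + t) ^ γ * ((1 + t) ^ (-κ) * c) := by ring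
      _ ≤ _ := h3
      _ = C * normK (simil N k lam 0 a) := by
        linear_combination (C * normK (simil N k lam 0 a)) * h2
  have hinf : Tendsto (fun t : ℝ => (1 + t) ^ (γ - κ) * c) atTop atTop :=
    ((tendsto_rpow_atTop (by linarith)).comp
      (tendsto_atTop_add_const_left _ 1 tendsto_id)).atTop_mul_const hc
  obtain ⟨t, h1, h2⟩ := ((eventually_ge_atTop 0).and
    (hinf.eventually_gt_atTop (C * normK (simil N k lam 0 a)))).exists
  exact absurd (hbound t h1) (not_le.2 h2)

end Decay

end HardyHeat

end

theorem theorem1p2 (N k : ℕ) (hN : 2 ≤ N) (hk : k ≤ N) (lam : ℝ)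
    (hlam : lam ≤ HardyHeat.hardyConst N k) :
    MemLp (HardyHeat.alpha N k lam) 2 (HardyHeat.cornerMeasure N k) ∧
    (∀ u₀ ∈ HardyHeat.L2K N k,
      Integrable (fun x => u₀ x * Real.exp (‖x‖ ^ 2 / 8) * HardyHeat.alpha N k lam x)
        (HardyHeat.cornerMeasure N k) ∧
      ∃ u : ℝ → HardyHeat.L2 N k,
        HardyHeat.IsSolution lam u₀ u ∧
        (∀ w : ℝ → HardyHeat.L2 N k, HardyHeat.IsSolution lam u₀ w →
          ∀ t : ℝ, 0 ≤ t → w t = u t) ∧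
        (∀ t : ℝ, 0 ≤ t →
          ‖u t‖ ≤ (1 + t) ^ (-((1 + HardyHeat.mExp N k lam) / 2)) * HardyHeat.normK u₀) ∧
        Tendsto (fun t : ℝ =>
            ENNReal.ofReal (t ^ ((1 + HardyHeat.mExp N k lam) / 2)) *
              eLpNorm (fun x => u t x - HardyHeat.profile lam u₀ t x) 2
                (HardyHeat.cornerMeasure N k))
          atTop (𝓝 0)) ∧
    IsGreatest (HardyHeat.decayExponents N k lam) ((1 + HardyHeat.mExp N k lam) / 2) := by
  refine ⟨HardyHeat.memLp_alpha hN hk, fun u₀ h₀ => ⟨HardyHeat.integrable_mul_alpha hN hk h₀, ?_⟩,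
    HardyHeat.isGreatest_decayExponents hN hk hlam⟩
  obtain ⟨u, hu, -⟩ := HardyHeat.exists_isSolution hN hk hlam u₀
  exact ⟨u, hu, fun w hw t ht => hu.unique hN hk hlam hw ht,
    fun t ht => hu.norm_le_rpow hN hk hlam h₀ ht, hu.tendsto_profile hN hk hlam h₀⟩
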